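/- Let $k$ be a commutative ring containing $\mathbb{Q}$ (i.e. a commutative $\mathbb{Q}$-algebra). All complexes of $k$-modules are $\mathbb{Z}$-graded with differential $d$ of degree $+1$ and are concentrated in degrees $\le 0$. Let $cdga$ be the category of (graded-)commutative differential graded $k$-algebras. Let $\epsilon\text{-}cdga$ be the category of commutative monoids in $k[\epsilon]$-dg-modules ($\deg\epsilon=-1$, $\epsilon^2=0$, $d\epsilon = 0$, with $\epsilon$ acting on tensor products by $\epsilon\otimes 1+1\otimes\epsilon$). Equivalently, an object is a cdga $A$ with a $k$-linear operator $\epsilon:A^n\to A^{n-1}$ such that $\epsilon^2=0$, $d\epsilon+\epsilon d=0$ and $\epsilon(ab)=\epsilon(a)b+(-1)^{n}a\,\epsilon(b)$ for $a\in A^n$; morphisms are the cdga morphisms commuting with $\epsilon$. **Proposition 1.1.** 1. Each of the categories $cdga$ and $\epsilon\text{-}cdga$ has all small limits and colimits, and carries a (Quillen) model structure with functorial factorizations in which the weak equivalences are the morphisms inducing quasi-isomorphisms of underlying complexes, the fibrations are the morphisms that are surjective in every strictly negative degree, and the cofibrations are the morphisms with the left lifting property with respect to all fibrations that are weak equivalences.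 A morphism of $\epsilon\text{-}cdga$ is a weak equivalence (resp. a fibration) if and only if its image under the forgetful functor $\epsilon\text{-}cdga\to cdga$ is one; that is, the model structure on $\epsilon\text{-}cdga$ is transferred along the forgetful functor. 2. The forgetful functor $\epsilon\text{-}cdga\to cdga$ is right Quillen: it is a right adjoint and preserves fibrations and trivial fibrations. 3. Its left adjoint is the de Rham construction $A\mapsto\epsilon(A)$. Here let $\partial: A\to\Omega^1_A$ be the universal degree $0$ derivation of $A$ into $A$-dg-modules (a map of complexes with $\partial(ab)=(-1)^{|a||b|}b\,\partial(a)+a\,\partial(b)$, universal among such). The underlying cdga of $\epsilon(A)$ is $DR(A)=\mathrm{Sym}_A(\Omega^1_A[1])$, the free commutative $A$-dg-algebra on $\Omega^1_A[1]$, where $(\Omega^1_A[1])^n=(\Omega^1_A)^{n+1}$; the operator $\epsilon$ restricts on $A$ to $\partial:A^n\to(\Omega^1_A)^n=(\Omega^1_A[1])^{n-1}\subset DR(A)^{n-1}$; and the unit of the adjunction is the canonical morphism $A\to DR(A)$. -/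

import Mathlib

open CategoryTheory CategoryTheory.Limits HomotopicalAlgebra

universe u

noncomputable section

/-! All complexes are indexed by `ℤ`, have a differential of degree `+1` and are concentrated in
degrees `≤ 0`. The sign `(-1)^p` is `p.negOnePow`. -/

/-- A commutative differential graded `k`-algebra concentrated in degrees `≤ 0`.
The multiplication `mul p q r h` is the component `A^p × A^q → A^r`, for `p + q = r`. -/
structure Cdga (k : Type u) [CommRing k] where
  /-- the underlying complex -/
  cx : CochainComplex (ModuleCat.{u} k) ℤ
  nonpos : ∀ n : ℤ, 0 < n → Subsingleton (cx.X n)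
  mul : ∀ p q r : ℤ, p + q = r → (cx.X p →ₗ[k] cx.X q →ₗ[k] cx.X r)
  one : cx.X 0
  one_mul : ∀ (p : ℤ) (a : cx.X p), mul 0 p p (by omega) one a = a
  mul_assoc : ∀ (p q r pq qr s : ℤ) (h₁ : p + q = pq) (h₂ : q + r = qr) (h₃ : pq + r = s)
    (a : cx.X p) (b : cx.X q) (c : cx.X r),
    mul pq r s h₃ (mul p q pq h₁ a b) c = mul p qr s (by omega) a (mul q r qr h₂ b c)
  mul_comm : ∀ (p q r : ℤ) (h : p + q = r) (a : cx.X p) (b : cx.X q),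
    mul p q r h a b = (p * q).negOnePow • mul q p r (by omega) b a
  d_mul : ∀ (p q r p' q' r' : ℤ) (h : p + q = r) (hp : p + 1 = p') (hq : q + 1 = q')
    (hr : r + 1 = r') (a : cx.X p) (b : cx.X q),
    cx.d r r' (mul p q r h a b) =
      mul p' q r' (by omega) (cx.d p p' a) b +
        p.negOnePow • mul p q' r' (by omega) a (cx.d q q' b)

namespace Cdga

variable {k : Type u} [CommRing k]

/-- A morphism of cdga's: a unital multiplicative map of complexes. -/
@[ext]
structure Hom (A B : Cdga k) where
  /-- the underlying map of complexes -/
  toHom : A.cx ⟶ B.cx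
  map_one : toHom.f 0 A.one = B.one
  map_mul : ∀ (p q r : ℤ) (h : p + q = r) (a : A.cx.X p) (b : A.cx.X q),
    toHom.f r (A.mul p q r h a b) = B.mul p q r h (toHom.f p a) (toHom.f q b)

instance : Category.{u} (Cdga k) where
  Hom A B := Hom A B
  id A := ⟨𝟙 A.cx, by simp, by simp⟩
  comp f g := ⟨f.toHom ≫ g.toHom, by simp [f.map_one, g.map_one],
    by simp [f.map_mul, g.map_mul]⟩

variable (k) in
/-- The forgetful functor from cdga's to complexes of `k`-modules. -/
def toComplex : Cdga k ⥤ CochainComplex (ModuleCat.{u} k) ℤ where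
  obj A := A.cx
  map f := f.toHom
  map_id _ := rfl
  map_comp _ _ := rfl

variable (k) in
/-- The quasi-isomorphisms of cdga's. -/
def quasiIso : MorphismProperty (Cdga k) :=
  (HomologicalComplex.quasiIso (ModuleCat.{u} k) (ComplexShape.up ℤ)).inverseImage (toComplex k)

variable (k) in
/-- The morphisms of cdga's that are surjective in strictly negative degrees. -/
def surjNeg : MorphismProperty (Cdga k) :=
  fun _ _ f => ∀ n : ℤ, n < 0 → Function.Surjective (f.toHom.f n)

end Cdga

/-- An `ε`-cdga: a cdga with a `k[ε]`-dg-module structure, i.e. an operator `ε` of degree `-1`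
with `ε² = 0` and `dε + εd = 0`, which is a graded derivation of the product (`ε` acts on
`A ⊗ A` through `ε ⊗ 1 + 1 ⊗ ε`). -/
structure EpsCdga (k : Type u) [CommRing k] where
  /-- the underlying cdga -/
  alg : Cdga k
  eps : ∀ p q : ℤ, q + 1 = p → (alg.cx.X p →ₗ[k] alg.cx.X q)
  eps_eps : ∀ (p q r : ℤ) (h₁ : q + 1 = p) (h₂ : r + 1 = q) (a : alg.cx.X p),
    eps q r h₂ (eps p q h₁ a) = 0
  d_eps : ∀ (p q r : ℤ) (h₁ : q + 1 = p) (h₂ : p + 1 = r) (a : alg.cx.X p),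
    alg.cx.d q p (eps p q h₁ a) + eps r p h₂ (alg.cx.d p r a) = 0
  eps_mul : ∀ (p q r p' q' r' : ℤ) (h : p + q = r) (hp : p' + 1 = p) (hq : q' + 1 = q)
    (hr : r' + 1 = r) (a : alg.cx.X p) (b : alg.cx.X q),
    eps r r' hr (alg.mul p q r h a b) =
      alg.mul p' q r' (by omega) (eps p p' hp a) b +
        p.negOnePow • alg.mul p q' r' (by omega) a (eps q q' hq b)

namespace EpsCdga

variable {k : Type u} [CommRing k]

/-- A morphism of `ε`-cdga's: a morphism of cdga's that commutes with `ε`. -/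
@[ext]
structure Hom (A B : EpsCdga k) where
  /-- the underlying morphism of cdga's -/
  algHom : A.alg ⟶ B.alg
  map_eps : ∀ (p q : ℤ) (h : q + 1 = p) (a : A.alg.cx.X p),
    algHom.toHom.f q (A.eps p q h a) = B.eps p q h (algHom.toHom.f p a)

instance : Category.{u} (EpsCdga k) where
  Hom A B := Hom A B
  id A := ⟨𝟙 A.alg, fun _ _ _ _ => rfl⟩
  comp f g := ⟨f.algHom ≫ g.algHom, fun p q h a =>
    (congrArg (g.algHom.toHom.f q) (f.map_eps p q h a)).trans
      (g.map_eps p q h (f.algHom.toHom.f p a))⟩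

variable (k) in
/-- The forgetful functor from `ε`-cdga's to cdga's. -/
def forget : EpsCdga k ⥤ Cdga k where
  obj A := A.alg
  map f := f.algHom
  map_id _ := rfl
  map_comp _ _ := rfl

variable (k) in
/-- The quasi-isomorphisms of `ε`-cdga's (on underlying complexes). -/
def quasiIso : MorphismProperty (EpsCdga k) :=
  (HomologicalComplex.quasiIso (ModuleCat.{u} k) (ComplexShape.up ℤ)).inverseImage
    (forget k ⋙ Cdga.toComplex k)

variable (k) in
/-- The morphisms of `ε`-cdga's that are surjective in strictly negative degrees. -/
def surjNeg : MorphismProperty (EpsCdga k) :=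
  fun _ _ f => ∀ n : ℤ, n < 0 → Function.Surjective (f.algHom.toHom.f n)

end EpsCdga

/-- A (left) dg-module over a cdga `A`, concentrated in degrees `≤ 0`. -/
structure DgMod {k : Type u} [CommRing k] (A : Cdga k) where
  /-- the underlying complex -/
  cx : CochainComplex (ModuleCat.{u} k) ℤ
  nonpos : ∀ n : ℤ, 0 < n → Subsingleton (cx.X n)
  act : ∀ p q r : ℤ, p + q = r → (A.cx.X p →ₗ[k] cx.X q →ₗ[k] cx.X r)
  one_act : ∀ (p : ℤ) (x : cx.X p), act 0 p p (by omega) A.one x = x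
  mul_act : ∀ (p q r pq qr s : ℤ) (h₁ : p + q = pq) (h₂ : q + r = qr) (h₃ : pq + r = s)
    (a : A.cx.X p) (b : A.cx.X q) (x : cx.X r),
    act pq r s h₃ (A.mul p q pq h₁ a b) x = act p qr s (by omega) a (act q r qr h₂ b x)
  d_act : ∀ (p q r p' q' r' : ℤ) (h : p + q = r) (hp : p + 1 = p') (hq : q + 1 = q')
    (hr : r + 1 = r') (a : A.cx.X p) (x : cx.X q),
    cx.d r r' (act p q r h a x) =
      act p' q r' (by omega) (A.cx.d p p' a) x +
        p.negOnePow • act p q' r' (by omega) a (cx.d q q' x)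

namespace DgMod

variable {k : Type u} [CommRing k] {A : Cdga k}

/-- A morphism of dg-modules: an `A`-linear map of complexes. -/
@[ext]
structure Hom (M N : DgMod A) where
  /-- the underlying map of complexes -/
  toHom : M.cx ⟶ N.cx
  map_act : ∀ (p q r : ℤ) (h : p + q = r) (a : A.cx.X p) (x : M.cx.X q),
    toHom.f r (M.act p q r h a x) = N.act p q r h a (toHom.f q x)

/-- A cdga `B` under `A`, seen as an `A`-dg-module. -/
def ofHom {B : Cdga k} (φ : A ⟶ B) : DgMod A where
  cx := B.cx
  nonpos := B.nonpos
  act p q r h := (B.mul p q r h).comp (φ.toHom.f p).hom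
  one_act p x := by
    have := φ.map_one
    simp only [LinearMap.comp_apply]
    erw [this]
    exact B.one_mul p x
  mul_act p q r pq qr s h₁ h₂ h₃ a b x := by
    have := φ.map_mul p q pq h₁ a b
    simp only [LinearMap.comp_apply]
    erw [this]
    exact B.mul_assoc p q r pq qr s h₁ h₂ h₃ _ _ _
  d_act p q r p' q' r' h hp hq hr a x := by
    have h₁ := B.d_mul p q r p' q' r' h hp hq hr (φ.toHom.f p a) x
    have h₂ : B.cx.d p p' (φ.toHom.f p a) = φ.toHom.f p' (A.cx.d p p' a) := by
      rw [← ConcreteCategory.comp_apply, ← ConcreteCategory.comp_apply, φ.toHom.comm]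
    rw [h₂] at h₁
    exact h₁

/-- The shift `M[1]`, with `M[1]^n = M^(n+1)`, differential `-d`, and action
`a · sx = (-1)^|a| s(a x)`. -/
def shift (M : DgMod A) : DgMod A where
  cx :=
    { X := fun n => M.cx.X (n + 1)
      d := fun m n => -M.cx.d (m + 1) (n + 1)
      shape := fun m n h => by
        rw [M.cx.shape _ _ (fun h' => h (by simp at h' ⊢; omega)), neg_zero]
      d_comp_d' := fun _ _ _ _ _ => by simp }
  nonpos n hn := M.nonpos (n + 1) (by omega)
  act p q r h := p.negOnePow • M.act p (q + 1) (r + 1) (by omega)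
  one_act p x := by
    have := M.one_act (p + 1) x
    simpa using this
  mul_act p q r pq qr s h₁ h₂ h₃ a b x := by
    have := M.mul_act p q (r + 1) pq (qr + 1) (s + 1) h₁ (by omega) (by omega) a b x
    subst h₁
    simp only [LinearMap.smul_apply, Int.negOnePow_add, mul_smul, LinearMap.map_smul_of_tower, this]
  d_act p q r p' q' r' h hp hq hr a x := by
    have := M.d_act p (q + 1) (r + 1) (p + 1) (q' + 1) (r' + 1) (by omega) rfl (by omega)
      (by omega) a x
    subst hp
    simp only [LinearMap.smul_apply, ModuleCat.hom_neg, LinearMap.neg_apply, Units.neg_smul,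
      LinearMap.map_smul_of_tower, map_neg, Int.negOnePow_succ, this, smul_add, smul_neg, neg_add]

/-- A (degree `0`, dg) derivation `D : A → M`: a map of complexes of `k`-modules with
`D(ab) = (-1)^(|a||b|) b D(a) + a D(b)`. -/
structure IsDerivation {M : DgMod A} (D : A.cx ⟶ M.cx) : Prop where
  map_mul : ∀ (p q r : ℤ) (h : p + q = r) (a : A.cx.X p) (b : A.cx.X q),
    D.f r (A.mul p q r h a b) =
      (p * q).negOnePow • M.act q p r (by omega) b (D.f p a) + M.act p q r h a (D.f q b)

/-- `∂ : A → Ω` is the universal derivation: `Ω` is the `A`-dg-module `Ω¹_A` that corepresents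
derivations. -/
structure IsUniversalDerivation {Ω : DgMod A} (del : A.cx ⟶ Ω.cx) : Prop where
  isDerivation : IsDerivation del
  existsUnique : ∀ (M : DgMod A) (D : A.cx ⟶ M.cx), IsDerivation D →
    ∃! f : Hom Ω M, del ≫ f.toHom = D

/-- The `A`-algebra `i : A → E` and the morphism of `A`-dg-modules `j : M → E` make `E` the free
commutative `A`-dg-algebra `Sym_A(M) = ⨁ₙ M^{⊗_A n} / Σₙ` on `M`. -/
def IsFreeAlgebra {M : DgMod A} {E : Cdga k} (i : A ⟶ E) (j : Hom M (ofHom i)) : Prop :=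
  ∀ (B : Cdga k) (φ : A ⟶ B) (ψ : Hom M (ofHom φ)),
    ∃! χ : E ⟶ B, i ≫ χ = φ ∧
      ∀ (n : ℤ) (x : M.cx.X n), χ.toHom.f n (j.toHom.f n x) = ψ.toHom.f n x

end DgMod

/-- The `ε`-cdga `E`, with the cdga morphism `i : A → E`, is the de Rham `ε`-cdga `ε(A)`:
its underlying cdga is `DR(A) = Sym_A(Ω¹_A[1])`, and `ε` is the universal derivation
`∂ : A^n → (Ω¹_A)^n = (Ω¹_A[1])^(n-1)` on `A`. -/
def IsDeRham {k : Type u} [CommRing k] (A : Cdga k) (E : EpsCdga k) (i : A ⟶ E.alg) : Prop :=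
  ∃ (Ω : DgMod A) (del : A.cx ⟶ Ω.cx) (j : DgMod.Hom Ω.shift (DgMod.ofHom i)),
    DgMod.IsUniversalDerivation del ∧ DgMod.IsFreeAlgebra i j ∧
      ∀ (n : ℤ) (a : A.cx.X (n + 1)),
        E.eps (n + 1) n rfl (i.toHom.f (n + 1) a) = j.toHom.f n (del.f (n + 1) a)

/-- The model category `M` (on a category with all small limits and colimits, and with functorial
factorizations) has `W` as weak equivalences and `Fib` as fibrations. Its cofibrations are then
the morphisms with the left lifting property against the trivial fibrations. -/
structure IsModelStructure {C : Type*} [Category C] (M : ModelCategory C)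
    (W Fib : MorphismProperty C) : Prop where
  hasLimits : HasLimits C
  hasColimits : HasColimits C
  weakEquivalences_eq : weakEquivalences C = W
  fibrations_eq : fibrations C = Fib
  cofibrations_eq : cofibrations C = (Fib ⊓ W).llp
  functorial_cof_trivFib :
    (cofibrations C).HasFunctorialFactorization (trivialFibrations C)
  functorial_trivCof_fib :
    (trivialCofibrations C).HasFunctorialFactorization (fibrations C)

/-- A right Quillen functor: a right adjoint that preserves fibrations and trivial fibrations. -/
structure IsRightQuillen {C D : Type*} [Category C] [Category D]
    (_ : ModelCategory C) (_ : ModelCategory D) (G : D ⥤ C) : Prop where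
  isRightAdjoint : G.IsRightAdjoint
  fibrations_le : fibrations D ≤ (fibrations C).inverseImage G
  trivialFibrations_le : trivialFibrations D ≤ (trivialFibrations C).inverseImage G

end

/-! Both categories are handled at once. A cdga is the same thing as an `ε`-cdga with `ε = 0`, and a
`Realization` is a category equivalent either to all `ε`-cdga's or to those with `ε = 0`. Limits are
computed degreewise. Colimits, factorizations and the free `ε`-cdga are given by presentations:
formal expressions modulo the laws and the chosen relations, with universal property
`Presentation.lift`.

Trivial fibrations are the maps that lift spheres in disks (`liftsDisks_iff`). To factor `f : A → B`
into a cofibration and a trivial fibration, adjoin to `A` a formal element `cell z b` for all `z` in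
the extension and all `b` in `B`, and impose `d (cell z b) = z` when `z` is a cocycle that is sent
to `d b`. Since `z` may itself contain cells, the result is already closed under attaching cells: a
single inductive type replaces the transfinite small object argument. The construction involves no
choice, hence is functorial. Lifts against trivial fibrations are defined by recursion on
expressions (`cellι_hasLift`).

For the other factorization, adjoin to `A` a free generator for each element of `B` of negative
degree. Lifting against fibrations only requires a choice of preimages (`diskι_hasLift`). The
inclusion of `A` is a quasi-isomorphism (`diskι_quasiIso`): the generators `x` are contracted by the
homotopy `x ↦ t x` with values in the polynomial path object `E[t, dt]`, and integration over `[0,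
1]`, where rational coefficients are needed, shows that the two ends of a closed path are
cohomologous. A retract argument (`Cof_inf_W_eq`) then yields the model axioms.

The left adjoint is the presented free `ε`-cdga on `A`. Its underlying cdga is recognized as
`Sym_A(Ω¹_A[1])` by its universal property, by means of a cofree `ε`-cdga, the truncation of `B[η]`
with `ε(x + ηy) = y`. Cdga maps from the free `ε`-cdga on `A` to `B` are `ε`-maps to the cofree one
on `B`, hence cdga maps from `A` to it, hence pairs of a cdga map `φ : A → B` and a derivation of
degree `-1` along `φ`, hence pairs of `φ` and an `A`-linear map `Ω¹_A[1] → B`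
(`isFreeAlgebra_kahlerToDeRham`).

Path objects and cofree objects are instances of one extension `E[η]`, with `η` of degree `1`, built
from a derivation `D` and a scalar `c` with `cD = 0` (`ScaledDerivation.thicken`): `D = d/dt`, `c =
0` for the former, `D = 0`, `c = 1` for the latter. -/

noncomputable section

/-! ### Quasi-isomorphisms in terms of cocycles and coboundaries -/

namespace CochainComplex

variable {k : Type u} [CommRing k] {K L : CochainComplex (ModuleCat.{u} k) ℤ}

lemma d_d_apply (K : CochainComplex (ModuleCat.{u} k) ℤ) {p q r : ℤ} (x : K.X p) :
    K.d q r (K.d p q x) = 0 := by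
  rw [← ConcreteCategory.comp_apply, K.d_comp_d]; rfl

lemma map_d_apply (f : K ⟶ L) {p q : ℤ} (x : K.X p) :
    f.f q (K.d p q x) = L.d p q (f.f p x) := by
  rw [← ConcreteCategory.comp_apply, ← f.comm, ConcreteCategory.comp_apply]

lemma homologyπ_surjective (K : CochainComplex (ModuleCat.{u} k) ℤ) (n : ℤ) :
    Function.Surjective (K.homologyπ n) :=
  (ModuleCat.epi_iff_surjective _).1 inferInstance

lemma iCycles_injective (K : CochainComplex (ModuleCat.{u} k) ℤ) (n : ℤ) :
    Function.Injective (K.iCycles n) :=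
  (ModuleCat.mono_iff_injective _).1 inferInstance

lemma d_iCycles_apply (K : CochainComplex (ModuleCat.{u} k) ℤ) (n m : ℤ) (z : K.cycles n) :
    K.d n m (K.iCycles n z) = 0 := by
  rw [← ConcreteCategory.comp_apply, K.iCycles_d]; rfl

lemma exists_iCycles_eq (K : CochainComplex (ModuleCat.{u} k) ℤ) {n m : ℤ} (h : n + 1 = m)
    (z : K.X n) (hz : K.d n m z = 0) : ∃ c : K.cycles n, K.iCycles n c = z := by
  have hex := ShortComplex.exact_of_f_is_kernel (ShortComplex.mk (K.iCycles n) (K.d n m) (by simp))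
    (K.cyclesIsKernel n m (by simp [← h]))
  exact (ShortComplex.moduleCat_exact_iff _).1 hex z hz

lemma homologyπ_eq_zero_iff (K : CochainComplex (ModuleCat.{u} k) ℤ) {m n : ℤ} (h : m + 1 = n)
    (z : K.cycles n) : K.homologyπ n z = 0 ↔ ∃ x : K.X m, K.d m n x = K.iCycles n z := by
  have hex := ShortComplex.exact_of_g_is_cokernel
    (ShortComplex.mk (K.toCycles m n) (K.homologyπ n) (by simp))
    (K.homologyIsCokernel m n (by simp [← h]))
  constructor
  · intro hz
    obtain ⟨x, hx⟩ := (ShortComplex.moduleCat_exact_iff _).1 hex z hz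
    refine ⟨x, ?_⟩
    rw [← K.toCycles_i m n, ConcreteCategory.comp_apply]
    exact congrArg _ hx
  · rintro ⟨x, hx⟩
    have : K.toCycles m n x = z := by
      apply K.iCycles_injective
      rw [← ConcreteCategory.comp_apply, K.toCycles_i, hx]
    rw [← this, ← ConcreteCategory.comp_apply, K.toCycles_comp_homologyπ]; rfl

lemma homologyMap_homologyπ (f : K ⟶ L) (n : ℤ) (z : K.cycles n) :
    HomologicalComplex.homologyMap f n (K.homologyπ n z) =
      L.homologyπ n (HomologicalComplex.cyclesMap f n z) := by
  rw [← ConcreteCategory.comp_apply, HomologicalComplex.homologyπ_naturality,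
    ConcreteCategory.comp_apply]

lemma iCycles_cyclesMap (f : K ⟶ L) (n : ℤ) (z : K.cycles n) :
    L.iCycles n (HomologicalComplex.cyclesMap f n z) = f.f n (K.iCycles n z) := by
  rw [← ConcreteCategory.comp_apply, HomologicalComplex.cyclesMap_i, ConcreteCategory.comp_apply]

/-- A morphism of complexes of modules is a quasi-isomorphism iff it is injective and surjective
on cohomology classes. -/
lemma quasiIso_iff_elements (f : K ⟶ L) :
    QuasiIso f ↔ ∀ p q r : ℤ, p + 1 = q → q + 1 = r →
      (∀ z : K.X q, K.d q r z = 0 → (∃ y : L.X p, L.d p q y = f.f q z) →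
        ∃ x : K.X p, K.d p q x = z) ∧
      (∀ z : L.X q, L.d q r z = 0 → ∃ (x : K.X q) (y : L.X p), K.d q r x = 0 ∧
        f.f q x = z + L.d p q y) := by
  rw [quasiIso_iff]
  have key : ∀ q, QuasiIsoAt f q ↔ Function.Bijective (HomologicalComplex.homologyMap f q) := by
    intro q
    rw [quasiIsoAt_iff_isIso_homologyMap, ConcreteCategory.isIso_iff_bijective]
  simp only [key]
  constructor
  · rintro hf p q r hpq hqr
    constructor
    · rintro z hz ⟨y, hy⟩
      obtain ⟨c, rfl⟩ := K.exists_iCycles_eq hqr z hz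
      rw [← K.homologyπ_eq_zero_iff hpq]
      apply (hf q).1
      rw [map_zero, homologyMap_homologyπ, L.homologyπ_eq_zero_iff hpq]
      exact ⟨y, by rw [hy, iCycles_cyclesMap]⟩
    · intro z hz
      obtain ⟨c, rfl⟩ := L.exists_iCycles_eq hqr z hz
      obtain ⟨e, he⟩ := (hf q).2 (L.homologyπ q c)
      obtain ⟨b, rfl⟩ := K.homologyπ_surjective q e
      rw [homologyMap_homologyπ, ← sub_eq_zero, ← map_sub, L.homologyπ_eq_zero_iff hpq] at he
      obtain ⟨y, hy⟩ := he
      refine ⟨K.iCycles q b, y, K.d_iCycles_apply _ _ _, ?_⟩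
      rw [hy, map_sub, iCycles_cyclesMap]
      abel
  · intro hf q
    obtain ⟨h₁, h₂⟩ := hf (q - 1) q (q + 1) (by omega) rfl
    constructor
    · rw [injective_iff_map_eq_zero]
      intro a ha
      obtain ⟨c, rfl⟩ := K.homologyπ_surjective q a
      rw [homologyMap_homologyπ, L.homologyπ_eq_zero_iff (m := q - 1) (by omega),
        iCycles_cyclesMap] at ha
      rw [K.homologyπ_eq_zero_iff (m := q - 1) (by omega)]
      exact h₁ _ (K.d_iCycles_apply _ _ _) ha
    · intro b
      obtain ⟨c, rfl⟩ := L.homologyπ_surjective q b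
      obtain ⟨x, y, hx, hy⟩ := h₂ (L.iCycles q c) (L.d_iCycles_apply _ _ _)
      obtain ⟨e, rfl⟩ := K.exists_iCycles_eq rfl x hx
      refine ⟨K.homologyπ q e, ?_⟩
      rw [homologyMap_homologyπ, ← sub_eq_zero, ← map_sub,
        L.homologyπ_eq_zero_iff (m := q - 1) (by omega)]
      refine ⟨y, ?_⟩
      rw [map_sub, iCycles_cyclesMap, hy]
      abel

end CochainComplex

/-! ### Trivial fibrations as lifting of spheres in disks -/

namespace CochainComplex

variable {k : Type u} [CommRing k] {K L : CochainComplex (ModuleCat.{u} k) ℤ}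

/-- The right lifting property against all inclusions of spheres into disks. -/
def LiftsDisks (f : K ⟶ L) : Prop :=
  ∀ p q r : ℤ, p + 1 = q → q + 1 = r → ∀ z : K.X q, K.d q r z = 0 →
    ∀ y : L.X p, f.f q z = L.d p q y → ∃ x : K.X p, K.d p q x = z ∧ f.f p x = y

lemma LiftsDisks.surjective {f : K ⟶ L} (hf : LiftsDisks f) (n : ℤ) :
    Function.Surjective (f.f n) := fun y => by
  -- To hit `y`, a cocycle over `dy` is needed first. The same lifting property one degree higher,
  -- with boundary value `0`, provides it.
  obtain ⟨z, hz, hzy⟩ := hf (n + 1) (n + 1 + 1) _ rfl rfl 0 (map_zero _) (L.d n (n + 1) y)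
    (by rw [map_zero, d_d_apply])
  obtain ⟨x, -, hx⟩ := hf n _ _ rfl rfl z hz y hzy
  exact ⟨x, hx⟩

/-- A lift with prescribed boundary gives injectivity on cohomology; a lift with boundary `0` takes
a cocycle to a cocycle strictly above it, which gives surjectivity. -/
lemma LiftsDisks.quasiIso {f : K ⟶ L} (hf : LiftsDisks f) : QuasiIso f := by
  rw [quasiIso_iff_elements]
  refine fun p q r hpq hqr => ⟨?_, fun z hz => ?_⟩
  · rintro z hz ⟨y, hy⟩
    obtain ⟨x, hx, -⟩ := hf p q r hpq hqr z hz y hy.symm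
    exact ⟨x, hx⟩
  · obtain ⟨x, hx, hxz⟩ := hf q r (r + 1) hqr rfl 0 (map_zero _) z (by rw [map_zero, hz])
    exact ⟨x, 0, hx, by rw [hxz, map_zero, add_zero]⟩

/-- Between complexes in degrees `≤ 0`, the quasi-isomorphisms that are surjective in negative
degrees have the right lifting property against all inclusions of spheres into disks. -/
lemma liftsDisks_of_quasiIso (f : K ⟶ L) (hL : ∀ n : ℤ, 0 < n → Subsingleton (L.X n))
    (hs : ∀ n : ℤ, n < 0 → Function.Surjective (f.f n)) (hf : QuasiIso f) : LiftsDisks f := by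
  rw [quasiIso_iff_elements] at hf
  intro p q r hpq hqr z hz y hzy
  obtain ⟨x, rfl⟩ := (hf p q r hpq hqr).1 z hz ⟨y, hzy.symm⟩
  by_cases hp : 0 < p
  · have := hL p hp
    exact ⟨x, rfl, Subsingleton.elim _ _⟩
  -- The primitive `x` need not lie over `y`. The error `y - f x` is a cocycle, so it is the image
  -- of a cocycle `x'` up to some `dw`; as `p ≤ 0`, `w` has negative degree and can be lifted.
  · obtain ⟨x', w, hx', hw⟩ := (hf (p - 1) p q (by omega) hpq).2 (y - f.f p x)
      (by rw [map_sub, ← hzy, map_d_apply, sub_self])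
    obtain ⟨w, rfl⟩ := hs (p - 1) (by omega) w
    refine ⟨x + x' - K.d (p - 1) p w, ?_, ?_⟩
    · simp only [map_sub, map_add, hx', d_d_apply, add_zero, sub_zero]
    · simp only [map_sub, map_add, hw, map_d_apply]
      abel

/-- The cochain complex on a family of modules and linear maps. -/
def ofModules (X : ℤ → Type u) [∀ n, AddCommGroup (X n)] [∀ n, Module k (X n)]
    (d : ∀ p q : ℤ, p + 1 = q → X p →ₗ[k] X q)
    (d_d : ∀ (p q r : ℤ) (h : p + 1 = q) (h' : q + 1 = r) (x : X p), d q r h' (d p q h x) = 0) :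
    CochainComplex (ModuleCat.{u} k) ℤ where
  X n := ModuleCat.of k (X n)
  d p q := if h : p + 1 = q then ModuleCat.ofHom (d p q h) else 0
  shape p q h := dif_neg h
  d_comp_d' p q r h h' := by
    rw [dif_pos (show p + 1 = q from h), dif_pos (show q + 1 = r from h')]
    ext x
    exact d_d p q r h h' x

lemma ofModules_d (X : ℤ → Type u) [∀ n, AddCommGroup (X n)] [∀ n, Module k (X n)]
    (d : ∀ p q : ℤ, p + 1 = q → X p →ₗ[k] X q)
    (d_d : ∀ (p q r : ℤ) (h : p + 1 = q) (h' : q + 1 = r) (x : X p), d q r h' (d p q h x) = 0)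
    {p q : ℤ} (h : p + 1 = q) (x : X p) : (ofModules X d d_d).d p q x = d p q h x := by
  simp only [ofModules, dif_pos h]
  rfl

/-- A morphism of complexes from a family of linear maps commuting with the differentials. -/
def homMk (f : ∀ n : ℤ, K.X n →ₗ[k] L.X n)
    (hf : ∀ (p q : ℤ), p + 1 = q → ∀ x : K.X p, f q (K.d p q x) = L.d p q (f p x)) : K ⟶ L where
  f n := ModuleCat.ofHom (f n)
  comm' p q h := by
    ext x
    exact (hf p q h x).symm

lemma hom_ext_apply {f g : K ⟶ L} (h : ∀ (n : ℤ) (x : K.X n), f.f n x = g.f n x) : f = g := by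
  ext n x
  exact h n x

end CochainComplex

/-! ### Elementwise calculus in `ε`-cdga's -/

namespace EpsCdga

variable {k : Type u} [CommRing k]

/-- The degree `n` part of an `ε`-cdga. -/
abbrev X (E : EpsCdga k) (n : ℤ) : ModuleCat.{u} k := E.alg.cx.X n

/-- The differential of an `ε`-cdga. -/
def d (E : EpsCdga k) (p q : ℤ) : E.X p →ₗ[k] E.X q := (E.alg.cx.d p q).hom

/-- The multiplication of an `ε`-cdga. -/
abbrev mul (E : EpsCdga k) (p q r : ℤ) (h : p + q = r) : E.X p →ₗ[k] E.X q →ₗ[k] E.X r :=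
  E.alg.mul p q r h

/-- The unit of an `ε`-cdga. -/
abbrev one (E : EpsCdga k) : E.X 0 := E.alg.one

lemma cx_d_apply (E : EpsCdga k) (p q : ℤ) (x : E.X p) : E.alg.cx.d p q x = E.d p q x := rfl

@[simp]
lemma d_d (E : EpsCdga k) (p q r : ℤ) (x : E.X p) : E.d q r (E.d p q x) = 0 :=
  CochainComplex.d_d_apply E.alg.cx x

lemma d_mul (E : EpsCdga k) (p q r p' q' r' : ℤ) (h : p + q = r) (hp : p + 1 = p')
    (hq : q + 1 = q') (hr : r + 1 = r') (a : E.X p) (b : E.X q) :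
    E.d r r' (E.mul p q r h a b) =
      E.mul p' q r' (by omega) (E.d p p' a) b +
        p.negOnePow • E.mul p q' r' (by omega) a (E.d q q' b) :=
  E.alg.d_mul p q r p' q' r' h hp hq hr a b

lemma d_eps' (E : EpsCdga k) (p q r : ℤ) (h₁ : q + 1 = p) (h₂ : p + 1 = r) (a : E.X p) :
    E.eps r p h₂ (E.d p r a) = -E.d q p (E.eps p q h₁ a) :=
  eq_neg_of_add_eq_zero_right (E.d_eps p q r h₁ h₂ a)

lemma eq_zero_of_pos (E : EpsCdga k) {n : ℤ} (hn : 0 < n) (x : E.X n) : x = 0 :=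
  have := E.alg.nonpos n hn
  Subsingleton.elim _ _

/-- A morphism of `ε`-cdga's in degree `n`, as a linear map. -/
def app {E F : EpsCdga k} (f : E ⟶ F) (n : ℤ) : E.X n →ₗ[k] F.X n := (f.algHom.toHom.f n).hom

section app

variable {E F G : EpsCdga k} (f : E ⟶ F)

lemma toHom_f_apply (n : ℤ) (x : E.X n) : f.algHom.toHom.f n x = app f n x := rfl

@[simp]
lemma app_one : app f 0 E.one = F.one := f.algHom.map_one

@[simp]
lemma app_mul (p q r : ℤ) (h : p + q = r) (a : E.X p) (b : E.X q) :
    app f r (E.mul p q r h a b) = F.mul p q r h (app f p a) (app f q b) :=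
  f.algHom.map_mul p q r h a b

@[simp]
lemma app_d (p q : ℤ) (a : E.X p) : app f q (E.d p q a) = F.d p q (app f p a) :=
  CochainComplex.map_d_apply f.algHom.toHom a

@[simp]
lemma app_eps (p q : ℤ) (h : q + 1 = p) (a : E.X p) :
    app f q (E.eps p q h a) = F.eps p q h (app f p a) :=
  f.map_eps p q h a

@[simp]
lemma app_id (n : ℤ) (a : E.X n) : app (𝟙 E) n a = a := rfl

@[simp]
lemma app_comp (g : F ⟶ G) (n : ℤ) (a : E.X n) : app (f ≫ g) n a = app g n (app f n a) := rfl

variable {f} in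
lemma hom_ext {g : E ⟶ F} (h : ∀ (n : ℤ) (x : E.X n), app f n x = app g n x) : f = g :=
  Hom.ext (Cdga.Hom.ext (CochainComplex.hom_ext_apply h))

/-- A morphism of `ε`-cdga's from a family of linear maps. -/
def homMk (f : ∀ n : ℤ, E.X n →ₗ[k] F.X n)
    (map_d : ∀ (p q : ℤ), p + 1 = q → ∀ x : E.X p, f q (E.d p q x) = F.d p q (f p x))
    (map_one : f 0 E.one = F.one)
    (map_mul : ∀ (p q r : ℤ) (h : p + q = r) (a : E.X p) (b : E.X q),
      f r (E.mul p q r h a b) = F.mul p q r h (f p a) (f q b))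
    (map_eps : ∀ (p q : ℤ) (h : q + 1 = p) (a : E.X p),
      f q (E.eps p q h a) = F.eps p q h (f p a)) : E ⟶ F where
  algHom :=
    { toHom := CochainComplex.homMk f map_d
      map_one := map_one
      map_mul := map_mul }
  map_eps := map_eps

end app

end EpsCdga

/-- The data of an `ε`-cdga on a family of modules. -/
structure EpsCdgaData (k : Type u) [CommRing k] where
  /-- the graded pieces -/
  X : ℤ → Type u
  [grp : ∀ n, AddCommGroup (X n)]
  [mod : ∀ n, Module k (X n)]
  /-- the differential -/
  d : ∀ p q : ℤ, p + 1 = q → X p →ₗ[k] X q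
  d_d : ∀ (p q r : ℤ) (h : p + 1 = q) (h' : q + 1 = r) (x : X p), d q r h' (d p q h x) = 0
  nonpos : ∀ (n : ℤ), 0 < n → ∀ x : X n, x = 0
  /-- the multiplication -/
  mul : ∀ p q r : ℤ, p + q = r → (X p →ₗ[k] X q →ₗ[k] X r)
  /-- the unit -/
  one : X 0
  one_mul : ∀ (p : ℤ) (a : X p), mul 0 p p (by omega) one a = a
  mul_assoc : ∀ (p q r pq qr s : ℤ) (h₁ : p + q = pq) (h₂ : q + r = qr) (h₃ : pq + r = s)
    (a : X p) (b : X q) (c : X r),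
    mul pq r s h₃ (mul p q pq h₁ a b) c = mul p qr s (by omega) a (mul q r qr h₂ b c)
  mul_comm : ∀ (p q r : ℤ) (h : p + q = r) (a : X p) (b : X q),
    mul p q r h a b = (p * q).negOnePow • mul q p r (by omega) b a
  d_mul : ∀ (p q r p' q' r' : ℤ) (h : p + q = r) (hp : p + 1 = p') (hq : q + 1 = q')
    (hr : r + 1 = r') (a : X p) (b : X q),
    d r r' hr (mul p q r h a b) =
      mul p' q r' (by omega) (d p p' hp a) b +
        p.negOnePow • mul p q' r' (by omega) a (d q q' hq b)
  /-- the operator of degree `-1` -/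
  eps : ∀ p q : ℤ, q + 1 = p → (X p →ₗ[k] X q)
  eps_eps : ∀ (p q r : ℤ) (h₁ : q + 1 = p) (h₂ : r + 1 = q) (a : X p),
    eps q r h₂ (eps p q h₁ a) = 0
  d_eps : ∀ (p q r : ℤ) (h₁ : q + 1 = p) (h₂ : p + 1 = r) (a : X p),
    d q p h₁ (eps p q h₁ a) + eps r p h₂ (d p r h₂ a) = 0
  eps_mul : ∀ (p q r p' q' r' : ℤ) (h : p + q = r) (hp : p' + 1 = p) (hq : q' + 1 = q)
    (hr : r' + 1 = r) (a : X p) (b : X q),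
    eps r r' hr (mul p q r h a b) =
      mul p' q r' (by omega) (eps p p' hp a) b +
        p.negOnePow • mul p q' r' (by omega) a (eps q q' hq b)

attribute [instance] EpsCdgaData.grp EpsCdgaData.mod

namespace EpsCdgaData

variable {k : Type u} [CommRing k] (D : EpsCdgaData k)

/-- The `ε`-cdga defined by its components. -/
def toEpsCdga : EpsCdga k where
  alg :=
    { cx := CochainComplex.ofModules D.X D.d D.d_d
      nonpos := fun n hn => ⟨fun x y => (D.nonpos n hn x).trans (D.nonpos n hn y).symm⟩
      mul := D.mul
      one := D.one
      one_mul := D.one_mul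
      mul_assoc := D.mul_assoc
      mul_comm := D.mul_comm
      d_mul := fun p q r p' q' r' h hp hq hr (a : D.X p) (b : D.X q) => by
        have := D.d_mul p q r p' q' r' h hp hq hr a b
        rw [← CochainComplex.ofModules_d D.X D.d D.d_d hr,
          ← CochainComplex.ofModules_d D.X D.d D.d_d hp,
          ← CochainComplex.ofModules_d D.X D.d D.d_d hq] at this
        exact this }
  eps := D.eps
  eps_eps := D.eps_eps
  d_eps p q r h₁ h₂ (a : D.X p) := by
    have := D.d_eps p q r h₁ h₂ a
    rw [← CochainComplex.ofModules_d D.X D.d D.d_d h₁,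
      ← CochainComplex.ofModules_d D.X D.d D.d_d h₂] at this
    exact this
  eps_mul := D.eps_mul

lemma toEpsCdga_d {p q : ℤ} (h : p + 1 = q) (x : D.X p) :
    D.toEpsCdga.d p q x = D.d p q h x :=
  CochainComplex.ofModules_d D.X D.d D.d_d h x

open EpsCdga in
/-- A morphism out of an `ε`-cdga defined by its components. -/
def homOut {F : EpsCdga k} (f : ∀ n : ℤ, D.X n →ₗ[k] F.X n)
    (map_d : ∀ (p q : ℤ) (h : p + 1 = q) (x : D.X p), f q (D.d p q h x) = F.d p q (f p x))
    (map_one : f 0 D.one = F.one)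
    (map_mul : ∀ (p q r : ℤ) (h : p + q = r) (a : D.X p) (b : D.X q),
      f r (D.mul p q r h a b) = F.mul p q r h (f p a) (f q b))
    (map_eps : ∀ (p q : ℤ) (h : q + 1 = p) (a : D.X p),
      f q (D.eps p q h a) = F.eps p q h (f p a)) : D.toEpsCdga ⟶ F :=
  homMk (E := D.toEpsCdga) f
    (fun p q h x => (congrArg (f q) (D.toEpsCdga_d h x)).trans (map_d p q h x))
    map_one map_mul map_eps

open EpsCdga in
/-- A morphism to an `ε`-cdga defined by its components. -/
def homIn {F : EpsCdga k} (f : ∀ n : ℤ, F.X n →ₗ[k] D.X n)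
    (map_d : ∀ (p q : ℤ) (h : p + 1 = q) (x : F.X p), f q (F.d p q x) = D.d p q h (f p x))
    (map_one : f 0 F.one = D.one)
    (map_mul : ∀ (p q r : ℤ) (h : p + q = r) (a : F.X p) (b : F.X q),
      f r (F.mul p q r h a b) = D.mul p q r h (f p a) (f q b))
    (map_eps : ∀ (p q : ℤ) (h : q + 1 = p) (a : F.X p),
      f q (F.eps p q h a) = D.eps p q h (f p a)) : F ⟶ D.toEpsCdga :=
  homMk (F := D.toEpsCdga) f
    (fun p q h x => (map_d p q h x).trans (D.toEpsCdga_d h _).symm)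
    map_one map_mul map_eps

end EpsCdgaData

/-! ### Presentations with formal primitives -/

namespace EpsCdga

/-- Formal expressions in the operations of an `ε`-cdga, on graded generators `G`, together with
formal primitives `cell z b` of expressions `z`, labelled by the elements `b` of `B`. -/
inductive Term (k : Type u) (G B : ℤ → Type u) : ℤ → Type u
  | gen (n : ℤ) (g : G n) : Term k G B n
  | zero (n : ℤ) : Term k G B n
  | add {n : ℤ} (x y : Term k G B n) : Term k G B n
  | smul {n : ℤ} (c : k) (x : Term k G B n) : Term k G B n
  | one : Term k G B 0
  | mul (p q r : ℤ) (h : p + q = r) (x : Term k G B p) (y : Term k G B q) : Term k G B r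
  | d (p q : ℤ) (h : p + 1 = q) (x : Term k G B p) : Term k G B q
  | eps (p q : ℤ) (h : q + 1 = p) (x : Term k G B p) : Term k G B q
  | cell (p q : ℤ) (h : p + 1 = q) (z : Term k G B q) (b : B p) : Term k G B p

/-- The sign `(-1)^p` as a scalar. -/
def sign (k : Type u) [CommRing k] (p : ℤ) : k := ((p.negOnePow : ℤ) : k)

lemma sign_smul {k : Type u} [CommRing k] {M : Type*} [AddCommGroup M] [Module k M] (p : ℤ)
    (x : M) : sign k p • x = p.negOnePow • x := by
  rw [sign, Int.cast_smul_eq_zsmul, Units.smul_def]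

/-- The evaluation of expressions in an `ε`-cdga. -/
def Term.eval {k : Type u} [CommRing k] {G B : ℤ → Type u} {E : EpsCdga k}
    (g : ∀ n : ℤ, G n → E.X n)
    (c : ∀ p q : ℤ, p + 1 = q → Term k G B q → E.X q → B p → E.X p) :
    ∀ {n : ℤ}, Term k G B n → E.X n
  | _, .gen n x => g n x
  | _, .zero _ => 0
  | _, .add x y => eval g c x + eval g c y
  | _, .smul a x => a • eval g c x
  | _, .one => E.one
  | _, .mul p q r h x y => E.mul p q r h (eval g c x) (eval g c y)
  | _, .d p q _ x => E.d p q (eval g c x)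
  | _, .eps p q h x => E.eps p q h (eval g c x)
  | _, .cell p q h z b => c p q h z (eval g c z) b

/-- A presentation of an `ε`-cdga: generators, labels for formal primitives, relations, the
condition under which a formal primitive of a cocycle is a primitive, and whether `ε` is forced
to vanish. -/
structure Presentation (k : Type u) where
  /-- the generators -/
  G : ℤ → Type u
  /-- the labels of the formal primitives -/
  B : ℤ → Type u
  /-- the condition for `cell z b` to be a primitive of `z` -/
  good : ∀ p q : ℤ, p + 1 = q → Term k G B q → B p → Prop
  /-- the relations -/
  R : ∀ n : ℤ, Term k G B n → Term k G B n → Prop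
  /-- whether `ε` vanishes -/
  noEps : Prop

namespace Presentation

variable {k : Type u} [CommRing k] (P : Presentation k)

/-- The expressions of a presentation. -/
abbrev Tm (n : ℤ) : Type u := Term k P.G P.B n

/-- The congruence generated by the laws of `ε`-cdga's and the relations of the presentation. -/
inductive Rel : ∀ n : ℤ, P.Tm n → P.Tm n → Prop
  | refl (n : ℤ) (x) : Rel n x x
  | symm (n : ℤ) (x y) : Rel n x y → Rel n y x
  | trans (n : ℤ) (x y z) : Rel n x y → Rel n y z → Rel n x z
  | congr_add (n : ℤ) (x x' y y') : Rel n x x' → Rel n y y' → Rel n (.add x y) (.add x' y')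
  | congr_smul (n : ℤ) (c : k) (x x') : Rel n x x' → Rel n (.smul c x) (.smul c x')
  | congr_mul (p q r : ℤ) (h) (x x' y y') : Rel p x x' → Rel q y y' →
      Rel r (.mul p q r h x y) (.mul p q r h x' y')
  | congr_d (p q : ℤ) (h) (x x') : Rel p x x' → Rel q (.d p q h x) (.d p q h x')
  | congr_eps (p q : ℤ) (h) (x x') : Rel p x x' → Rel q (.eps p q h x) (.eps p q h x')
  | congr_cell (p q : ℤ) (h) (x x') (b) : Rel q x x' → Rel p (.cell p q h x b) (.cell p q h x' b)
  | rel (n : ℤ) (x y) : P.R n x y → Rel n x y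
  -- Closedness of `x` is required modulo the congruence being generated, for otherwise `d² = 0`
  -- would impose `dx = 0`. Expressions that are closed only thanks to other cells are thereby
  -- included.
  | d_cell (p q r : ℤ) (h) (h') (x) (b) : P.good p q h x b → Rel r (.d q r h' x) (.zero r) →
      Rel q (.d p q h (.cell p q h x b)) x
  | pos (n : ℤ) (x) : 0 < n → Rel n x (.zero n)
  | eps_zero (p q : ℤ) (h) (x) : P.noEps → Rel q (.eps p q h x) (.zero q)
  | add_assoc (n : ℤ) (x y z) : Rel n (.add (.add x y) z) (.add x (.add y z))
  | add_comm (n : ℤ) (x y) : Rel n (.add x y) (.add y x)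
  | zero_add (n : ℤ) (x) : Rel n (.add (.zero n) x) x
  | one_smul (n : ℤ) (x) : Rel n (.smul 1 x) x
  | mul_smul (n : ℤ) (c c' : k) (x) : Rel n (.smul (c * c') x) (.smul c (.smul c' x))
  | add_smul (n : ℤ) (c c' : k) (x) : Rel n (.smul (c + c') x) (.add (.smul c x) (.smul c' x))
  | smul_add (n : ℤ) (c : k) (x y) : Rel n (.smul c (.add x y)) (.add (.smul c x) (.smul c y))
  | zero_smul (n : ℤ) (x) : Rel n (.smul 0 x) (.zero n)
  | smul_zero (n : ℤ) (c : k) : Rel n (.smul c (.zero n)) (.zero n)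
  | d_add (p q : ℤ) (h) (x y) : Rel q (.d p q h (.add x y)) (.add (.d p q h x) (.d p q h y))
  | d_smul (p q : ℤ) (h) (c : k) (x) : Rel q (.d p q h (.smul c x)) (.smul c (.d p q h x))
  | d_d (p q r : ℤ) (h) (h') (x) : Rel r (.d q r h' (.d p q h x)) (.zero r)
  | eps_add (p q : ℤ) (h) (x y) : Rel q (.eps p q h (.add x y)) (.add (.eps p q h x) (.eps p q h y))
  | eps_smul (p q : ℤ) (h) (c : k) (x) : Rel q (.eps p q h (.smul c x)) (.smul c (.eps p q h x))
  | eps_eps (p q r : ℤ) (h) (h') (x) : Rel r (.eps q r h' (.eps p q h x)) (.zero r)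
  | d_eps (p q r : ℤ) (h) (h') (h'') (h''') (x) :
      Rel p (.add (.d q p h' (.eps p q h x)) (.eps r p h''' (.d p r h'' x))) (.zero p)
  | add_mul (p q r : ℤ) (h) (x x' y) :
      Rel r (.mul p q r h (.add x x') y) (.add (.mul p q r h x y) (.mul p q r h x' y))
  | mul_add (p q r : ℤ) (h) (x y y') :
      Rel r (.mul p q r h x (.add y y')) (.add (.mul p q r h x y) (.mul p q r h x y'))
  | smul_mul (p q r : ℤ) (h) (c : k) (x y) :
      Rel r (.mul p q r h (.smul c x) y) (.smul c (.mul p q r h x y))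
  | mul_smul' (p q r : ℤ) (h) (c : k) (x y) :
      Rel r (.mul p q r h x (.smul c y)) (.smul c (.mul p q r h x y))
  | one_mul (p : ℤ) (h) (x) : Rel p (.mul 0 p p h .one x) x
  | mul_assoc (p q r pq qr s : ℤ) (h₁) (h₂) (h₃) (h₄) (x y z) :
      Rel s (.mul pq r s h₃ (.mul p q pq h₁ x y) z) (.mul p qr s h₄ x (.mul q r qr h₂ y z))
  | mul_comm (p q r : ℤ) (h) (h') (x y) :
      Rel r (.mul p q r h x y) (.smul (sign k (p * q)) (.mul q p r h' y x))
  | d_mul (p q r p' q' r' : ℤ) (h) (hp) (hq) (hr) (h') (h'') (x y) :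
      Rel r' (.d r r' hr (.mul p q r h x y))
        (.add (.mul p' q r' h' (.d p p' hp x) y)
          (.smul (sign k p) (.mul p q' r' h'' x (.d q q' hq y))))
  | eps_mul (p q r p' q' r' : ℤ) (h) (hp) (hq) (hr) (h') (h'') (x y) :
      Rel r' (.eps r r' hr (.mul p q r h x y))
        (.add (.mul p' q r' h' (.eps p p' hp x) y)
          (.smul (sign k p) (.mul p q' r' h'' x (.eps q q' hq y))))

/-- The expressions up to congruence. -/
def setoid (n : ℤ) : Setoid (P.Tm n) :=
  ⟨P.Rel n, ⟨Rel.refl n, fun {x y} => Rel.symm n x y, fun {x y z} => Rel.trans n x y z⟩⟩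

/-- The graded pieces of the presented `ε`-cdga. -/
def Carrier (n : ℤ) : Type u := Quotient (P.setoid n)

variable {P}

/-- The class of an expression. -/
def cls {n : ℤ} (x : P.Tm n) : P.Carrier n := Quotient.mk (P.setoid n) x

lemma cls_eq {n : ℤ} {x y : P.Tm n} (h : P.Rel n x y) : cls x = cls y :=
  Quotient.sound (s := P.setoid n) h

lemma rel_of_cls_eq {n : ℤ} {x y : P.Tm n} (h : cls x = cls y) : P.Rel n x y :=
  Quotient.exact (s := P.setoid n) h

lemma cls_surjective {n : ℤ} (a : P.Carrier n) : ∃ x : P.Tm n, cls x = a :=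
  Quotient.exists_rep a

variable (P)

instance (n : ℤ) : Zero (P.Carrier n) := ⟨cls (Term.zero n)⟩

instance (n : ℤ) : Add (P.Carrier n) :=
  ⟨Quotient.map₂ (sa := P.setoid n) (sb := P.setoid n) (sc := P.setoid n) Term.add
    fun _ _ h _ _ h' => Rel.congr_add n _ _ _ _ h h'⟩

instance (n : ℤ) : AddCommMonoid (P.Carrier n) where
  add_assoc := by
    rintro ⟨x⟩ ⟨y⟩ ⟨z⟩
    exact cls_eq (Rel.add_assoc n x y z)
  add_comm := by
    rintro ⟨x⟩ ⟨y⟩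
    exact cls_eq (Rel.add_comm n x y)
  zero_add := by
    rintro ⟨x⟩
    exact cls_eq (Rel.zero_add n x)
  add_zero := by
    rintro ⟨x⟩
    exact (cls_eq (Rel.add_comm n x (Term.zero n))).trans (cls_eq (Rel.zero_add n x))
  nsmul := nsmulRec

instance (n : ℤ) : Module k (P.Carrier n) where
  smul c := Quotient.map (sa := P.setoid n) (sb := P.setoid n) (Term.smul c)
    fun _ _ h => Rel.congr_smul n c _ _ h
  one_smul := by
    rintro ⟨x⟩
    exact cls_eq (Rel.one_smul n x)
  mul_smul := by
    rintro c c' ⟨x⟩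
    exact cls_eq (Rel.mul_smul n c c' x)
  smul_zero c := cls_eq (Rel.smul_zero n c)
  smul_add := by
    rintro c ⟨x⟩ ⟨y⟩
    exact cls_eq (Rel.smul_add n c x y)
  add_smul := by
    rintro c c' ⟨x⟩
    exact cls_eq (Rel.add_smul n c c' x)
  zero_smul := by
    rintro ⟨x⟩
    exact cls_eq (Rel.zero_smul n x)

/-- Expressions contain no negation: the opposite of a class is its multiple by `-1`. -/
instance (n : ℤ) : AddCommGroup (P.Carrier n) := Module.addCommMonoidToAddCommGroup k

/-- The `ε`-cdga of expressions up to congruence. -/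
def data : EpsCdgaData k where
  X := P.Carrier
  d p q h :=
    { toFun := Quotient.map (sa := P.setoid p) (sb := P.setoid q) (Term.d p q h)
        fun _ _ => Rel.congr_d p q h _ _
      map_add' := by
        rintro ⟨x⟩ ⟨y⟩
        exact cls_eq (Rel.d_add p q h x y)
      map_smul' := by
        rintro c ⟨x⟩
        exact cls_eq (Rel.d_smul p q h c x) }
  d_d p q r h h' := by
    rintro ⟨x⟩
    exact cls_eq (Rel.d_d p q r h h' x)
  nonpos n hn := by
    rintro ⟨x⟩
    exact cls_eq (Rel.pos n x hn)
  mul p q r h := LinearMap.mk₂ k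
    (Quotient.map₂ (sa := P.setoid p) (sb := P.setoid q) (sc := P.setoid r) (Term.mul p q r h)
      fun _ _ h₁ _ _ h₂ => Rel.congr_mul p q r h _ _ _ _ h₁ h₂)
    (by
      rintro ⟨x⟩ ⟨x'⟩ ⟨y⟩
      exact cls_eq (Rel.add_mul p q r h x x' y))
    (by
      rintro c ⟨x⟩ ⟨y⟩
      exact cls_eq (Rel.smul_mul p q r h c x y))
    (by
      rintro ⟨x⟩ ⟨y⟩ ⟨y'⟩
      exact cls_eq (Rel.mul_add p q r h x y y'))
    (by
      rintro c ⟨x⟩ ⟨y⟩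
      exact cls_eq (Rel.mul_smul' p q r h c x y))
  one := cls Term.one
  one_mul p := by
    rintro ⟨x⟩
    exact cls_eq (Rel.one_mul p _ x)
  mul_assoc p q r pq qr s h₁ h₂ h₃ := by
    rintro ⟨x⟩ ⟨y⟩ ⟨z⟩
    exact cls_eq (Rel.mul_assoc p q r pq qr s h₁ h₂ h₃ _ x y z)
  mul_comm p q r h := by
    rintro ⟨x⟩ ⟨y⟩
    rw [← sign_smul (k := k)]
    exact cls_eq (Rel.mul_comm p q r h _ x y)
  d_mul p q r p' q' r' h hp hq hr := by
    rintro ⟨x⟩ ⟨y⟩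
    rw [← sign_smul (k := k)]
    exact cls_eq (Rel.d_mul p q r p' q' r' h hp hq hr _ _ x y)
  eps p q h :=
    { toFun := Quotient.map (sa := P.setoid p) (sb := P.setoid q) (Term.eps p q h)
        fun _ _ => Rel.congr_eps p q h _ _
      map_add' := by
        rintro ⟨x⟩ ⟨y⟩
        exact cls_eq (Rel.eps_add p q h x y)
      map_smul' := by
        rintro c ⟨x⟩
        exact cls_eq (Rel.eps_smul p q h c x) }
  eps_eps p q r h h' := by
    rintro ⟨x⟩
    exact cls_eq (Rel.eps_eps p q r h h' x)
  d_eps p q r h h' := by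
    rintro ⟨x⟩
    exact cls_eq (Rel.d_eps p q r h _ h' _ x)
  eps_mul p q r p' q' r' h hp hq hr := by
    rintro ⟨x⟩ ⟨y⟩
    rw [← sign_smul (k := k)]
    exact cls_eq (Rel.eps_mul p q r p' q' r' h hp hq hr _ _ x y)

/-- The presented `ε`-cdga. -/
def obj : EpsCdga k := P.data.toEpsCdga

variable {P}

/-- The class of an expression in the presented `ε`-cdga. -/
def el {n : ℤ} (x : P.Tm n) : P.obj.X n := cls x

lemma el_surjective {n : ℤ} (a : P.obj.X n) : ∃ x : P.Tm n, el x = a := cls_surjective a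

lemma el_eq {n : ℤ} {x y : P.Tm n} (h : P.Rel n x y) : el x = el y := cls_eq h

lemma rel_of_el_eq {n : ℤ} {x y : P.Tm n} (h : el x = el y) : P.Rel n x y := rel_of_cls_eq h

lemma el_zero (n : ℤ) : el (P := P) (Term.zero n) = 0 := rfl

lemma el_add {n : ℤ} (x y : P.Tm n) : el (Term.add x y) = el x + el y := rfl

lemma el_smul {n : ℤ} (c : k) (x : P.Tm n) : el (Term.smul c x) = c • el x := rfl

lemma el_one : el (P := P) Term.one = P.obj.one := rfl

lemma el_mul (p q r : ℤ) (h : p + q = r) (x : P.Tm p) (y : P.Tm q) :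
    el (Term.mul p q r h x y) = P.obj.mul p q r h (el x) (el y) := rfl

lemma el_eps (p q : ℤ) (h : q + 1 = p) (x : P.Tm p) :
    el (Term.eps p q h x) = P.obj.eps p q h (el x) := rfl

lemma el_d (p q : ℤ) (h : p + 1 = q) (x : P.Tm p) :
    el (Term.d p q h x) = P.obj.d p q (el x) :=
  (P.data.toEpsCdga_d h (cls x)).symm

variable (P) in
/-- The formal primitives, on classes. -/
def cell (p q : ℤ) (h : p + 1 = q) (a : P.obj.X q) (b : P.B p) : P.obj.X p :=
  Quotient.map (sa := P.setoid q) (sb := P.setoid p) (fun x => Term.cell p q h x b)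
    (fun _ _ => Rel.congr_cell p q h _ _ b) a

lemma obj_eps_eq_zero (hP : P.noEps) (p q : ℤ) (h : q + 1 = p) (a : P.obj.X p) :
    P.obj.eps p q h a = 0 := by
  obtain ⟨x, rfl⟩ := el_surjective a
  exact el_eq (Rel.eps_zero p q h x hP)

/-- Two morphisms out of a presented `ε`-cdga agree if they agree on generators and on formal
primitives. -/
lemma hom_ext {E : EpsCdga k} {f g : P.obj ⟶ E}
    (hG : ∀ (n : ℤ) (x : P.G n), app f n (el (Term.gen n x)) = app g n (el (Term.gen n x)))
    (hB : ∀ (p q : ℤ) (h : p + 1 = q) (z : P.Tm q) (b : P.B p),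
      app f q (el z) = app g q (el z) →
        app f p (el (Term.cell p q h z b)) = app g p (el (Term.cell p q h z b))) : f = g := by
  apply EpsCdga.hom_ext
  intro n a
  obtain ⟨x, rfl⟩ := el_surjective a
  induction x with
  | gen n x => exact hG n x
  | zero n => rw [el_zero, map_zero, map_zero]
  | add x y hx hy => rw [el_add, map_add, map_add, hx, hy]
  | smul c x hx => rw [el_smul, map_smul, map_smul, hx]
  | one => rw [el_one, app_one, app_one]
  | mul p q r h x y hx hy => rw [el_mul, app_mul, app_mul, hx, hy]
  | d p q h x hx => rw [el_d, app_d, app_d, hx]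
  | eps p q h x hx => rw [el_eps, app_eps, app_eps, hx]
  | cell p q h z b hz => exact hB p q h z b hz

section lift

variable {E : EpsCdga k} (g : ∀ n : ℤ, P.G n → E.X n)
  (c : ∀ p q : ℤ, p + 1 = q → P.Tm q → E.X q → P.B p → E.X p)

variable (hE : P.noEps → ∀ (p q : ℤ) (h : q + 1 = p) (a : E.X p), E.eps p q h a = 0)
  (hR : ∀ (n : ℤ) (x y : P.Tm n), P.R n x y → Term.eval g c x = Term.eval g c y)
  (hc : ∀ (p q : ℤ) (h : p + 1 = q) (z z' : P.Tm q) (a : E.X q) (b : P.B p), el z = el z' →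
    c p q h z a b = c p q h z' a b)
  (hd : ∀ (p q r : ℤ) (h : p + 1 = q) (_ : q + 1 = r) (z : P.Tm q) (b : P.B p),
    P.good p q h z b → P.obj.d q r (el z) = 0 → E.d q r (Term.eval g c z) = 0 →
      E.d p q (c p q h z (Term.eval g c z) b) = Term.eval g c z)

-- By induction on the congruence. The operation `c` sees the expression `z` besides its value, so
-- that a lift can take into account a prescribed image of `cell z b`; `hc` says that only the class
-- of `z` matters. In the case of `d_cell` the closedness of the value of `z` is the induction
-- hypothesis, so `hd` may assume it.
include hE hR hc hd in
lemma eval_eq_of_rel {n : ℤ} {x y : P.Tm n} (hxy : P.Rel n x y) : Term.eval g c x = Term.eval g c y := by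
  induction hxy with
  | refl n x => rfl
  | symm n x y _ h => exact h.symm
  | trans n x y z _ _ h h' => exact h.trans h'
  | congr_add n x x' y y' _ _ h h' => simp only [Term.eval, h, h']
  | congr_smul n c x x' _ h => simp only [Term.eval, h]
  | congr_mul p q r _ x x' y y' _ _ h h' => simp only [Term.eval, h, h']
  | congr_d p q _ x x' _ h => simp only [Term.eval, h]
  | congr_eps p q _ x x' _ h => simp only [Term.eval, h]
  | congr_cell p q h x x' b hx hxx' =>
    simp only [Term.eval, hxx']
    exact hc p q h x x' _ b (el_eq hx)
  | rel n x y h => exact hR n x y h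
  | d_cell p q r h h' x b hg hx hdx =>
    exact hd p q r h h' x b hg (by rw [← el_d q r h', el_eq hx, el_zero]) hdx
  | pos n x hn => exact E.eq_zero_of_pos hn _
  | eps_zero p q h x hP => exact hE hP p q h _
  | add_assoc n x y z => exact add_assoc _ _ _
  | add_comm n x y => exact add_comm _ _
  | zero_add n x => exact zero_add _
  | one_smul n x => exact one_smul _ _
  | mul_smul n c c' x => exact mul_smul _ _ _
  | add_smul n c c' x => exact add_smul _ _ _
  | smul_add n c x y => exact smul_add _ _ _
  | zero_smul n x => exact zero_smul _ _
  | smul_zero n c => exact smul_zero _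
  | d_add p q h x y => exact map_add _ _ _
  | d_smul p q h c x => exact map_smul _ _ _
  | d_d p q r h h' x => exact E.d_d p q r _
  | eps_add p q h x y => exact map_add _ _ _
  | eps_smul p q h c x => exact map_smul _ _ _
  | eps_eps p q r h h' x => exact E.eps_eps p q r h h' _
  | d_eps p q r h h' h'' h''' x => exact E.d_eps p q r h h'' _
  | add_mul p q r h x x' y => exact LinearMap.map_add₂ _ _ _ _
  | mul_add p q r h x y y' => exact map_add _ _ _
  | smul_mul p q r h c x y => exact LinearMap.map_smul₂ _ _ _ _
  | mul_smul' p q r h c x y => exact map_smul _ _ _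
  | one_mul p h x => exact E.alg.one_mul p _
  | mul_assoc p q r pq qr s h₁ h₂ h₃ h₄ x y z =>
    exact E.alg.mul_assoc p q r pq qr s h₁ h₂ h₃ _ _ _
  | mul_comm p q r h h' x y =>
    simp only [Term.eval, sign_smul]
    exact E.alg.mul_comm p q r h _ _
  | d_mul p q r p' q' r' h hp hq hr h' h'' x y =>
    simp only [Term.eval, sign_smul]
    exact E.d_mul p q r p' q' r' h hp hq hr _ _
  | eps_mul p q r p' q' r' h hp hq hr h' h'' x y =>
    simp only [Term.eval, sign_smul]
    exact E.eps_mul p q r p' q' r' h hp hq hr _ _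

/-- The universal property of a presented `ε`-cdga. -/
def lift : P.obj ⟶ E :=
  homMk
    (fun n =>
      { toFun := fun a => Quotient.lift (s := P.setoid n) (Term.eval g c)
          (fun _ _ h => eval_eq_of_rel g c hE hR hc hd h) a
        map_add' := by
          rintro ⟨x⟩ ⟨y⟩
          rfl
        map_smul' := by
          rintro c ⟨x⟩
          rfl })
    (by
      intro p q h a
      obtain ⟨x, rfl⟩ := el_surjective a
      rw [← el_d p q h]
      rfl)
    rfl
    (by
      rintro p q r h ⟨x⟩ ⟨y⟩
      rfl)
    (by
      rintro p q h ⟨x⟩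
      rfl)

end lift

end Presentation

end EpsCdga

/-! ### Limits and colimits in both categories -/

namespace EpsCdga

variable {k : Type u} [CommRing k]

section limits

variable {J : Type u} [Category.{u} J] (K : J ⥤ EpsCdga k)

/-- The compatible families of elements of degree `n` in a diagram of `ε`-cdga's. -/
def sections (n : ℤ) : Submodule k (∀ j, (K.obj j).X n) where
  carrier := {x | ∀ (i j : J) (f : i ⟶ j), app (K.map f) n (x i) = x j}
  add_mem' hx hy i j f := by
    simp only [Pi.add_apply, map_add, hx i j f, hy i j f]
  zero_mem' i j f := map_zero _
  smul_mem' c x hx i j f := by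
    simp only [Pi.smul_apply, map_smul, hx i j f]

lemma sections_ext {n : ℤ} {x y : sections K n} (h : ∀ j, x.1 j = y.1 j) : x = y :=
  Subtype.ext (funext h)

/-- The limit of a diagram of `ε`-cdga's. -/
def limitData : EpsCdgaData k where
  X := fun n => sections K n
  d p q h :=
    { toFun x := ⟨fun j => (K.obj j).d p q (x.1 j), fun i j f => by rw [app_d, x.2 i j f]⟩
      map_add' x y := sections_ext K fun j => map_add _ _ _
      map_smul' c x := sections_ext K fun j => map_smul _ _ _ }
  d_d p q r h h' x := sections_ext K fun j => (K.obj j).d_d _ _ _ _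
  nonpos n hn x := sections_ext K fun j => (K.obj j).eq_zero_of_pos hn _
  mul p q r h := LinearMap.mk₂ k
    (fun x y => ⟨fun j => (K.obj j).mul p q r h (x.1 j) (y.1 j), fun i j f => by
      rw [app_mul, x.2 i j f, y.2 i j f]⟩)
    (fun x x' y => sections_ext K fun j => LinearMap.map_add₂ _ _ _ _)
    (fun c x y => sections_ext K fun j => LinearMap.map_smul₂ _ _ _ _)
    (fun x y y' => sections_ext K fun j => map_add _ _ _)
    (fun c x y => sections_ext K fun j => map_smul _ _ _)
  one := ⟨fun j => (K.obj j).one, fun i j f => app_one _⟩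
  one_mul p a := sections_ext K fun j => (K.obj j).alg.one_mul p _
  mul_assoc p q r pq qr s h₁ h₂ h₃ a b c := sections_ext K fun j =>
    (K.obj j).alg.mul_assoc p q r pq qr s h₁ h₂ h₃ _ _ _
  mul_comm p q r h a b := sections_ext K fun j => (K.obj j).alg.mul_comm p q r h _ _
  d_mul p q r p' q' r' h hp hq hr a b := sections_ext K fun j =>
    (K.obj j).d_mul p q r p' q' r' h hp hq hr _ _
  eps p q h :=
    { toFun x := ⟨fun j => (K.obj j).eps p q h (x.1 j), fun i j f => by rw [app_eps, x.2 i j f]⟩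
      map_add' x y := sections_ext K fun j => map_add _ _ _
      map_smul' c x := sections_ext K fun j => map_smul _ _ _ }
  eps_eps p q r h h' x := sections_ext K fun j => (K.obj j).eps_eps _ _ _ _ _ _
  d_eps p q r h h' x := sections_ext K fun j => (K.obj j).d_eps _ _ _ _ _ _
  eps_mul p q r p' q' r' h hp hq hr a b := sections_ext K fun j =>
    (K.obj j).eps_mul p q r p' q' r' h hp hq hr _ _

/-- The limit cone of a diagram of `ε`-cdga's. -/
def limitCone : Cone K where
  pt := (limitData K).toEpsCdga
  π :=
    { app j := (limitData K).homOut (fun n => (LinearMap.proj j).comp (sections K n).subtype)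
        (fun _ _ _ _ => rfl) rfl (fun _ _ _ _ _ _ => rfl) (fun _ _ _ _ => rfl)
      naturality i j f := hom_ext fun _ x => (x.2 i j f).symm }

/-- The limit cone of a diagram of `ε`-cdga's is a limit. -/
def limitConeIsLimit : IsLimit (limitCone K) where
  lift s := (limitData K).homIn
    (fun _ =>
      { toFun x := ⟨fun j => app (s.π.app j) _ x, fun i j f => by
          rw [← app_comp, s.w]⟩
        map_add' x y := sections_ext K fun j => map_add _ _ _
        map_smul' c x := sections_ext K fun j => map_smul _ _ _ })
    (fun p q h x => sections_ext K fun j => app_d _ _ _ _)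
    (sections_ext K fun j => app_one _)
    (fun p q r h a b => sections_ext K fun j => app_mul _ _ _ _ _ _ _)
    (fun p q h a => sections_ext K fun j => app_eps _ _ _ _ _)
  fac s j := rfl
  uniq s m hm := hom_ext fun n x => sections_ext K fun j =>
    congrArg (fun f => app f n x) (hm j)

end limits

/-- The condition `ε = 0`. -/
@[reducible] def EpsZero (E : EpsCdga k) : Prop :=
  ∀ (p q : ℤ) (h : q + 1 = p) (a : E.X p), E.eps p q h a = 0

/-- A category `C` equivalent to the category of all `ε`-cdga's, or (if `noEps` holds) to the
category of those with `ε = 0`. -/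
structure Realization (k : Type u) [CommRing k] (C : Type*) [Category.{u} C] where
  /-- the functor to `ε`-cdga's -/
  U : C ⥤ EpsCdga k
  /-- `U` is fully faithful -/
  ff : U.FullyFaithful
  /-- whether `ε` vanishes -/
  noEps : Prop
  epsZero : noEps → ∀ X : C, EpsZero (U.obj X)
  /-- the object with given image -/
  of : ∀ E : EpsCdga k, (noEps → EpsZero E) → C
  /-- `U` sends `of E` to `E` -/
  iso : ∀ (E : EpsCdga k) (h : noEps → EpsZero E), U.obj (of E h) ≅ E

namespace Realization

variable {C : Type*} [Category.{u} C] (S : Realization k C)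

/-- Morphisms into an object `of E`. -/
def homTo {X : C} {E : EpsCdga k} {h : S.noEps → EpsZero E} (f : S.U.obj X ⟶ E) : X ⟶ S.of E h :=
  S.ff.preimage (f ≫ (S.iso E h).inv)

/-- Morphisms out of an object `of E`. -/
def homFrom {X : C} {E : EpsCdga k} {h : S.noEps → EpsZero E} (f : E ⟶ S.U.obj X) : S.of E h ⟶ X :=
  S.ff.preimage ((S.iso E h).hom ≫ f)

@[simp]
lemma map_homTo {X : C} {E : EpsCdga k} {h : S.noEps → EpsZero E} (f : S.U.obj X ⟶ E) :
    S.U.map (S.homTo (h := h) f) = f ≫ (S.iso E h).inv :=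
  S.ff.map_preimage _

@[simp]
lemma map_homFrom {X : C} {E : EpsCdga k} {h : S.noEps → EpsZero E} (f : E ⟶ S.U.obj X) :
    S.U.map (S.homFrom (h := h) f) = (S.iso E h).hom ≫ f :=
  S.ff.map_preimage _

lemma eq_homFrom {X : C} {E : EpsCdga k} {h : S.noEps → EpsZero E} {f : E ⟶ S.U.obj X}
    {m : S.of E h ⟶ X} (hm : (S.iso E h).inv ≫ S.U.map m = f) : m = S.homFrom f :=
  S.ff.map_injective (by rw [map_homFrom, ← Iso.inv_comp_eq, hm])

-- `ε` acts componentwise on a limit, so the objects with `ε = 0` are closed under limits and the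
-- fully faithful `U` creates them.
include S in
lemma hasLimits : HasLimitsOfSize.{u, u} C where
  has_limits_of_shape J _ :=
    { has_limit K := by
        have := S.ff.full
        have := S.ff.faithful
        have hl := limitConeIsLimit (K ⋙ S.U)
        have h0 : S.noEps → EpsZero (limitCone (K ⋙ S.U)).pt := fun hS p q h a =>
          sections_ext _ fun j => S.epsZero hS _ _ _ _ _
        have : HasLimit (K ⋙ S.U) := ⟨⟨_, hl⟩⟩
        have := createsLimitOfFullyFaithfulOfIso' hl _ (S.iso _ h0)
        exact hasLimit_of_created K S.U }

section colimits

variable {J : Type u} [Category.{u} J] (K : J ⥤ C)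

/-- The generators of a colimit. -/
abbrev ColimitGen (n : ℤ) : Type u := Σ j : J, (S.U.obj (K.obj j)).X n

open Term in
/-- The relations of a colimit. -/
inductive ColimitRel : ∀ n : ℤ, Term k (S.ColimitGen K) (fun _ => PEmpty) n →
    Term k (S.ColimitGen K) (fun _ => PEmpty) n → Prop
  | map (n : ℤ) (i j : J) (f : i ⟶ j) (x : (S.U.obj (K.obj i)).X n) :
      ColimitRel n (gen n ⟨i, x⟩) (gen n ⟨j, app (S.U.map (K.map f)) n x⟩)
  | add (n : ℤ) (j : J) (x y : (S.U.obj (K.obj j)).X n) :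
      ColimitRel n (gen n ⟨j, x + y⟩) (.add (gen n ⟨j, x⟩) (gen n ⟨j, y⟩))
  | smul (n : ℤ) (j : J) (c : k) (x : (S.U.obj (K.obj j)).X n) :
      ColimitRel n (gen n ⟨j, c • x⟩) (.smul c (gen n ⟨j, x⟩))
  | one (j : J) : ColimitRel 0 (gen 0 ⟨j, (S.U.obj (K.obj j)).one⟩) .one
  | mul (p q r : ℤ) (h) (j : J) (x : (S.U.obj (K.obj j)).X p) (y : (S.U.obj (K.obj j)).X q) :
      ColimitRel r (gen r ⟨j, (S.U.obj (K.obj j)).mul p q r h x y⟩)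
        (.mul p q r h (gen p ⟨j, x⟩) (gen q ⟨j, y⟩))
  | d (p q : ℤ) (h) (j : J) (x : (S.U.obj (K.obj j)).X p) :
      ColimitRel q (gen q ⟨j, (S.U.obj (K.obj j)).d p q x⟩) (.d p q h (gen p ⟨j, x⟩))
  | eps (p q : ℤ) (h) (j : J) (x : (S.U.obj (K.obj j)).X p) :
      ColimitRel q (gen q ⟨j, (S.U.obj (K.obj j)).eps p q h x⟩) (.eps p q h (gen p ⟨j, x⟩))

/-- The presentation of a colimit. -/
def colimitPresentation : Presentation k where
  G := S.ColimitGen K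
  B _ := PEmpty
  good _ _ _ _ _ := False
  R := S.ColimitRel K
  noEps := S.noEps

open Presentation in
/-- The inclusions into a colimit. -/
def colimitι (j : J) : S.U.obj (K.obj j) ⟶ (S.colimitPresentation K).obj :=
  homMk
    (fun n =>
      { toFun x := el (P := S.colimitPresentation K) (Term.gen n ⟨j, x⟩)
        map_add' x y := el_eq (P := S.colimitPresentation K) (.rel _ _ _ (ColimitRel.add n j x y))
        map_smul' c x := el_eq (P := S.colimitPresentation K) (.rel _ _ _ (ColimitRel.smul n j c x)) })
    (fun p q h x => (el_eq (P := S.colimitPresentation K) (.rel _ _ _ (ColimitRel.d p q h j x))).trans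
      (el_d p q h _))
    (el_eq (P := S.colimitPresentation K) (.rel _ _ _ (ColimitRel.one j)))
    (fun p q r h x y => el_eq (P := S.colimitPresentation K) (.rel _ _ _ (ColimitRel.mul p q r h j x y)))
    (fun p q h x => el_eq (P := S.colimitPresentation K) (.rel _ _ _ (ColimitRel.eps p q h j x)))

lemma colimitι_naturality {i j : J} (f : i ⟶ j) :
    S.U.map (K.map f) ≫ S.colimitι K j = S.colimitι K i :=
  EpsCdga.hom_ext fun n x => (Presentation.el_eq (P := S.colimitPresentation K)
    (.rel _ _ _ (ColimitRel.map n i j f x))).symm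

/-- The universal property of a colimit. -/
def colimitDesc {E : EpsCdga k} (hE : S.noEps → EpsZero E) (g : ∀ j, S.U.obj (K.obj j) ⟶ E)
    (hg : ∀ (i j : J) (f : i ⟶ j), S.U.map (K.map f) ≫ g j = g i) :
    (S.colimitPresentation K).obj ⟶ E :=
  Presentation.lift (fun n x => app (g x.1) n x.2) (fun _ _ _ _ _ b => b.elim) hE
    (by
      intro n x y h
      induction h with
      | map n i j f x =>
        simp only [Term.eval]
        rw [← app_comp, hg]
      | _ => simp only [Term.eval, map_add, map_smul, app_one, app_mul, app_d, app_eps])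
    (fun _ _ _ _ _ _ b => b.elim) (fun _ _ _ _ _ _ b => b.elim)

/-- The colimit cocone of a diagram. -/
def colimitCocone : Cocone K where
  pt := S.of (S.colimitPresentation K).obj
    (fun h => Presentation.obj_eps_eq_zero (P := S.colimitPresentation K) h)
  ι :=
    { app j := S.homTo (S.colimitι K j)
      naturality i j f := S.ff.map_injective (by
        dsimp
        rw [S.U.map_comp, S.U.map_comp, S.map_homTo, S.map_homTo, ← Category.assoc,
          colimitι_naturality]
        simp) }

/-- The colimit cocone of a diagram is a colimit. -/
def colimitCoconeIsColimit : IsColimit (S.colimitCocone K) where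
  desc s := S.homFrom (S.colimitDesc K (fun h => S.epsZero h _) (fun j => S.U.map (s.ι.app j))
    (fun i j f => by rw [← S.U.map_comp, s.w]))
  fac s j := S.ff.map_injective (by
    simp only [S.U.map_comp, colimitCocone, map_homTo, map_homFrom, Category.assoc,
      Iso.inv_hom_id_assoc]
    rfl)
  uniq s m hm := S.eq_homFrom (by
    apply Presentation.hom_ext
    · rintro n ⟨j, x⟩
      refine Eq.trans ?_ (congrArg (fun f => app (S.U.map f) n x) (hm j))
      rw [S.U.map_comp]
      simp only [colimitCocone, map_homTo, Category.assoc]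
      rfl
    · exact fun _ _ _ _ b => b.elim)

end colimits

-- The vanishing of `ε`, when required, is among the relations of the presentation, so one
-- construction serves both categories.
include S in
lemma hasColimits : HasColimitsOfSize.{u, u} C where
  has_colimits_of_shape _ _ :=
    { has_colimit K := ⟨⟨_, S.colimitCoconeIsColimit K⟩⟩ }

end Realization

end EpsCdga

/-! ### Adjoining a variable `η` of degree `1` -/

namespace EpsCdga

variable {k : Type u} [CommRing k]

/-- The identification of graded pieces of equal degrees. -/
def castX (E : EpsCdga k) {p q : ℤ} (h : p = q) : E.X p →ₗ[k] E.X q := h ▸ LinearMap.id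

section castX

variable (E : EpsCdga k) {p q : ℤ} (h : p = q)

@[simp]
lemma castX_rfl (x : E.X p) : E.castX rfl x = x := rfl

@[simp]
lemma castX_castX {r : ℤ} (h' : q = r) (x : E.X p) :
    E.castX h' (E.castX h x) = E.castX (h.trans h') x := by
  subst h h'; rfl

@[simp]
lemma d_castX (r : ℤ) (x : E.X p) : E.d q r (E.castX h x) = E.d p r x := by
  subst h; rfl

@[simp]
lemma castX_d (r : ℤ) (x : E.X r) : E.castX h (E.d r p x) = E.d r q x := by
  subst h; rfl

@[simp]
lemma eps_castX (r : ℤ) (h' : r + 1 = q) (x : E.X p) :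
    E.eps q r h' (E.castX h x) = E.eps p r (by omega) x := by
  subst h; rfl

@[simp]
lemma castX_eps (r : ℤ) (h' : p + 1 = r) (x : E.X r) :
    E.castX h (E.eps r p h' x) = E.eps r q (by omega) x := by
  subst h; rfl

@[simp]
lemma mul_castX_left (r s : ℤ) (h' : q + r = s) (x : E.X p) (y : E.X r) :
    E.mul q r s h' (E.castX h x) y = E.mul p r s (by omega) x y := by
  subst h; rfl

@[simp]
lemma mul_castX_right (r s : ℤ) (h' : r + q = s) (x : E.X r) (y : E.X p) :
    E.mul r q s h' x (E.castX h y) = E.mul r p s (by omega) x y := by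
  subst h; rfl

@[simp]
lemma castX_mul (r s : ℤ) (h' : r + s = p) (x : E.X r) (y : E.X s) :
    E.castX h (E.mul r s p h' x y) = E.mul r s q (by omega) x y := by
  subst h; rfl

end castX

/-- A derivation of degree `0` of an `ε`-cdga, commuting with `d` and `ε`, and annihilated by
a scalar `c`. -/
structure ScaledDerivation (E : EpsCdga k) where
  /-- the derivation -/
  D : ∀ n : ℤ, E.X n →ₗ[k] E.X n
  /-- the scalar -/
  c : k
  map_mul : ∀ (p q r : ℤ) (h : p + q = r) (a : E.X p) (b : E.X q),
    D r (E.mul p q r h a b) = E.mul p q r h (D p a) b + E.mul p q r h a (D q b)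
  map_d : ∀ (p q : ℤ) (a : E.X p), D q (E.d p q a) = E.d p q (D p a)
  map_eps : ∀ (p q : ℤ) (h : q + 1 = p) (a : E.X p), D q (E.eps p q h a) = E.eps p q h (D p a)
  smul_eq_zero : ∀ (n : ℤ) (a : E.X n), c • D n a = 0

namespace ScaledDerivation

variable {E : EpsCdga k} (δ : ScaledDerivation E)

/-- The Leibniz rule for `1 · 1` reads `D 1 = D 1 + D 1`. -/
lemma map_one : δ.D 0 E.one = 0 := by
  have h := δ.map_mul 0 0 0 (by omega) E.one E.one
  rw [E.alg.mul_comm 0 0 0 _ (δ.D 0 E.one) E.one, E.alg.one_mul, E.alg.one_mul] at h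
  simpa using h

@[simp]
lemma D_castX {p q : ℤ} (h : p = q) (x : E.X p) : δ.D q (E.castX h x) = E.castX h (δ.D p x) := by
  subst h; rfl

/-- The elements `x + ηy` of degree `n`, where `η` has degree `1`, of the truncation in degrees
`≤ 0` of `E[η]`. -/
def thickening (n : ℤ) : Submodule k (E.X n × E.X (n - 1)) where
  -- Truncation keeps only cocycles in degree `0`. As `E` vanishes in degree `1`, the sole condition
  -- there is that the `η`-component `Dx - dy` of the differential is zero.
  carrier := {z | (0 ≤ n → E.d (n - 1) n z.2 = δ.D n z.1) ∧ (0 < n → z.2 = 0)}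
  add_mem' h h' := ⟨fun hn => by simp [h.1 hn, h'.1 hn], fun hn => by simp [h.2 hn, h'.2 hn]⟩
  zero_mem' := ⟨fun _ => by simp, fun _ => rfl⟩
  smul_mem' c z h := ⟨fun hn => by simp [h.1 hn], fun hn => by simp [h.2 hn]⟩

variable {δ} in
lemma thickening_ext {n : ℤ} {z w : δ.thickening n} (h₁ : z.1.1 = w.1.1) (h₂ : z.1.2 = w.1.2) :
    z = w :=
  Subtype.ext (Prod.ext h₁ h₂)

lemma negOnePow_sub_one (p : ℤ) : (p - 1).negOnePow = -p.negOnePow := by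
  simp [Int.negOnePow_sub]

/-- The differential of `E[η]`. -/
def thickeningD (p q : ℤ) (h : p + 1 = q) : δ.thickening p →ₗ[k] δ.thickening q where
  toFun z := ⟨⟨E.d p q z.1.1, E.castX (by omega) (δ.D p z.1.1) - E.d (p - 1) (q - 1) z.1.2⟩,
    fun _ => by simp [δ.map_d], fun hq => by
      have := z.2.1 (by omega)
      simp [← this]⟩
  map_add' z w := thickening_ext (by simp) (by simp; abel)
  map_smul' c z := thickening_ext (by simp) (by simp [smul_sub])

/-- The operator `ε` of `E[η]`. -/
def thickeningEps (p q : ℤ) (h : q + 1 = p) : δ.thickening p →ₗ[k] δ.thickening q where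
  toFun z := ⟨⟨E.eps p q h z.1.1 + δ.c • E.castX (by omega) z.1.2,
      -E.eps (p - 1) (q - 1) (by omega) z.1.2⟩,
    fun hq => by
      -- A target of degree `≥ 0` means a source of positive degree, where both components vanish.
      have h₁ := E.eq_zero_of_pos (by omega) z.1.1
      have h₂ := z.2.2 (by omega)
      simp [h₁, h₂], fun hq => by simp [z.2.2 (by omega)]⟩
  map_add' z w := thickening_ext (by simp; abel) (by simp; abel)
  map_smul' c z := thickening_ext (by simp [smul_smul, mul_comm]) (by simp)

/-- The product of `E[η]`. -/
def thickeningMul (p q r : ℤ) (h : p + q = r) :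
    δ.thickening p →ₗ[k] δ.thickening q →ₗ[k] δ.thickening r :=
  LinearMap.mk₂ k
    (fun z w => ⟨⟨E.mul p q r h z.1.1 w.1.1,
        E.mul (p - 1) q (r - 1) (by omega) z.1.2 w.1.1 +
          p.negOnePow • E.mul p (q - 1) (r - 1) (by omega) z.1.1 w.1.2⟩, by
      by_cases hp : 0 < p
      · have h₁ := E.eq_zero_of_pos hp z.1.1
        have h₂ := z.2.2 hp
        simp only [h₁, h₂, map_zero, LinearMap.zero_apply, smul_zero, add_zero]
        exact zero_mem _
      by_cases hq : 0 < q
      · have h₁ := E.eq_zero_of_pos hq w.1.1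
        have h₂ := w.2.2 hq
        simp only [h₁, h₂, map_zero, smul_zero, add_zero]
        exact zero_mem _
      -- With `p, q ≤ 0` only `p = q = r = 0` is left, where the Leibniz rules for `d` and `D` show
      -- that a product of cocycles is a cocycle.
      refine ⟨fun hr => ?_, fun hr => by omega⟩
      obtain rfl : p = 0 := by omega
      obtain rfl : q = 0 := by omega
      obtain rfl : r = 0 := by omega
      simp only [Int.negOnePow_zero, one_smul, map_add, δ.map_mul]
      rw [E.d_mul (0 - 1) 0 (0 - 1) 0 1 0 _ (by omega) (by omega) (by omega),
        E.d_mul 0 (0 - 1) (0 - 1) 1 0 0 _ (by omega) (by omega) (by omega),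
        z.2.1 le_rfl, w.2.1 le_rfl, E.eq_zero_of_pos (n := 1) (by omega) (E.d 0 1 w.1.1),
        E.eq_zero_of_pos (n := 1) (by omega) (E.d 0 1 z.1.1)]
      simp⟩)
    (fun z z' w => thickening_ext (by simp) (by simp; abel))
    (fun c z w => thickening_ext (by simp) (by simp [smul_comm p.negOnePow c]))
    (fun z w w' => thickening_ext (by simp) (by simp; abel))
    (fun c z w => thickening_ext (by simp) (by simp [smul_comm p.negOnePow c]))

/-- The `ε`-cdga `E[η]`, truncated in degrees `≤ 0`, with `d(x + ηy) = dx + η(Dx - dy)` and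
`ε(x + ηy) = (εx + cy) - ηεy`. -/
def thicken : EpsCdgaData k where
  X n := δ.thickening n
  d := δ.thickeningD
  d_d p q r h h' z := thickening_ext (by simp [thickeningD]) (by simp [thickeningD, δ.map_d])
  nonpos n hn z := thickening_ext (E.eq_zero_of_pos hn _) (z.2.2 hn)
  mul := δ.thickeningMul
  one := ⟨⟨E.one, 0⟩, fun _ => by simp [δ.map_one], fun _ => rfl⟩
  one_mul p z := thickening_ext (by simp [thickeningMul, E.alg.one_mul])
    (by simp [thickeningMul, E.alg.one_mul])
  mul_assoc p q r pq qr s h₁ h₂ h₃ a b c := thickening_ext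
    (E.alg.mul_assoc p q r pq qr s h₁ h₂ h₃ _ _ _)
    (by
      subst h₁
      simp only [thickeningMul, LinearMap.mk₂_apply, map_add, LinearMap.add_apply,
        LinearMap.map_smul_of_tower, LinearMap.smul_apply, smul_add, Int.negOnePow_add, mul_smul]
      rw [E.alg.mul_assoc (p - 1) q r _ qr _ _ h₂, E.alg.mul_assoc p (q - 1) r _ (qr - 1) _ _,
        E.alg.mul_assoc p q (r - 1) _ (qr - 1) _ _, add_assoc])
  mul_comm p q r h a b := thickening_ext (E.alg.mul_comm p q r h _ _)
    (by
      simp only [thickeningMul, LinearMap.mk₂_apply, Submodule.coe_smul_of_tower, Prod.smul_snd]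
      rw [E.alg.mul_comm (p - 1) q, E.alg.mul_comm p (q - 1)]
      simp only [smul_add, smul_smul, ← Int.negOnePow_add]
      rw [add_comm]
      congr 2
      · rw [mul_sub, Int.negOnePow_add, Int.negOnePow_sub]
        rw [mul_one, mul_left_comm, Int.units_mul_self, mul_one]
      · rw [sub_mul, one_mul, Int.negOnePow_sub, Int.negOnePow_add])
  d_mul p q r p' q' r' h hp hq hr a b := thickening_ext
    (E.d_mul p q r p' q' r' h hp hq hr _ _)
    (by
      subst hp
      simp only [thickeningMul, thickeningD, LinearMap.mk₂_apply, LinearMap.coe_mk, AddHom.coe_mk,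
        Submodule.coe_add, Submodule.coe_smul_of_tower, Prod.snd_add, Prod.smul_snd, map_add,
        LinearMap.map_smul_of_tower, δ.map_mul, castX_mul, map_sub, LinearMap.sub_apply,
        mul_castX_left, mul_castX_right]
      rw [E.d_mul (p - 1) q (r - 1) (p + 1 - 1) q' (r' - 1) _ (by omega) hq (by omega),
        E.d_mul p (q - 1) (r - 1) (p + 1) (q' - 1) (r' - 1) _ rfl (by omega) (by omega)]
      obtain hs | hs := Int.units_eq_one_or p.negOnePow <;>
        simp [Int.negOnePow_succ, negOnePow_sub_one, hs] <;> abel)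
  eps := δ.thickeningEps
  eps_eps p q r h h' z := thickening_ext (by simp [thickeningEps, E.eps_eps])
    (by simp [thickeningEps, E.eps_eps])
  d_eps p q r h h' z := thickening_ext
    (by
      -- What remains of `dε + εd` in this component is `c • Dx`; this is why `c` must annihilate
      -- `D`.
      have := E.d_eps' p q r h h' z.1.1
      simp [thickeningEps, thickeningD, this, smul_sub, δ.smul_eq_zero]
      abel)
    (by
      have := E.d_eps' (p - 1) (q - 1) (r - 1) (by omega) (by omega) z.1.2
      simp [thickeningEps, thickeningD, this, δ.smul_eq_zero, δ.map_eps])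
  eps_mul p q r p' q' r' h hp hq hr a b := thickening_ext
    (by
      simp only [thickeningMul, thickeningEps, LinearMap.mk₂_apply, LinearMap.coe_mk,
        AddHom.coe_mk, Submodule.coe_add, Submodule.coe_smul_of_tower, Prod.fst_add, Prod.smul_fst,
        map_add, map_smul, LinearMap.add_apply, LinearMap.smul_apply, LinearMap.map_smul_of_tower,
        castX_mul, mul_castX_left, mul_castX_right]
      rw [E.eps_mul p q r p' q' r' h hp hq hr]
      simp only [smul_add, smul_comm δ.c p.negOnePow]
      abel)
    (by
      subst hp
      simp only [thickeningMul, thickeningEps, LinearMap.mk₂_apply, LinearMap.coe_mk,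
        AddHom.coe_mk, Submodule.coe_add, Submodule.coe_smul_of_tower, Prod.snd_add, Prod.smul_snd,
        map_add, map_smul, LinearMap.add_apply, LinearMap.smul_apply, LinearMap.map_smul_of_tower,
        mul_castX_left, mul_castX_right, map_neg, LinearMap.neg_apply]
      rw [E.eps_mul (p' + 1 - 1) q (r - 1) (p' - 1) q' (r' - 1) _ (by omega) hq (by omega),
        E.eps_mul (p' + 1) (q - 1) (r - 1) p' (q' - 1) (r' - 1) _ rfl (by omega) (by omega)]
      obtain hs | hs := Int.units_eq_one_or p'.negOnePow <;>
        simp [Int.negOnePow_succ, hs] <;> abel)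

end ScaledDerivation

end EpsCdga

/-! ### Polynomial path objects -/

namespace EpsCdga

variable {k : Type u} [CommRing k]

section baseChange

open TensorProduct

variable (R : Type u) [CommRing R] [Algebra k R] (E : EpsCdga k)

/-- The product of `R ⊗ E`. -/
def baseChangeMul (p q r : ℤ) (h : p + q = r) :
    R ⊗[k] E.X p →ₗ[k] R ⊗[k] E.X q →ₗ[k] R ⊗[k] E.X r :=
  TensorProduct.map₂ (LinearMap.mul k R) (E.mul p q r h)

@[simp]
lemma baseChangeMul_tmul (p q r : ℤ) (h : p + q = r) (s t : R) (a : E.X p) (b : E.X q) :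
    baseChangeMul R E p q r h (s ⊗ₜ a) (t ⊗ₜ b) = (s * t) ⊗ₜ E.mul p q r h a b := rfl

/-- The `ε`-cdga `R ⊗ E`, for an algebra `R`. -/
def baseChangeData : EpsCdgaData k where
  X n := R ⊗[k] E.X n
  d p q _ := (E.d p q).lTensor R
  d_d p q r _ _ x := by
    induction x with
    | zero => simp
    | add x y hx hy => rw [map_add, map_add, hx, hy, add_zero]
    | tmul s a => simp
  nonpos n hn x := by
    induction x with
    | zero => rfl
    | add x y hx hy => rw [hx, hy, add_zero]
    | tmul s a => rw [E.eq_zero_of_pos hn a, tmul_zero]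
  mul := baseChangeMul R E
  one := 1 ⊗ₜ E.one
  one_mul p x := by
    induction x with
    | zero => simp
    | add x y hx hy => rw [map_add, hx, hy]
    | tmul s a => simp [E.alg.one_mul]
  mul_assoc p q r pq qr s h₁ h₂ h₃ x y z := by
    induction x with
    | zero => simp
    | add x y hx hy => simp only [map_add, LinearMap.add_apply, hx, hy]
    | tmul s a =>
      induction y with
      | zero => simp
      | add x y hx hy => simp only [map_add, LinearMap.add_apply, hx, hy]
      | tmul t b =>
        induction z with
        | zero => simp
        | add x y hx hy => simp only [map_add, hx, hy]
        | tmul u c => simp [mul_assoc, E.alg.mul_assoc p q r pq qr _ h₁ h₂ h₃]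
  mul_comm p q r h x y := by
    induction x with
    | zero => simp
    | add x y hx hy => simp only [map_add, LinearMap.add_apply, hx, hy, smul_add]
    | tmul s a =>
      induction y with
      | zero => simp
      | add x y hx hy => simp only [map_add, LinearMap.add_apply, hx, hy, smul_add]
      | tmul t b =>
        rw [baseChangeMul_tmul, baseChangeMul_tmul, E.alg.mul_comm, mul_comm, ← sign_smul (k := k),
          ← sign_smul (k := k), tmul_smul]
  d_mul p q r p' q' r' h hp hq hr x y := by
    induction x with
    | zero => simp
    | add x y hx hy => simp only [map_add, LinearMap.add_apply, hx, hy, smul_add]; abel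
    | tmul s a =>
      induction y with
      | zero => simp
      | add x y hx hy => simp only [map_add, hx, hy, smul_add]; abel
      | tmul t b =>
        simp only [baseChangeMul_tmul, LinearMap.lTensor_tmul]
        rw [E.d_mul p q r p' q' r' h hp hq hr, ← sign_smul (k := k), ← sign_smul (k := k),
          tmul_add, tmul_smul]
  eps p q h := (E.eps p q h).lTensor R
  eps_eps p q r _ _ x := by
    induction x with
    | zero => simp
    | add x y hx hy => rw [map_add, map_add, hx, hy, add_zero]
    | tmul s a => simp [E.eps_eps]
  d_eps p q r h h' x := by
    induction x with
    | zero => simp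
    | add x y hx hy =>
      simp only [map_add]
      rw [add_add_add_comm, hx, hy, add_zero]
    | tmul s a =>
      simp only [LinearMap.lTensor_tmul]
      rw [← tmul_add, E.d_eps' p q r h h', add_neg_cancel, tmul_zero]
  eps_mul p q r p' q' r' h hp hq hr x y := by
    induction x with
    | zero => simp
    | add x y hx hy => simp only [map_add, LinearMap.add_apply, hx, hy, smul_add]; abel
    | tmul s a =>
      induction y with
      | zero => simp
      | add x y hx hy => simp only [map_add, hx, hy, smul_add]; abel
      | tmul t b =>
        simp only [baseChangeMul_tmul, LinearMap.lTensor_tmul]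
        rw [E.eps_mul p q r p' q' r' h hp hq hr, ← sign_smul (k := k), ← sign_smul (k := k),
          tmul_add, tmul_smul]

end baseChange

/-- The `ε`-cdga of polynomials in a variable `t` with coefficients in `E`. -/
def poly (E : EpsCdga k) : EpsCdga k := (baseChangeData (Polynomial k) E).toEpsCdga

section poly

open TensorProduct

variable (E : EpsCdga k)

/-- Applying a linear form on polynomials to the coefficients. -/
def polyForm (φ : Polynomial k →ₗ[k] k) (n : ℤ) : Polynomial k ⊗[k] E.X n →ₗ[k] E.X n :=
  TensorProduct.lift (LinearMap.lsmul k (E.X n) ∘ₗ φ)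

@[simp]
lemma polyForm_tmul (φ : Polynomial k →ₗ[k] k) (n : ℤ) (s : Polynomial k) (a : E.X n) :
    polyForm E φ n (s ⊗ₜ a) = φ s • a := rfl

/-- Any linear form on polynomials will do, multiplicative or not: evaluation and integration are
both instances. -/
lemma polyForm_d (φ : Polynomial k →ₗ[k] k) (p q : ℤ) (h : p + 1 = q) (x : E.poly.X p) :
    polyForm E φ q (E.poly.d p q x) = E.d p q (polyForm E φ p x) := by
  have hx : E.poly.d p q x = (E.d p q).lTensor (Polynomial k) x :=
    (baseChangeData (Polynomial k) E).toEpsCdga_d h x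
  rw [hx]
  change Polynomial k ⊗[k] E.X p at x
  clear hx
  induction x with
  | zero => simp
  | add x y hx hy => simp only [map_add, hx, hy]
  | tmul s a => simp

lemma polyForm_mul (s : k) (p q r : ℤ) (h : p + q = r) (x : Polynomial k ⊗[k] E.X p)
    (y : Polynomial k ⊗[k] E.X q) :
    polyForm E (Polynomial.leval s) r (baseChangeMul (Polynomial k) E p q r h x y) =
      E.mul p q r h (polyForm E (Polynomial.leval s) p x)
        (polyForm E (Polynomial.leval s) q y) := by
  induction x with
  | zero => simp
  | add x y hx hy => simp only [map_add, LinearMap.add_apply, hx, hy]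
  | tmul s' a =>
    induction y with
    | zero => simp
    | add x y hx hy => simp only [map_add, hx, hy]
    | tmul t b => simp [smul_smul, mul_comm]

lemma polyForm_eps (φ : Polynomial k →ₗ[k] k) (p q : ℤ) (h : q + 1 = p)
    (x : Polynomial k ⊗[k] E.X p) :
    polyForm E φ q ((E.eps p q h).lTensor (Polynomial k) x) =
      E.eps p q h (polyForm E φ p x) := by
  induction x with
  | zero => simp
  | add x y hx hy => simp only [map_add, hx, hy]
  | tmul s a => simp

lemma rTensor_lTensor {M N M' N' : Type*} [AddCommGroup M] [AddCommGroup N] [AddCommGroup M']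
    [AddCommGroup N'] [Module k M] [Module k N] [Module k M'] [Module k N'] (f : M →ₗ[k] M')
    (g : N →ₗ[k] N') (x : M ⊗[k] N) :
    f.rTensor N' (g.lTensor M x) = g.lTensor M' (f.rTensor N x) :=
  LinearMap.congr_fun
    ((LinearMap.rTensor_comp_lTensor _ f g).trans (LinearMap.lTensor_comp_rTensor _ f g).symm) x

/-- Evaluation of polynomials at a scalar. -/
def polyEval (s : k) : E.poly ⟶ E :=
  (baseChangeData (Polynomial k) E).homOut (fun n => polyForm E (Polynomial.leval s) n)
    (fun p q h x => by
      rw [← (baseChangeData (Polynomial k) E).toEpsCdga_d h]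
      exact polyForm_d E _ p q h x)
    (by
      change polyForm E _ 0 (1 ⊗ₜ E.one) = E.one
      simp)
    (fun p q r h x y => polyForm_mul E s p q r h x y)
    (fun p q h x => polyForm_eps E _ p q h x)

lemma app_polyEval (s : k) (n : ℤ) (x : E.poly.X n) :
    app (E.polyEval s) n x = polyForm E (Polynomial.leval s) n x := rfl

/-- Constant polynomials. -/
def polyC : E ⟶ E.poly :=
  (baseChangeData (Polynomial k) E).homIn (fun n => TensorProduct.mk k (Polynomial k) (E.X n) 1)
    (fun _ _ _ _ => rfl) rfl
    (fun p q r h x y => by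
      change 1 ⊗ₜ _ = (1 * 1 : Polynomial k) ⊗ₜ _
      rw [mul_one])
    (fun _ _ _ _ => rfl)

/-- The derivation `d/dt` of polynomials. -/
def polyDerivation : ScaledDerivation E.poly where
  D n := (Polynomial.derivative (R := k)).rTensor (E.X n)
  c := 0
  map_mul p q r h x y := by
    change (Polynomial.derivative (R := k)).rTensor (E.X r)
        (baseChangeMul (Polynomial k) E p q r h x y) =
      baseChangeMul (Polynomial k) E p q r h ((Polynomial.derivative (R := k)).rTensor (E.X p) x) y
        + baseChangeMul (Polynomial k) E p q r h x
          ((Polynomial.derivative (R := k)).rTensor (E.X q) y)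
    change Polynomial k ⊗[k] E.X p at x
    change Polynomial k ⊗[k] E.X q at y
    induction x with
    | zero => simp
    | add x y hx hy => simp only [map_add, LinearMap.add_apply, hx, hy]; abel
    | tmul s a =>
      induction y with
      | zero => simp
      | add x y hx hy => simp only [map_add, hx, hy]; abel
      | tmul t b => simp [TensorProduct.add_tmul]
  map_d p q x := by
    by_cases h : p + 1 = q
    · have hx (x : E.poly.X p) : E.poly.d p q x = (E.d p q).lTensor (Polynomial k) x :=
        (baseChangeData (Polynomial k) E).toEpsCdga_d h x
      rw [hx, hx]
      exact rTensor_lTensor _ _ _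
    · have hx (x : E.poly.X p) : E.poly.d p q x = 0 := by
        rw [← cx_d_apply, E.poly.alg.cx.shape _ _ h]
        rfl
      exact (congrArg _ (hx x)).trans ((map_zero _).trans (hx _).symm)
  map_eps p q h x := rTensor_lTensor _ _ _
  smul_eq_zero n a := zero_smul _ _

/-- The path object `E[t, dt]`, truncated in degrees `≤ 0`. -/
def path : EpsCdga k := E.polyDerivation.thicken.toEpsCdga

/-- The evaluation of a path at a scalar. -/
def pathEval (s : k) : E.path ⟶ E :=
  E.polyDerivation.thicken.homOut
    (fun n => app (E.polyEval s) n ∘ₗ LinearMap.fst k _ _ ∘ₗ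
      (E.polyDerivation.thickening n).subtype)
    (fun p q h x => app_d (E.polyEval s) p q x.1.1) (app_one (E.polyEval s))
    (fun p q r h a b => app_mul (E.polyEval s) p q r h a.1.1 b.1.1)
    (fun p q h a => by
      refine Eq.trans ?_ (app_eps (E.polyEval s) p q h a.1.1)
      change app (E.polyEval s) q (_ + (0 : k) • _) = _
      rw [zero_smul, add_zero])

/-- Constant paths. -/
def pathConst : E ⟶ E.path :=
  E.polyDerivation.thicken.homIn
    (fun n => (LinearMap.inl k _ _ ∘ₗ app E.polyC n).codRestrict (E.polyDerivation.thickening n)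
      fun x => ⟨fun _ => by
        rw [LinearMap.comp_apply, LinearMap.inl_apply, map_zero]
        change 0 = (Polynomial.derivative (R := k)).rTensor (E.X n) (1 ⊗ₜ x)
        simp, fun _ => rfl⟩)
    (fun p q h x => by
      refine ScaledDerivation.thickening_ext (app_d E.polyC p q x) ?_
      change 0 = E.poly.castX _ ((Polynomial.derivative (R := k)).rTensor (E.X p) (1 ⊗ₜ x)) -
        E.poly.d (p - 1) (q - 1) 0
      rw [map_zero, LinearMap.rTensor_tmul, Polynomial.derivative_one, zero_tmul, sub_zero]
      exact (map_zero _).symm)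
    rfl
    (fun p q r h x y => ScaledDerivation.thickening_ext (app_mul E.polyC p q r h x y) (by
      change 0 = E.poly.mul _ _ _ _ 0 _ + _ • E.poly.mul _ _ _ _ _ 0
      simp))
    (fun p q h x => ScaledDerivation.thickening_ext
      (by
        refine (app_eps E.polyC p q h x).trans ?_
        change _ = _ + (0 : k) • _
        rw [zero_smul, add_zero]
        rfl)
      (by
        change 0 = -E.poly.eps _ _ _ 0
        simp))

/-- The path `t • x`, for `x` of negative degree. -/
def pathLine {n : ℤ} (hn : n < 0) (x : E.X n) : E.path.X n :=
  (⟨⟨(Polynomial.X : Polynomial k) ⊗ₜ[k] x, 0⟩, fun h => by omega, fun _ => rfl⟩ :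
    E.polyDerivation.thickening n)

lemma app_pathEval_pathLine (s : k) {n : ℤ} (hn : n < 0) (x : E.X n) :
    app (E.pathEval s) n (E.pathLine hn x) = s • x := by
  change polyForm E (Polynomial.leval s) n ((Polynomial.X : Polynomial k) ⊗ₜ[k] x) = s • x
  simp

lemma app_pathEval_pathConst (s : k) (n : ℤ) (x : E.X n) :
    app (E.pathEval s) n (app E.pathConst n x) = x := by
  change polyForm E (Polynomial.leval s) n ((1 : Polynomial k) ⊗ₜ[k] x) = x
  simp

@[simp]
lemma pathConst_pathEval (s : k) : E.pathConst ≫ E.pathEval s = 𝟙 E :=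
  hom_ext fun n x => app_pathEval_pathConst E s n x

/-- Since `c = 0` for the path object, its `ε` is, up to sign, the `ε` of the coefficients.
Homotopies between objects with `ε = 0` therefore stay among such objects. -/
lemma path_epsZero (hE : E.EpsZero) : E.path.EpsZero := by
  have h₀ : E.poly.EpsZero := by
    intro p q h x
    change (E.eps p q h).lTensor (Polynomial k) x = 0
    rw [show E.eps p q h = 0 from LinearMap.ext (hE p q h), LinearMap.lTensor_zero]
    rfl
  intro p q h x
  refine ScaledDerivation.thickening_ext ?_ ?_
  · change E.poly.eps p q h _ + (0 : k) • _ = 0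
    rw [h₀, zero_smul, add_zero]
  · change -E.poly.eps _ _ _ _ = 0
    rw [h₀, neg_zero]

variable (k) in
/-- The integral of polynomials over `[0, 1]`. -/
def polyIntegral [Algebra ℚ k] : Polynomial k →ₗ[k] k :=
  Polynomial.lsum fun m => algebraMap ℚ k ((m + 1 : ℚ)⁻¹) • LinearMap.id

/-- It suffices to treat monomials, where the factor `n + 1` produced by the derivative cancels its
inverse in the integral. Rational coefficients enter the proof through this integral. -/
lemma polyIntegral_derivative [Algebra ℚ k] (s : Polynomial k) :
    polyIntegral k (Polynomial.derivative s) = s.eval 1 - s.eval 0 := by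
  induction s using Polynomial.induction_on' with
  | add p q hp hq =>
    simp only [map_add, hp, hq, Polynomial.eval_add]
    abel
  | monomial n a =>
    rw [Polynomial.derivative_monomial, polyIntegral, Polynomial.lsum_apply,
      Polynomial.sum_monomial_index _ _ (by simp)]
    cases n with
    | zero => simp
    | succ n =>
      have : algebraMap ℚ k ((n + 1 : ℚ)⁻¹) * (n + 1 : k) = 1 := by
        have h : ((n : ℚ) + 1) ≠ 0 := by positivity
        rw [show ((n : k) + 1) = algebraMap ℚ k (n + 1) by simp, ← map_mul, inv_mul_cancel₀ h,
          map_one]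
      simp only [Nat.add_sub_cancel, LinearMap.smul_apply, LinearMap.id_apply, smul_eq_mul,
        Polynomial.eval_monomial, one_pow, mul_one, Nat.cast_add, Nat.cast_one]
      rw [mul_left_comm, this]
      simp

lemma polyForm_polyIntegral [Algebra ℚ k] (n : ℤ) (x : E.poly.X n) :
    polyForm E (polyIntegral k) n (E.polyDerivation.D n x) =
      app (E.polyEval 1) n x - app (E.polyEval 0) n x := by
  rw [app_polyEval, app_polyEval]
  change polyForm E _ n ((Polynomial.derivative (R := k)).rTensor (E.X n) x) = _
  change Polynomial k ⊗[k] E.X n at x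
  induction x with
  | zero => simp
  | add x y hx hy =>
    simp only [map_add, hx, hy]
    abel
  | tmul s a => simp [polyIntegral_derivative, sub_smul]

/-- The two ends of a closed path are cohomologous. -/
lemma exists_d_eq_pathEval_sub [Algebra ℚ k] (p q r : ℤ) (h : p + 1 = q) (h' : q + 1 = r)
    (z : E.path.X q) (hz : E.path.d q r z = 0) :
    ∃ w : E.X p, E.d p q w = app (E.pathEval 1) q z - app (E.pathEval 0) q z := by
  obtain rfl : p = q - 1 := by omega
  replace hz : E.polyDerivation.thickeningD q r h' z = 0 :=
    (E.polyDerivation.thicken.toEpsCdga_d h' z).symm.trans hz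
  obtain ⟨⟨x, y⟩, hxy⟩ := z
  have hy : E.poly.castX (by omega) (E.polyDerivation.D q x) - E.poly.d (q - 1) (r - 1) y = 0 :=
    congrArg (fun z => z.1.2) hz
  -- The `η`-component of closedness of `x + ηy` says `dx/dt = dy`, up to identification of degrees.
  have hy' : E.polyDerivation.D q x = E.poly.d (q - 1) q y := by
    have := congrArg (E.poly.castX (show r - 1 = q by omega)) hy
    simpa [sub_eq_zero] using this
  -- Stokes: the integral of `y` is the primitive, because integration commutes with `d` and the
  -- integral of `dx/dt` is `x(1) - x(0)`.
  refine ⟨polyForm E (polyIntegral k) (q - 1) y, ?_⟩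
  rw [← polyForm_d E _ _ _ h, ← hy']
  exact polyForm_polyIntegral E q x

end poly

end EpsCdga

/-! ### Extensions of a cdga by generators and formal primitives -/

namespace EpsCdga

variable {k : Type u} [CommRing k]

/-- The values on generators of a morphism out of an extension. -/
def genMap {A E : EpsCdga k} {S : ℤ → Type u} (φ : A.alg ⟶ E.alg)
    (s : ∀ n : ℤ, S n → E.X n) (n : ℤ) : A.X n ⊕ S n → E.X n :=
  Sum.elim (fun a => φ.toHom.f n a) (s n)

/-- By induction on expressions, without any appeal to the congruence. It serves to transport the
condition `good` along a commutative square. -/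
lemma Term.app_eval {E F : EpsCdga k} {G B : ℤ → Type u} (f : E ⟶ F)
    {g : ∀ n : ℤ, G n → E.X n} {c : ∀ p q : ℤ, p + 1 = q → Term k G B q → E.X q → B p → E.X p}
    {g' : ∀ n : ℤ, G n → F.X n} {c' : ∀ p q : ℤ, p + 1 = q → Term k G B q → F.X q → B p → F.X p}
    (hg : ∀ (n : ℤ) (x : G n), app f n (g n x) = g' n x)
    (hc : ∀ (p q : ℤ) (h : p + 1 = q) (z : Term k G B q) (a : E.X q) (b : B p),
      app f p (c p q h z a b) = c' p q h z (app f q a) b) {n : ℤ} (x : Term k G B n) :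
    app f n (Term.eval g c x) = Term.eval g' c' x := by
  induction x with
  | gen n x => exact hg n x
  | cell p q h z b hz => simp only [Term.eval, hc, hz]
  | _ => simp_all only [Term.eval, map_zero, map_add, map_smul, app_one, app_mul, app_d, app_eps]

/-- The data presenting an extension of a cdga `A` by generators `S` and formal primitives. -/
structure ExtData (k : Type u) [CommRing k] where
  /-- the `ε`-cdga that is extended -/
  A : EpsCdga k
  /-- the new generators -/
  S : ℤ → Type u
  /-- the labels of the formal primitives -/
  B : ℤ → Type u
  /-- the condition for `cell z b` to be a primitive of `z` -/
  good : ∀ p q : ℤ, p + 1 = q → Term k (fun n => A.X n ⊕ S n) B q → B p → Prop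
  /-- whether the operator `ε` of `A` is preserved -/
  keepEps : Prop
  /-- whether `ε` vanishes -/
  noEps : Prop

namespace ExtData

variable (X : ExtData k)

/-- The generator given by an element of `A`. -/
def inl (n : ℤ) (a : X.A.X n) : Term k (fun n => X.A.X n ⊕ X.S n) X.B n := .gen n (.inl a)

/-- The relations of `A`. -/
inductive Rel : ∀ n : ℤ, Term k (fun n => X.A.X n ⊕ X.S n) X.B n →
    Term k (fun n => X.A.X n ⊕ X.S n) X.B n → Prop
  | add (n : ℤ) (x y : X.A.X n) : Rel n (X.inl n (x + y)) (.add (X.inl n x) (X.inl n y))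
  | smul (n : ℤ) (c : k) (x : X.A.X n) : Rel n (X.inl n (c • x)) (.smul c (X.inl n x))
  | one : Rel 0 (X.inl 0 X.A.one) .one
  | mul (p q r : ℤ) (h) (x : X.A.X p) (y : X.A.X q) :
      Rel r (X.inl r (X.A.mul p q r h x y)) (.mul p q r h (X.inl p x) (X.inl q y))
  | d (p q : ℤ) (h) (x : X.A.X p) : Rel q (X.inl q (X.A.d p q x)) (.d p q h (X.inl p x))
  | eps (p q : ℤ) (h) (x : X.A.X p) : X.keepEps →
      Rel q (X.inl q (X.A.eps p q h x)) (.eps p q h (X.inl p x))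

/-- The presentation of the extension. -/
def pres : Presentation k where
  G n := X.A.X n ⊕ X.S n
  B := X.B
  good := X.good
  R := X.Rel
  noEps := X.noEps

/-- The extension. -/
abbrev obj : EpsCdga k := X.pres.obj

lemma epsZero (hX : X.noEps) : EpsZero X.obj := Presentation.obj_eps_eq_zero (P := X.pres) hX

/-- The class of an expression in the extension. -/
abbrev el {n : ℤ} (x : Term k (fun n => X.A.X n ⊕ X.S n) X.B n) : X.obj.X n :=
  Presentation.el (P := X.pres) x

variable {X} in
lemma el_eq_of_rel {n : ℤ} {x y : Term k (fun n => X.A.X n ⊕ X.S n) X.B n} (h : X.Rel n x y) :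
    X.el x = X.el y :=
  Presentation.el_eq (P := X.pres) (.rel _ _ _ h)

/-- The generators of the extension. -/
def gen {n : ℤ} (s : X.S n) : X.obj.X n := X.el (.gen n (.inr s))

/-- The inclusion of `A` into the extension. -/
def algι : X.A.alg ⟶ X.obj.alg where
  toHom := CochainComplex.homMk
    (fun n =>
      { toFun x := X.el (X.inl n x)
        map_add' x y := el_eq_of_rel (.add n x y)
        map_smul' c x := el_eq_of_rel (.smul n c x) })
    (fun p q h x => (el_eq_of_rel (.d p q h x)).trans (Presentation.el_d p q h _))
  map_one := el_eq_of_rel .one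
  map_mul p q r h x y := el_eq_of_rel (.mul p q r h x y)

/-- The inclusion of `A` into the extension, when `ε` is preserved. -/
def ι (hX : X.keepEps) : X.A ⟶ X.obj where
  algHom := X.algι
  map_eps p q h x := el_eq_of_rel (.eps p q h x hX)

section lift

variable {X} {E : EpsCdga k}

variable (φ : X.A.alg ⟶ E.alg) (s : ∀ n : ℤ, X.S n → E.X n)
  (hφ : X.keepEps → ∀ (p q : ℤ) (h : q + 1 = p) (a : X.A.X p),
    φ.toHom.f q (X.A.eps p q h a) = E.eps p q h (φ.toHom.f p a))
  (c : ∀ p q : ℤ, p + 1 = q → X.pres.Tm q → E.X q → X.B p → E.X p)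
  (hE : X.noEps → EpsZero E)
  (hc : ∀ (p q : ℤ) (h : p + 1 = q) (z z' : X.pres.Tm q) (a : E.X q) (b : X.B p),
    X.el z = X.el z' → c p q h z a b = c p q h z' a b)
  (hd : ∀ (p q r : ℤ) (h : p + 1 = q) (_ : q + 1 = r) (z : X.pres.Tm q) (b : X.B p),
    X.good p q h z b → X.obj.d q r (X.el z) = 0 → E.d q r (Term.eval (genMap φ s) c z) = 0 →
      E.d p q (c p q h z (Term.eval (genMap φ s) c z) b) = Term.eval (genMap φ s) c z)

/-- The universal property of an extension. -/
def lift : X.obj ⟶ E :=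
  Presentation.lift (genMap φ s) c hE
    (by
      intro n x y h
      induction h with
      | add n x y => exact map_add (φ.toHom.f n).hom _ _
      | smul n c x => exact map_smul (φ.toHom.f n).hom _ _
      | one => exact φ.map_one
      | mul p q r h x y => exact φ.map_mul p q r h x y
      | d p q h x => exact CochainComplex.map_d_apply φ.toHom x
      | eps p q h x hX => exact hφ hX p q h x)
    hc hd

lemma algι_lift : X.algι ≫ (lift φ s hφ c hE hc hd).algHom = φ :=
  Cdga.Hom.ext (CochainComplex.hom_ext_apply fun _ _ => rfl)

lemma hom_ext {f g : X.obj ⟶ E} (hA : X.algι ≫ f.algHom = X.algι ≫ g.algHom)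
    (hS : ∀ (n : ℤ) (x : X.S n), app f n (X.gen x) = app g n (X.gen x))
    (hB : ∀ (p q : ℤ) (h : p + 1 = q) (z : X.pres.Tm q) (b : X.B p),
      app f q (X.el z) = app g q (X.el z) →
        app f p (X.el (.cell p q h z b)) = app g p (X.el (.cell p q h z b))) : f = g := by
  refine Presentation.hom_ext ?_ hB
  rintro n (x | x)
  · exact congrArg (fun φ : X.A.alg ⟶ E.alg => φ.toHom.f n x) hA
  · exact hS n x

end lift

end ExtData

/-! ### Adjoining contractible generators -/

section disks

variable (noEps : Prop) (A B : EpsCdga k)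

/-- The extension of `A` by a generator for each element of `B` of negative degree. -/
def diskExt : ExtData k where
  A := A
  S n := {_b : B.X n // n < 0}
  B _ := PEmpty
  good _ _ _ _ _ := False
  keepEps := True
  noEps := noEps

/-- Morphisms out of `diskExt`. -/
def diskLift {E : EpsCdga k} (hE : noEps → EpsZero E) (φ : A ⟶ E)
    (s : ∀ n : ℤ, n < 0 → B.X n → E.X n) : (diskExt noEps A B).obj ⟶ E :=
  ExtData.lift (X := diskExt noEps A B) φ.algHom (fun n b => s n b.2 b.1)
    (fun _ => φ.map_eps) (fun _ _ _ _ _ b => b.elim) hE (fun _ _ _ _ _ _ b => b.elim)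
    (fun _ _ _ _ _ _ b => b.elim)

/-- The inclusion of `A` into `diskExt`. -/
def diskι : A ⟶ (diskExt noEps A B).obj := (diskExt noEps A B).ι trivial

/-- The generators of `diskExt`. -/
def diskGen {n : ℤ} (hn : n < 0) (b : B.X n) : (diskExt noEps A B).obj.X n :=
  (diskExt noEps A B).gen ⟨b, hn⟩

variable {noEps A B}

@[simp]
lemma diskι_diskLift_assoc {E F : EpsCdga k} (hE : noEps → EpsZero E) (φ : A ⟶ E)
    (s : ∀ n : ℤ, n < 0 → B.X n → E.X n) (g : E ⟶ F) :
    diskι noEps A B ≫ diskLift noEps A B hE φ s ≫ g = φ ≫ g := rfl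

@[simp]
lemma app_diskLift_diskGen {E : EpsCdga k} (hE : noEps → EpsZero E) (φ : A ⟶ E)
    (s : ∀ n : ℤ, n < 0 → B.X n → E.X n) {n : ℤ} (hn : n < 0) (b : B.X n) :
    app (diskLift noEps A B hE φ s) n (diskGen noEps A B hn b) = s n hn b := rfl

lemma disk_hom_ext {E : EpsCdga k} {g g' : (diskExt noEps A B).obj ⟶ E}
    (h : diskι noEps A B ≫ g = diskι noEps A B ≫ g')
    (h' : ∀ (n : ℤ) (hn : n < 0) (b : B.X n),
      app g n (diskGen noEps A B hn b) = app g' n (diskGen noEps A B hn b)) : g = g' :=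
  ExtData.hom_ext (congrArg Hom.algHom h) (fun n b => h' n b.2 b.1)
    (fun _ _ _ _ b => b.elim)

variable (noEps) in
/-- The projection of `diskExt` to `B`. -/
def diskπ (f : A ⟶ B) (hB : noEps → EpsZero B) : (diskExt noEps A B).obj ⟶ B :=
  diskLift noEps A B hB f fun _ _ b => b

lemma diskπ_surjective (f : A ⟶ B) (hB : noEps → EpsZero B) : surjNeg k (diskπ noEps f hB) :=
  fun _ hn b => ⟨diskGen noEps A B hn b, rfl⟩

-- The new generators satisfy no relation, so preimages under `g` may be chosen for each of them
-- independently. All of them have negative degree, where `g` is surjective.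
variable (noEps A B) in
lemma diskι_hasLift {Y Z : EpsCdga k} (hY : noEps → EpsZero Y) {g : Y ⟶ Z} (hg : surjNeg k g)
    {φ : A ⟶ Y} {ψ : (diskExt noEps A B).obj ⟶ Z} (h : φ ≫ g = diskι noEps A B ≫ ψ) :
    ∃ l : (diskExt noEps A B).obj ⟶ Y, diskι noEps A B ≫ l = φ ∧ l ≫ g = ψ := by
  choose s hs using fun (n : ℤ) (hn : n < 0) (b : B.X n) =>
    hg n hn (app ψ n (diskGen noEps A B hn b))
  refine ⟨diskLift noEps A B hY φ s, rfl, disk_hom_ext ?_ ?_⟩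
  · rw [diskι_diskLift_assoc, h]
  · intro n hn b
    rw [app_comp, app_diskLift_diskGen]
    exact hs n hn b

/-- A morphism with a retraction that is homotopic to the identity through a path object is a
quasi-isomorphism. -/
lemma quasiIso_of_path [Algebra ℚ k] {A E : EpsCdga k} (i : A ⟶ E) (r : E ⟶ A) (h : i ≫ r = 𝟙 A)
    (H : E ⟶ E.path) (h₀ : H ≫ E.pathEval 0 = r ≫ i) (h₁ : H ≫ E.pathEval 1 = 𝟙 E) :
    quasiIso k i := by
  have hr (n : ℤ) (a : A.X n) : app r n (app i n a) = a := by
    rw [← app_comp, h, app_id]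
  have hi (p q r' : ℤ) (hp : p + 1 = q) (hq : q + 1 = r') (z : E.X q) (hz : E.d q r' z = 0) :
      ∃ w : E.X p, E.d p q w = z - app i q (app r q z) := by
    obtain ⟨w, hw⟩ := E.exists_d_eq_pathEval_sub p q r' hp hq (app H q z)
      (by rw [← app_d, hz, map_zero])
    -- The closed path `H z` runs from `i (r z)` to `z`.
    rw [← app_comp, ← app_comp, h₀, h₁] at hw
    exact ⟨w, hw⟩
  refine (CochainComplex.quasiIso_iff_elements i.algHom.toHom).2 fun p q r' hp hq => ⟨?_, ?_⟩
  · rintro z - ⟨y, hy⟩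
    refine ⟨app r p y, ?_⟩
    change A.d p q (app r p y) = z
    rw [← app_d, show E.d p q y = app i q z from hy, hr]
  · intro z hz
    obtain ⟨w, hw⟩ := hi p q r' hp hq z hz
    refine ⟨app r q z, -w, ?_, ?_⟩
    · change A.d q r' (app r q z) = 0
      rw [← app_d, show E.d q r' z = 0 from hz, map_zero]
    · change app i q (app r q z) = z + E.d p q (-w)
      rw [map_neg, hw]
      abel

-- The retraction kills the new generators. The homotopy is constant on `A` and multiplies each
-- generator by `t`, so that it is `i ∘ r` at `0` and the identity at `1`. The path `t x` survives
-- the truncation because `x` has negative degree.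
variable (noEps A B) in
lemma diskι_quasiIso [Algebra ℚ k] (hA : noEps → EpsZero A) : quasiIso k (diskι noEps A B) := by
  have hE : noEps → EpsZero (diskExt noEps A B).obj := (diskExt noEps A B).epsZero
  refine quasiIso_of_path _ (diskLift noEps A B hA (𝟙 A) fun _ _ _ => 0) rfl
    (diskLift noEps A B (fun h => path_epsZero _ (hE h)) (diskι noEps A B ≫ pathConst _)
      fun n hn b => pathLine _ hn (diskGen noEps A B hn b)) ?_ ?_
  · apply disk_hom_ext
    · simp
    · intro n hn b
      simp only [app_comp, app_diskLift_diskGen, app_pathEval_pathLine, zero_smul, map_zero]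
  · apply disk_hom_ext
    · simp
    · intro n hn b
      simp only [app_comp, app_diskLift_diskGen, app_pathEval_pathLine, one_smul, app_id]

variable (noEps) in
/-- The functoriality of `diskExt`. -/
def diskMap {A' B' : EpsCdga k} (u : A ⟶ A') (v : B ⟶ B') :
    (diskExt noEps A B).obj ⟶ (diskExt noEps A' B').obj :=
  diskLift noEps A B (diskExt noEps A' B').epsZero (u ≫ diskι noEps A' B')
    fun _ hn b => diskGen noEps A' B' hn (app v _ b)

lemma diskMap_id {u : A ⟶ A} {v : B ⟶ B} (hu : u = 𝟙 A) (hv : v = 𝟙 B) :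
    diskMap noEps u v = 𝟙 _ := by
  subst hu hv
  exact disk_hom_ext rfl fun _ _ _ => rfl

lemma diskMap_comp {A' B' A'' B'' : EpsCdga k} {u : A ⟶ A'} {v : B ⟶ B'} {u' : A' ⟶ A''}
    {v' : B' ⟶ B''} {u'' : A ⟶ A''} {v'' : B ⟶ B''} (hu : u'' = u ≫ u') (hv : v'' = v ≫ v') :
    diskMap noEps u'' v'' = diskMap noEps u v ≫ diskMap noEps u' v' := by
  subst hu hv
  exact disk_hom_ext rfl fun _ _ _ => rfl

lemma diskMap_diskπ {A' B' : EpsCdga k} {f : A ⟶ B} {f' : A' ⟶ B'} (hB : noEps → EpsZero B)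
    (hB' : noEps → EpsZero B') (u : A ⟶ A') (v : B ⟶ B') (w : u ≫ f' = f ≫ v) :
    diskMap noEps u v ≫ diskπ noEps f' hB' = diskπ noEps f hB ≫ v :=
  disk_hom_ext w fun _ _ _ => rfl

end disks

/-! ### Adjoining primitives of all cocycles -/

section cells

variable (noEps : Prop) {A B : EpsCdga k} (f : A ⟶ B)

/-- The extension of `A` by formal primitives of all cocycles that become boundaries in `B`. -/
def cellExt : ExtData k where
  A := A
  S _ := PEmpty
  B n := B.X n
  good p q _ z b :=
    Term.eval (genMap f.algHom fun _ x => x.elim) (fun _ _ _ _ _ b => b) z = B.d p q b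
  keepEps := True
  noEps := noEps

/-- The inclusion of `A` into `cellExt`. -/
def cellι : A ⟶ (cellExt noEps f).obj := (cellExt noEps f).ι trivial

/-- The projection of `cellExt` to `B`. -/
def cellπ (hB : noEps → EpsZero B) : (cellExt noEps f).obj ⟶ B :=
  ExtData.lift (X := cellExt noEps f) f.algHom (fun _ x => x.elim)
    (fun _ => f.map_eps) (fun _ _ _ _ _ b => b) hB (fun _ _ _ _ _ _ _ _ => rfl)
    (fun _ _ _ _ _ _ _ hz _ _ => hz.symm)

/-- The formal primitives in `cellExt`. -/
def cellOp (p q : ℤ) (h : p + 1 = q) (z : (cellExt noEps f).obj.X q) (b : B.X p) :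
    (cellExt noEps f).obj.X p :=
  (cellExt noEps f).pres.cell p q h z b

variable {noEps f}

lemma app_cellπ_cellOp (hB : noEps → EpsZero B) (p q : ℤ) (h : p + 1 = q)
    (z : (cellExt noEps f).obj.X q) (b : B.X p) :
    app (cellπ noEps f hB) p (cellOp noEps f p q h z b) = b := by
  obtain ⟨z, rfl⟩ := Presentation.el_surjective z
  rfl

lemma d_cellOp {p q r : ℤ} (h : p + 1 = q) (h' : q + 1 = r) {z : (cellExt noEps f).pres.Tm q}
    {b : B.X p} (hz : (cellExt noEps f).obj.d q r ((cellExt noEps f).el z) = 0)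
    (hb : Term.eval (genMap f.algHom fun _ x => x.elim) (fun _ _ _ _ _ b => b) z = B.d p q b) :
    (cellExt noEps f).obj.d p q (cellOp noEps f p q h ((cellExt noEps f).el z) b) =
      (cellExt noEps f).el z := by
  rw [← Presentation.el_d q r h', ← Presentation.el_zero] at hz
  refine (Presentation.el_d p q h _).symm.trans (Presentation.el_eq
    (.d_cell p q r h h' z b hb (Presentation.rel_of_el_eq hz)))

lemma d_cellOp' (hB : noEps → EpsZero B) {p q r : ℤ} (h : p + 1 = q) (h' : q + 1 = r)
    {z : (cellExt noEps f).obj.X q} {b : B.X p} (hz : (cellExt noEps f).obj.d q r z = 0)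
    (hb : app (cellπ noEps f hB) q z = B.d p q b) :
    (cellExt noEps f).obj.d p q (cellOp noEps f p q h z b) = z := by
  obtain ⟨z, rfl⟩ := Presentation.el_surjective z
  exact d_cellOp h h' hz hb

lemma cell_hom_ext {E : EpsCdga k} {g g' : (cellExt noEps f).obj ⟶ E}
    (h : cellι noEps f ≫ g = cellι noEps f ≫ g')
    (h' : ∀ (p q : ℤ) (h : p + 1 = q) (z : (cellExt noEps f).obj.X q) (b : B.X p),
      app g q z = app g' q z →
        app g p (cellOp noEps f p q h z b) = app g' p (cellOp noEps f p q h z b)) : g = g' :=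
  ExtData.hom_ext (congrArg Hom.algHom h) (fun _ x => x.elim) fun p q h _ b => h' p q h _ b

/-- The formal primitive of `z` labelled by `b` solves the lifting problem for `z` and `b`. Here `z`
is any cocycle of the extension, not just of `A`, so no iteration is needed. -/
lemma cellπ_liftsDisks (hB : noEps → EpsZero B) :
    CochainComplex.LiftsDisks (cellπ noEps f hB).algHom.toHom :=
  fun p q _ h h' z hz b hb =>
    ⟨cellOp noEps f p q h z b, d_cellOp' hB h h' hz hb, app_cellπ_cellOp hB p q h z b⟩

-- The lift is defined by recursion on expressions. A cell is sent to an element over its prescribed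
-- image, which is taken to be a primitive of the value of `z` whenever that is possible. For cells
-- without relation any preimage is good enough.
variable (noEps f) in
lemma cellι_hasLift {Y Z : EpsCdga k} (hY : noEps → EpsZero Y) {g : Y ⟶ Z}
    (hg : CochainComplex.LiftsDisks g.algHom.toHom)
    {φ : A ⟶ Y} {ψ : (cellExt noEps f).obj ⟶ Z} (h : φ ≫ g = cellι noEps f ≫ ψ) :
    ∃ l : (cellExt noEps f).obj ⟶ Y, cellι noEps f ≫ l = φ ∧ l ≫ g = ψ := by
  -- One total choice for all cells: a primitive of `y` over `x` if there is one, and otherwise any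
  -- element over `x`. It depends on `y` and `x` only, hence respects the congruence.
  have hex (p q : ℤ) (y : Y.X q) (x : Z.X p) : ∃ w : Y.X p, app g p w = x ∧
      ((∃ w : Y.X p, Y.d p q w = y ∧ app g p w = x) → Y.d p q w = y) := by
    by_cases hw : ∃ w : Y.X p, Y.d p q w = y ∧ app g p w = x
    · obtain ⟨w, hw₁, hw₂⟩ := hw
      exact ⟨w, hw₂, fun _ => hw₁⟩
    · obtain ⟨w, hw'⟩ := hg.surjective p x
      exact ⟨w, hw', fun h => (hw h).elim⟩
  choose s hs₁ hs₂ using hex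
  let c (p q : ℤ) (h : p + 1 = q) (z : (cellExt noEps f).pres.Tm q) (y : Y.X q) (b : B.X p) :
      Y.X p := s p q y (app ψ p (cellOp noEps f p q h ((cellExt noEps f).el z) b))
  -- Values lie over `ψ` already at the level of expressions. This comes before the descent to
  -- classes, whose verification uses it.
  have heval {n : ℤ} (z : (cellExt noEps f).pres.Tm n) :
      app g n (Term.eval (genMap φ.algHom fun _ x => x.elim) c z) =
        app ψ n ((cellExt noEps f).el z) := by
    induction z with
    | gen n x =>
      rcases x with x | x
      · exact congrArg (fun φ => app φ n x) h
      · exact x.elim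
    | zero n => exact (map_zero _).trans (map_zero _).symm
    | add x y hx hy =>
      exact (map_add _ _ _).trans ((congrArg₂ (· + ·) hx hy).trans (map_add _ _ _).symm)
    | smul c x hx =>
      exact (map_smul _ _ _).trans ((congrArg (c • ·) hx).trans (map_smul _ _ _).symm)
    | one => exact (app_one g).trans (app_one ψ).symm
    | mul p q r h x y hx hy =>
      exact (app_mul g p q r h _ _).trans
        ((congrArg₂ (fun a b => Z.mul p q r h a b) hx hy).trans (app_mul ψ p q r h _ _).symm)
    | d p q h x hx =>
      exact (app_d g p q _).trans ((congrArg (Z.d p q) hx).trans ((app_d ψ p q _).symm.trans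
        (congrArg (app ψ q) (Presentation.el_d p q h x).symm)))
    | eps p q h x hx =>
      exact (app_eps g p q h _).trans ((congrArg (Z.eps p q h) hx).trans (app_eps ψ p q h _).symm)
    | cell p q h z b hz => exact hs₁ _ _ _ _
  refine ⟨ExtData.lift (X := cellExt noEps f) φ.algHom (fun _ x => x.elim) (fun _ => φ.map_eps)
    c hY (fun p q h z z' a b hz => by simp only [c, hz])
    (fun p q r h h' z b hz hdz hdz' => hs₂ _ _ _ _ ?_), rfl, ?_⟩
  -- The value of `z` is closed and lies over `ψ z = d (ψ (cell z b))`, so the disk lifting property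
  -- shows that a primitive over `ψ (cell z b)` exists; the choice above has then picked one.
  · refine hg p q r h h' _ hdz' _ ?_
    exact (heval z).trans ((congrArg (app ψ q) (d_cellOp h h' hdz hz)).symm.trans
      (app_d ψ p q _))
  · refine EpsCdga.hom_ext fun n x => ?_
    obtain ⟨x, rfl⟩ := Presentation.el_surjective x
    exact heval x

variable (noEps) in
/-- The functoriality of `cellExt`. -/
def cellMap {A' B' : EpsCdga k} {f' : A' ⟶ B'} (hB' : noEps → EpsZero B') (u : A ⟶ A')
    (v : B ⟶ B') (w : u ≫ f' = f ≫ v) : (cellExt noEps f).obj ⟶ (cellExt noEps f').obj :=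
  ExtData.lift (X := cellExt noEps f) (u ≫ cellι noEps f').algHom (fun _ x => x.elim)
    (fun _ => (u ≫ cellι noEps f').map_eps)
    (fun p q h _ z b => cellOp noEps f' p q h z (app v p b)) (cellExt noEps f').epsZero
    (fun _ _ _ _ _ _ _ _ => rfl)
    (fun p q r h h' z b hz _ hdz' => d_cellOp' hB' h h' hdz' (by
      -- The image of a good cell is good: the projection to `B'` of the value of `z` and `v` of its
      -- evaluation in `B` are both the evaluation of the same expression with generators sent along
      -- `f ≫ v = u ≫ f'`, and the latter is `v (d b) = d (v b)`.
      refine Eq.trans ?_ ((congrArg (app v q) hz).trans (app_d v p q b))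
      trans Term.eval (genMap (f ≫ v).algHom fun _ x => x.elim) (fun _ _ _ _ _ b => app v _ b) z
      · refine Term.app_eval _ ?_ (fun p q h z a b => app_cellπ_cellOp hB' p q h a (app v p b)) z
        rintro n (x | x)
        · rw [← w]
          rfl
        · exact x.elim
      · refine (Term.app_eval _ ?_ (fun _ _ _ _ _ _ => rfl) z).symm
        rintro n (x | x)
        · rfl
        · exact x.elim))

@[simp]
lemma app_cellMap_cellOp {A' B' : EpsCdga k} {f' : A' ⟶ B'} (hB' : noEps → EpsZero B')
    (u : A ⟶ A') (v : B ⟶ B') (w : u ≫ f' = f ≫ v) (p q : ℤ) (h : p + 1 = q)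
    (z : (cellExt noEps f).obj.X q) (b : B.X p) :
    app (cellMap noEps hB' u v w) p (cellOp noEps f p q h z b) =
      cellOp noEps f' p q h (app (cellMap noEps hB' u v w) q z) (app v p b) := by
  obtain ⟨z, rfl⟩ := Presentation.el_surjective z
  rfl

lemma cellMap_cellπ {A' B' : EpsCdga k} {f' : A' ⟶ B'} (hB : noEps → EpsZero B)
    (hB' : noEps → EpsZero B') (u : A ⟶ A') (v : B ⟶ B') (w : u ≫ f' = f ≫ v) :
    cellMap noEps hB' u v w ≫ cellπ noEps f' hB' = cellπ noEps f hB ≫ v :=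
  cell_hom_ext w fun p q h z b _ => by
    simp only [app_comp, app_cellMap_cellOp, app_cellπ_cellOp]

lemma cellMap_id {hB : noEps → EpsZero B} {u : A ⟶ A} {v : B ⟶ B} {w : u ≫ f = f ≫ v}
    (hu : u = 𝟙 A) (hv : v = 𝟙 B) : cellMap noEps hB u v w = 𝟙 _ := by
  subst hu hv
  exact cell_hom_ext rfl fun p q h z b hz => by rw [app_cellMap_cellOp, hz]; rfl

lemma cellMap_comp {A' B' A'' B'' : EpsCdga k} {f' : A' ⟶ B'} {f'' : A'' ⟶ B''}
    {hB' : noEps → EpsZero B'} {hB'' : noEps → EpsZero B''} {u : A ⟶ A'} {v : B ⟶ B'}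
    {w : u ≫ f' = f ≫ v} {u' : A' ⟶ A''} {v' : B' ⟶ B''} {w' : u' ≫ f'' = f' ≫ v'}
    {u'' : A ⟶ A''} {v'' : B ⟶ B''} {w'' : u'' ≫ f'' = f ≫ v''} (hu : u'' = u ≫ u')
    (hv : v'' = v ≫ v') :
    cellMap noEps hB'' u'' v'' w'' = cellMap noEps hB' u v w ≫ cellMap noEps hB'' u' v' w' := by
  subst hu hv
  refine cell_hom_ext rfl fun p q h z b hz => ?_
  rw [app_cellMap_cellOp, hz]
  simp only [app_comp, app_cellMap_cellOp]

end cells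

end EpsCdga

/-! ### The model structures -/

namespace EpsCdga

variable {k : Type u} [CommRing k]

instance : (quasiIso k).HasTwoOutOfThreeProperty :=
  inferInstanceAs ((HomologicalComplex.quasiIso _ _).inverseImage _).HasTwoOutOfThreeProperty

instance : (quasiIso k).IsStableUnderRetracts :=
  inferInstanceAs ((HomologicalComplex.quasiIso _ _).inverseImage _).IsStableUnderRetracts

instance : (surjNeg k).IsStableUnderRetracts where
  of_retract {_ _ _ _ f g} h hg n hn y := by
    obtain ⟨x, hx⟩ := hg n hn (app h.i.right n y)
    refine ⟨app h.r.left n x, ?_⟩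
    rw [toHom_f_apply] at hx ⊢
    rw [← app_comp, h.r_w, app_comp, hx, ← app_comp]
    simp

lemma liftsDisks_iff {E F : EpsCdga k} (f : E ⟶ F) :
    CochainComplex.LiftsDisks f.algHom.toHom ↔ (surjNeg k ⊓ quasiIso k) f :=
  ⟨fun h => ⟨fun n _ => h.surjective n, h.quasiIso⟩,
    fun h => CochainComplex.liftsDisks_of_quasiIso _ F.alg.nonpos h.1 h.2⟩

namespace Realization

variable {C : Type*} [Category.{u} C] (S : Realization k C)

/-- The quasi-isomorphisms of `C`. -/
def W : MorphismProperty C := (quasiIso k).inverseImage S.U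

/-- The morphisms of `C` that are surjective in negative degrees. -/
def Fib : MorphismProperty C := (surjNeg k).inverseImage S.U

/-- The morphisms of `C` with the left lifting property against trivial fibrations. -/
def Cof : MorphismProperty C := (S.Fib ⊓ S.W).llp

instance : S.W.HasTwoOutOfThreeProperty :=
  inferInstanceAs ((quasiIso k).inverseImage S.U).HasTwoOutOfThreeProperty

instance : S.W.IsStableUnderRetracts :=
  inferInstanceAs ((quasiIso k).inverseImage S.U).IsStableUnderRetracts

instance : S.Fib.IsStableUnderRetracts :=
  inferInstanceAs ((surjNeg k).inverseImage S.U).IsStableUnderRetracts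

instance : S.Cof.IsStableUnderRetracts :=
  inferInstanceAs (S.Fib ⊓ S.W).llp.IsStableUnderRetracts

/-- Reduces lifting problems in `C` to `ε`-cdga's through the fully faithful `U`, allowing for the
isomorphism between `E` and the object of `C` that realizes it. -/
lemma hasLiftingProperty_homTo {A X Y : C} {E : EpsCdga k} {hE : S.noEps → EpsZero E}
    (i : S.U.obj A ⟶ E) (p : X ⟶ Y)
    (H : ∀ (φ : S.U.obj A ⟶ S.U.obj X) (ψ : E ⟶ S.U.obj Y), φ ≫ S.U.map p = i ≫ ψ →
      ∃ l : E ⟶ S.U.obj X, i ≫ l = φ ∧ l ≫ S.U.map p = ψ) :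
    HasLiftingProperty (S.homTo (h := hE) i) p where
  sq_hasLift {u v} sq := by
    obtain ⟨l, hl, hl'⟩ := H (S.U.map u) ((S.iso E hE).inv ≫ S.U.map v) (by
      rw [← S.U.map_comp, sq.w, S.U.map_comp, map_homTo, Category.assoc])
    exact ⟨⟨{ l := S.homFrom l
              fac_left := S.ff.map_injective (by simp [hl])
              fac_right := S.ff.map_injective (by simp [hl']) }⟩⟩

/-- A functor to `C` from a functor to `ε`-cdga's. -/
def liftFunctor {D : Type*} [Category* D] (G : D ⥤ EpsCdga k)
    (hG : ∀ X, S.noEps → EpsZero (G.obj X)) : D ⥤ C where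
  obj X := S.of (G.obj X) (hG X)
  map f := S.homFrom (G.map f ≫ (S.iso _ (hG _)).inv)
  map_id X := S.ff.map_injective (by simp)
  map_comp f g := S.ff.map_injective (by simp)

/-- Functorial factorizations in `C` from functorial factorizations of `ε`-cdga's. -/
def factorizationData {W₁ W₂ : MorphismProperty C} (Z : Arrow C ⥤ EpsCdga k)
    (hZ : ∀ f, S.noEps → EpsZero (Z.obj f))
    (i : ∀ f : Arrow C, S.U.obj f.left ⟶ Z.obj f) (p : ∀ f : Arrow C, Z.obj f ⟶ S.U.obj f.right)
    (hi : ∀ {f g : Arrow C} (φ : f ⟶ g), S.U.map φ.left ≫ i g = i f ≫ Z.map φ)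
    (hp : ∀ {f g : Arrow C} (φ : f ⟶ g), Z.map φ ≫ p g = p f ≫ S.U.map φ.right)
    (fac : ∀ f : Arrow C, i f ≫ p f = S.U.map f.hom)
    (h₁ : ∀ f : Arrow C, W₁ (S.homTo (h := hZ f) (i f)))
    (h₂ : ∀ f : Arrow C, W₂ (S.homFrom (h := hZ f) (p f))) :
    MorphismProperty.FunctorialFactorizationData W₁ W₂ where
  Z := S.liftFunctor Z hZ
  i :=
    { app f := S.homTo (i f)
      naturality f g φ := by
        change φ.left ≫ S.homTo (i g) = S.homTo (i f) ≫
          S.homFrom (Z.map φ ≫ (S.iso _ (hZ g)).inv)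
        refine S.ff.map_injective ?_
        simp only [S.U.map_comp, map_homTo, map_homFrom, Category.assoc, Iso.inv_hom_id_assoc]
        rw [← Category.assoc, hi, Category.assoc] }
  p :=
    { app f := S.homFrom (p f)
      naturality f g φ := by
        change S.homFrom (Z.map φ ≫ (S.iso _ (hZ g)).inv) ≫ S.homFrom (p g) =
          S.homFrom (p f) ≫ φ.right
        refine S.ff.map_injective ?_
        simp only [S.U.map_comp, map_homFrom, Category.assoc, Iso.inv_hom_id_assoc, hp] }
  fac := by
    ext f
    change S.homTo (i f) ≫ S.homFrom (p f) = f.hom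
    refine S.ff.map_injective ?_
    simp only [S.U.map_comp, map_homTo, map_homFrom, Category.assoc, Iso.inv_hom_id_assoc, fac]
  hi := h₁
  hp := h₂

/-- The functorial factorization by adjoining contractible generators. -/
def diskFunctor : Arrow C ⥤ EpsCdga k where
  obj f := (diskExt S.noEps (S.U.obj f.left) (S.U.obj f.right)).obj
  map φ := diskMap S.noEps (S.U.map φ.left) (S.U.map φ.right)
  map_id _ := diskMap_id (S.U.map_id _) (S.U.map_id _)
  map_comp _ _ := diskMap_comp (S.U.map_comp _ _) (S.U.map_comp _ _)

/-- The functorial factorization by adjoining primitives. -/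
def cellFunctor : Arrow C ⥤ EpsCdga k where
  obj f := (cellExt S.noEps (S.U.map f.hom)).obj
  map {f g} φ := cellMap S.noEps (fun h => S.epsZero h _) (S.U.map φ.left) (S.U.map φ.right)
    (by rw [← S.U.map_comp, φ.w, S.U.map_comp])
  map_id _ := cellMap_id (S.U.map_id _) (S.U.map_id _)
  map_comp _ _ := cellMap_comp (S.U.map_comp _ _) (S.U.map_comp _ _)

lemma W_homTo_iff {A : C} {E : EpsCdga k} {hE : S.noEps → EpsZero E} (i : S.U.obj A ⟶ E) :
    S.W (S.homTo (h := hE) i) ↔ quasiIso k i := by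
  rw [W, MorphismProperty.inverseImage_iff, map_homTo]
  exact (quasiIso k).cancel_right_of_respectsIso _ _

lemma W_homFrom_iff {B : C} {E : EpsCdga k} {hE : S.noEps → EpsZero E} (p : E ⟶ S.U.obj B) :
    S.W (S.homFrom (h := hE) p) ↔ quasiIso k p := by
  rw [W, MorphismProperty.inverseImage_iff, map_homFrom]
  exact (quasiIso k).cancel_left_of_respectsIso _ _

lemma Fib_homFrom_iff {B : C} {E : EpsCdga k} {hE : S.noEps → EpsZero E} (p : E ⟶ S.U.obj B) :
    S.Fib (S.homFrom (h := hE) p) ↔ surjNeg k p := by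
  rw [Fib, MorphismProperty.inverseImage_iff, map_homFrom]
  exact (surjNeg k).cancel_left_of_respectsIso _ _

lemma Cof_of_llp_Fib {A B : C} {i : A ⟶ B} (hi : S.Fib.llp i) : S.Cof i :=
  fun _ _ p hp => hi p hp.1

/-- The factorizations into a trivial cofibration, with the lifting property against all
fibrations, and a fibration. -/
def diskFactorization [Algebra ℚ k] :
    MorphismProperty.FunctorialFactorizationData (S.Fib.llp ⊓ S.W) S.Fib :=
  S.factorizationData S.diskFunctor (fun f => (diskExt S.noEps (S.U.obj f.left) (S.U.obj f.right)).epsZero)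
    (fun f => diskι S.noEps (S.U.obj f.left) (S.U.obj f.right))
    (fun f => diskπ S.noEps (S.U.map f.hom) fun h => S.epsZero h _)
    (fun φ => rfl)
    (fun φ => diskMap_diskπ _ _ _ _ (by rw [← S.U.map_comp, φ.w, S.U.map_comp]))
    (fun f => rfl)
    (fun f => ⟨fun _ _ p hp => S.hasLiftingProperty_homTo _ _ fun _ _ =>
        diskι_hasLift S.noEps _ _ (fun h => S.epsZero h _) hp,
      (S.W_homTo_iff _).2 (diskι_quasiIso S.noEps _ _ fun h => S.epsZero h _)⟩)
    (fun f => (S.Fib_homFrom_iff _).2 (diskπ_surjective _ _))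

/-- The factorizations into a cofibration and a trivial fibration. -/
def cellFactorization :
    MorphismProperty.FunctorialFactorizationData S.Cof (S.Fib ⊓ S.W) :=
  S.factorizationData S.cellFunctor (fun f => (cellExt S.noEps (S.U.map f.hom)).epsZero)
    (fun f => cellι S.noEps (S.U.map f.hom))
    (fun f => cellπ S.noEps (S.U.map f.hom) fun h => S.epsZero h _)
    (fun φ => rfl)
    (fun φ => cellMap_cellπ _ _ _ _ (by rw [← S.U.map_comp, φ.w, S.U.map_comp]))
    (fun f => rfl)
    (fun f _ _ p hp => S.hasLiftingProperty_homTo _ _ fun _ _ =>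
        cellι_hasLift S.noEps _ (fun h => S.epsZero h _) ((liftsDisks_iff _).2 hp))
    (fun f =>
      have h := (liftsDisks_iff _).1 (cellπ_liftsDisks (f := S.U.map f.hom) fun h => S.epsZero h _)
      ⟨(S.Fib_homFrom_iff _).2 h.1, (S.W_homFrom_iff _).2 h.2⟩)

/-- Two retract arguments with the same factorization `f = i ≫ p`. If `f` is a trivial cofibration,
then `p` is a weak equivalence by two-out-of-three, so `f` lifts against `p` and is a retract of
`i`. If `f` lifts against all fibrations, it lifts against `p` outright, and it is a weak
equivalence as a retract of `i`. -/
lemma Cof_inf_W_eq [Algebra ℚ k] : S.Cof ⊓ S.W = S.Fib.llp := by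
  apply le_antisymm
  · rintro A B f ⟨hf, hf'⟩
    have h := S.diskFactorization.factorizationData f
    have hp : (S.Fib ⊓ S.W) h.p := ⟨h.hp, S.W.of_precomp _ _ h.hi.2 (by rwa [h.fac])⟩
    have := hf h.p hp
    exact MorphismProperty.of_retract (RetractArrow.ofLeftLiftingProperty h.fac) h.hi.1
  · intro A B f hf
    have h := S.diskFactorization.factorizationData f
    have := hf h.p h.hp
    exact ⟨S.Cof_of_llp_Fib hf,
      MorphismProperty.of_retract (RetractArrow.ofLeftLiftingProperty h.fac) h.hi.2⟩

/-- The factorizations into a trivial cofibration and a fibration. -/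
def diskFactorization' [Algebra ℚ k] :
    MorphismProperty.FunctorialFactorizationData (S.Cof ⊓ S.W) S.Fib :=
  S.diskFactorization.ofLE (inf_le_left.trans S.Cof_inf_W_eq.ge) le_rfl

/-- The model structure. -/
@[reducible]
def modelCategory [Algebra ℚ k] : ModelCategory C :=
  { categoryWithFibrations := ⟨S.Fib⟩
    categoryWithCofibrations := ⟨S.Cof⟩
    categoryWithWeakEquivalences := ⟨S.W⟩
    cm1a := have := S.hasLimits; hasFiniteLimits_of_hasLimits C
    cm1b := have := S.hasColimits; hasFiniteColimits_of_hasColimits C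
    cm2 := (inferInstance : S.W.HasTwoOutOfThreeProperty)
    cm3a := (inferInstance : S.W.IsStableUnderRetracts)
    cm3b := (inferInstance : S.Fib.IsStableUnderRetracts)
    cm3c := (inferInstance : S.Cof.IsStableUnderRetracts)
    cm4a i p hi hi' hp := by
      have h : S.Fib.llp i := S.Cof_inf_W_eq.le _ ⟨hi.mem, hi'.mem⟩
      exact h p hp.mem
    cm4b i p hi hp hp' := by
      have h : S.Cof i := hi.mem
      exact h p ⟨hp.mem, hp'.mem⟩
    cm5a := (⟨fun f => ⟨S.diskFactorization'.factorizationData f⟩⟩ :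
      MorphismProperty.HasFactorization (S.Cof ⊓ S.W) S.Fib)
    cm5b := (⟨fun f => ⟨S.cellFactorization.factorizationData f⟩⟩ :
      MorphismProperty.HasFactorization S.Cof (S.Fib ⊓ S.W)) }

lemma isModelStructure [Algebra ℚ k] : IsModelStructure S.modelCategory S.W S.Fib where
  hasLimits := S.hasLimits
  hasColimits := S.hasColimits
  weakEquivalences_eq := rfl
  fibrations_eq := rfl
  cofibrations_eq := rfl
  functorial_cof_trivFib := ⟨⟨S.cellFactorization⟩⟩
  functorial_trivCof_fib :=
    ⟨⟨S.diskFactorization'⟩⟩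

end Realization

end EpsCdga

/-! ### Cdga's and `ε`-cdga's as realizations -/

variable {k : Type u} [CommRing k]

/-- A cdga as an `ε`-cdga with `ε = 0`. -/
def Cdga.withZeroEps (A : Cdga k) : EpsCdga k where
  alg := A
  eps _ _ _ := 0
  eps_eps _ _ _ _ _ _ := rfl
  d_eps _ _ _ _ _ _ := by simp
  eps_mul _ _ _ _ _ _ _ _ _ _ _ _ := by simp

namespace EpsCdga

namespace Realization

variable (k) in
/-- The `ε`-cdga's. -/
def eps : Realization k (EpsCdga k) where
  U := 𝟭 _
  ff := .id _
  noEps := False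
  epsZero h := h.elim
  of E _ := E
  iso E _ := Iso.refl E

variable (k) in
/-- The cdga's, as the `ε`-cdga's with `ε = 0`. -/
def zeroEps : Realization k (Cdga k) where
  U :=
    { obj := Cdga.withZeroEps
      map f := ⟨f, fun _ _ _ _ => map_zero (f.toHom.f _).hom⟩
      map_id _ := rfl
      map_comp _ _ := rfl }
  ff := { preimage f := f.algHom }
  noEps := True
  epsZero _ _ _ _ _ _ := rfl
  of E _ := E.alg
  -- The operator of `E` vanishes only by the hypothesis `h`, so forgetting it and putting back `0`
  -- gives an isomorphic object, not the same one.
  iso E h :=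
    { hom := ⟨𝟙 E.alg, fun p q h' a => (h trivial p q h' a).symm⟩
      inv := ⟨𝟙 E.alg, fun p q h' a => h trivial p q h' a⟩
      hom_inv_id := Hom.ext (Category.id_comp _)
      inv_hom_id := Hom.ext (Category.id_comp _) }

end Realization

variable (k) [Algebra ℚ k]

/-- The model structure on cdga's. -/
@[reducible]
def cdgaModelCategory : ModelCategory (Cdga k) := (Realization.zeroEps k).modelCategory

/-- The model structure on `ε`-cdga's. -/
@[reducible]
def epsCdgaModelCategory : ModelCategory (EpsCdga k) := (Realization.eps k).modelCategory

lemma isModelStructure_cdga :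
    IsModelStructure (cdgaModelCategory k) (Cdga.quasiIso k) (Cdga.surjNeg k) :=
  (Realization.zeroEps k).isModelStructure

lemma isModelStructure_epsCdga :
    IsModelStructure (epsCdgaModelCategory k) (quasiIso k) (surjNeg k) :=
  (Realization.eps k).isModelStructure

end EpsCdga

/-! ### Dg-modules and the universal derivation -/

variable {k : Type u} [CommRing k]

namespace CochainComplex

variable (K : CochainComplex (ModuleCat.{u} k) ℤ)

/-- The identification of terms of equal degrees. -/
def castDeg {p q : ℤ} (h : p = q) : K.X p →ₗ[k] K.X q := h ▸ LinearMap.id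

variable {p q : ℤ} (h : p = q)

@[simp]
lemma d_castDeg (r : ℤ) (x : K.X p) : K.d q r (K.castDeg h x) = K.d p r x := by
  subst h; rfl

@[simp]
lemma castDeg_d (r : ℤ) (x : K.X r) : K.castDeg h (K.d r p x) = K.d r q x := by
  subst h; rfl

end CochainComplex

namespace DgMod

variable {A : Cdga k}

@[simp]
lemma act_castDeg (M : DgMod A) {p q r s : ℤ} (h : r + q = s) (h' : p = q) (a : A.cx.X r)
    (x : M.cx.X p) : M.act r q s h a (M.cx.castDeg h' x) = M.act r p s (by omega) a x := by
  subst h'; rfl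

@[simp]
lemma castDeg_act (M : DgMod A) {p q r s : ℤ} (h : r + s = p) (h' : p = q) (a : A.cx.X r)
    (x : M.cx.X s) : M.cx.castDeg h' (M.act r s p h a x) = M.act r s q (by omega) a x := by
  subst h'; rfl

/-! ### The Kähler differentials -/

/-- Formal expressions in the operations of a dg-module, on generators `del a`. -/
inductive KahlerTerm (A : Cdga k) : ℤ → Type u
  | del (n : ℤ) (a : A.cx.X n) : KahlerTerm A n
  | zero (n : ℤ) : KahlerTerm A n
  | add {n : ℤ} (x y : KahlerTerm A n) : KahlerTerm A n
  | smul {n : ℤ} (c : k) (x : KahlerTerm A n) : KahlerTerm A n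
  | act (p q r : ℤ) (h : p + q = r) (a : A.cx.X p) (x : KahlerTerm A q) : KahlerTerm A r
  | d (p q : ℤ) (h : p + 1 = q) (x : KahlerTerm A p) : KahlerTerm A q

open EpsCdga in
/-- The congruence generated by the laws of dg-modules and derivations. -/
inductive KahlerRel (A : Cdga k) : ∀ n : ℤ, KahlerTerm A n → KahlerTerm A n → Prop
  | refl (n : ℤ) (x) : KahlerRel A n x x
  | symm (n : ℤ) (x y) : KahlerRel A n x y → KahlerRel A n y x
  | trans (n : ℤ) (x y z) : KahlerRel A n x y → KahlerRel A n y z → KahlerRel A n x z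
  | congr_add (n : ℤ) (x x' y y') : KahlerRel A n x x' → KahlerRel A n y y' →
      KahlerRel A n (.add x y) (.add x' y')
  | congr_smul (n : ℤ) (c : k) (x x') : KahlerRel A n x x' →
      KahlerRel A n (.smul c x) (.smul c x')
  | congr_act (p q r : ℤ) (h) (a) (x x') : KahlerRel A q x x' →
      KahlerRel A r (.act p q r h a x) (.act p q r h a x')
  | congr_d (p q : ℤ) (h) (x x') : KahlerRel A p x x' → KahlerRel A q (.d p q h x) (.d p q h x')
  | pos (n : ℤ) (x) : 0 < n → KahlerRel A n x (.zero n)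
  | add_assoc (n : ℤ) (x y z) : KahlerRel A n (.add (.add x y) z) (.add x (.add y z))
  | add_comm (n : ℤ) (x y) : KahlerRel A n (.add x y) (.add y x)
  | zero_add (n : ℤ) (x) : KahlerRel A n (.add (.zero n) x) x
  | one_smul (n : ℤ) (x) : KahlerRel A n (.smul 1 x) x
  | mul_smul (n : ℤ) (c c' : k) (x) : KahlerRel A n (.smul (c * c') x) (.smul c (.smul c' x))
  | add_smul (n : ℤ) (c c' : k) (x) :
      KahlerRel A n (.smul (c + c') x) (.add (.smul c x) (.smul c' x))
  | smul_add (n : ℤ) (c : k) (x y) :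
      KahlerRel A n (.smul c (.add x y)) (.add (.smul c x) (.smul c y))
  | zero_smul (n : ℤ) (x) : KahlerRel A n (.smul 0 x) (.zero n)
  | smul_zero (n : ℤ) (c : k) : KahlerRel A n (.smul c (.zero n)) (.zero n)
  | d_add (p q : ℤ) (h) (x y) :
      KahlerRel A q (.d p q h (.add x y)) (.add (.d p q h x) (.d p q h y))
  | d_smul (p q : ℤ) (h) (c : k) (x) :
      KahlerRel A q (.d p q h (.smul c x)) (.smul c (.d p q h x))
  | d_d (p q r : ℤ) (h) (h') (x) : KahlerRel A r (.d q r h' (.d p q h x)) (.zero r)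
  | add_act (p q r : ℤ) (h) (a a') (x) :
      KahlerRel A r (.act p q r h (a + a') x) (.add (.act p q r h a x) (.act p q r h a' x))
  | act_add (p q r : ℤ) (h) (a) (x x') :
      KahlerRel A r (.act p q r h a (.add x x')) (.add (.act p q r h a x) (.act p q r h a x'))
  | smul_act (p q r : ℤ) (h) (c : k) (a) (x) :
      KahlerRel A r (.act p q r h (c • a) x) (.smul c (.act p q r h a x))
  | act_smul (p q r : ℤ) (h) (c : k) (a) (x) :
      KahlerRel A r (.act p q r h a (.smul c x)) (.smul c (.act p q r h a x))
  | one_act (p : ℤ) (h) (x) : KahlerRel A p (.act 0 p p h A.one x) x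
  | mul_act (p q r pq qr s : ℤ) (h₁) (h₂) (h₃) (h₄) (a b x) :
      KahlerRel A s (.act pq r s h₃ (A.mul p q pq h₁ a b) x)
        (.act p qr s h₄ a (.act q r qr h₂ b x))
  | d_act (p q r p' q' r' : ℤ) (h) (hq) (hr) (h') (h'') (a x) : p + 1 = p' →
      KahlerRel A r' (.d r r' hr (.act p q r h a x))
        (.add (.act p' q r' h' (A.cx.d p p' a) x)
          (.smul (sign k p) (.act p q' r' h'' a (.d q q' hq x))))
  | del_add (n : ℤ) (a b) : KahlerRel A n (.del n (a + b)) (.add (.del n a) (.del n b))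
  | del_smul (n : ℤ) (c : k) (a) : KahlerRel A n (.del n (c • a)) (.smul c (.del n a))
  | del_d (p q : ℤ) (h) (a) : KahlerRel A q (.del q (A.cx.d p q a)) (.d p q h (.del p a))
  | del_mul (p q r : ℤ) (h) (h') (a b) :
      KahlerRel A r (.del r (A.mul p q r h a b))
        (.add (.smul (sign k (p * q)) (.act q p r h' b (.del p a))) (.act p q r h a (.del q b)))

namespace Kahler

variable (A)

/-- The expressions up to congruence. -/
def setoid (n : ℤ) : Setoid (KahlerTerm A n) :=
  ⟨KahlerRel A n, ⟨KahlerRel.refl n, fun {x y} => KahlerRel.symm n x y,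
    fun {x y z} => KahlerRel.trans n x y z⟩⟩

/-- The graded pieces of the Kähler differentials. -/
def Carrier (n : ℤ) : Type u := Quotient (setoid A n)

variable {A}

/-- The class of an expression. -/
def cls {n : ℤ} (x : KahlerTerm A n) : Carrier A n := Quotient.mk (setoid A n) x

lemma cls_eq {n : ℤ} {x y : KahlerTerm A n} (h : KahlerRel A n x y) : cls x = cls y :=
  Quotient.sound (s := setoid A n) h

variable (A)

instance (n : ℤ) : Zero (Carrier A n) := ⟨cls (.zero n)⟩

instance (n : ℤ) : Add (Carrier A n) :=
  ⟨Quotient.map₂ (sa := setoid A n) (sb := setoid A n) (sc := setoid A n) .add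
    fun _ _ h _ _ h' => .congr_add n _ _ _ _ h h'⟩

instance (n : ℤ) : AddCommMonoid (Carrier A n) where
  add_assoc := by
    rintro ⟨x⟩ ⟨y⟩ ⟨z⟩
    exact cls_eq (.add_assoc n x y z)
  add_comm := by
    rintro ⟨x⟩ ⟨y⟩
    exact cls_eq (.add_comm n x y)
  zero_add := by
    rintro ⟨x⟩
    exact cls_eq (.zero_add n x)
  add_zero := by
    rintro ⟨x⟩
    exact (cls_eq (.add_comm n x (.zero n))).trans (cls_eq (.zero_add n x))
  nsmul := nsmulRec

instance (n : ℤ) : Module k (Carrier A n) where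
  smul c := Quotient.map (sa := setoid A n) (sb := setoid A n) (.smul c)
    fun _ _ h => .congr_smul n c _ _ h
  one_smul := by
    rintro ⟨x⟩
    exact cls_eq (.one_smul n x)
  mul_smul := by
    rintro c c' ⟨x⟩
    exact cls_eq (.mul_smul n c c' x)
  smul_zero c := cls_eq (.smul_zero n c)
  smul_add := by
    rintro c ⟨x⟩ ⟨y⟩
    exact cls_eq (.smul_add n c x y)
  add_smul := by
    rintro c c' ⟨x⟩
    exact cls_eq (.add_smul n c c' x)
  zero_smul := by
    rintro ⟨x⟩
    exact cls_eq (.zero_smul n x)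

instance (n : ℤ) : AddCommGroup (Carrier A n) := Module.addCommMonoidToAddCommGroup k

/-- The differential. -/
def diff (p q : ℤ) (h : p + 1 = q) : Carrier A p →ₗ[k] Carrier A q where
  toFun := Quotient.map (sa := setoid A p) (sb := setoid A q) (.d p q h)
    fun _ _ => .congr_d p q h _ _
  map_add' := by
    rintro ⟨x⟩ ⟨y⟩
    exact cls_eq (.d_add p q h x y)
  map_smul' := by
    rintro c ⟨x⟩
    exact cls_eq (.d_smul p q h c x)

lemma diff_diff (p q r : ℤ) (h : p + 1 = q) (h' : q + 1 = r) (x : Carrier A p) :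
    diff A q r h' (diff A p q h x) = 0 := by
  obtain ⟨x⟩ := x
  exact cls_eq (.d_d p q r h h' x)

/-- The action of `A`. -/
def carrierAct (p q r : ℤ) (h : p + q = r) : A.cx.X p →ₗ[k] Carrier A q →ₗ[k] Carrier A r :=
  LinearMap.mk₂ k
    (fun a => Quotient.map (sa := setoid A q) (sb := setoid A r) (.act p q r h a)
      fun _ _ => .congr_act p q r h a _ _)
    (by
      rintro a a' ⟨x⟩
      exact cls_eq (.add_act p q r h a a' x))
    (by
      rintro c a ⟨x⟩
      exact cls_eq (.smul_act p q r h c a x))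
    (by
      rintro a ⟨x⟩ ⟨x'⟩
      exact cls_eq (.act_add p q r h a x x'))
    (by
      rintro c a ⟨x⟩
      exact cls_eq (.act_smul p q r h c a x))

end Kahler

open Kahler in
/-- The dg-module of Kähler differentials. -/
def kahler (A : Cdga k) : DgMod A where
  cx := CochainComplex.ofModules (Carrier A) (diff A) (diff_diff A)
  nonpos n hn := ⟨fun x y => by
    obtain ⟨x⟩ := x
    obtain ⟨y⟩ := y
    exact (cls_eq (.pos n x hn)).trans (cls_eq (.pos n y hn)).symm⟩
  act := carrierAct A
  one_act p := by
    rintro ⟨x⟩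
    exact cls_eq (.one_act p (by omega) x)
  mul_act p q r pq qr s h₁ h₂ h₃ a b := by
    rintro ⟨x⟩
    exact cls_eq (.mul_act p q r pq qr s h₁ h₂ h₃ _ a b x)
  d_act p q r p' q' r' h hp hq hr a x := by
    refine (CochainComplex.ofModules_d _ _ (diff_diff A) hr _).trans (Eq.trans ?_
      (congrArg (fun y => carrierAct A p' q r' (by omega) (A.cx.d p p' a) x +
        p.negOnePow • carrierAct A p q' r' (by omega) a y)
        (CochainComplex.ofModules_d _ _ (diff_diff A) hq x).symm))
    rw [← EpsCdga.sign_smul (k := k)]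
    obtain ⟨x⟩ := x
    exact cls_eq (.d_act p q r p' q' r' h hq hr (by omega) (by omega) a x hp)

namespace Kahler

/-- The class of an expression, as a Kähler differential. -/
def el {n : ℤ} (x : KahlerTerm A n) : (kahler A).cx.X n := cls x

lemma el_eq {n : ℤ} {x y : KahlerTerm A n} (h : KahlerRel A n x y) : el x = el y := cls_eq h

lemma el_d (p q : ℤ) (h : p + 1 = q) (x : KahlerTerm A p) :
    el (.d p q h x) = (kahler A).cx.d p q (el x) :=
  (CochainComplex.ofModules_d _ _ (diff_diff A) h (cls x)).symm

variable (A) in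
/-- The universal derivation. -/
def del : A.cx ⟶ (kahler A).cx :=
  CochainComplex.homMk
    (fun n =>
      { toFun a := el (.del n a)
        map_add' a b := el_eq (.del_add n a b)
        map_smul' c a := el_eq (.del_smul n c a) })
    (fun p q h a => (el_eq (.del_d p q h a)).trans (el_d p q h _))

lemma isDerivation_del : IsDerivation (del A) where
  map_mul p q r h a b := by
    rw [← EpsCdga.sign_smul (k := k)]
    exact el_eq (.del_mul p q r h _ a b)

/-- The Kähler differentials are generated by the image of the universal derivation. -/
lemma induction {P : ∀ n : ℤ, (kahler A).cx.X n → Prop}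
    (del : ∀ (n : ℤ) (a : A.cx.X n), P n ((del A).f n a))
    (zero : ∀ n : ℤ, P n 0)
    (add : ∀ (n : ℤ) (x y : (kahler A).cx.X n), P n x → P n y → P n (x + y))
    (smul : ∀ (n : ℤ) (c : k) (x : (kahler A).cx.X n), P n x → P n (c • x))
    (act : ∀ (p q r : ℤ) (h : p + q = r) (a : A.cx.X p) (x : (kahler A).cx.X q), P q x →
      P r ((kahler A).act p q r h a x))
    (d : ∀ (p q : ℤ) (_ : p + 1 = q) (x : (kahler A).cx.X p), P p x → P q ((kahler A).cx.d p q x))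
    {n : ℤ} (x : (kahler A).cx.X n) : P n x := by
  suffices h : ∀ {n : ℤ} (x : KahlerTerm A n), P n (el x) by
    obtain ⟨x⟩ := x
    exact h x
  intro n x
  induction x with
  | del n a => exact del n a
  | zero n => exact zero n
  | add x y hx hy => exact add _ _ _ hx hy
  | smul c x hx => exact smul _ _ _ hx
  | act p q r h a x hx => exact act p q r h a _ hx
  | d p q h x hx => exact el_d p q h x ▸ d p q h _ hx

section lift

variable {M : DgMod A} (D : A.cx ⟶ M.cx)

/-- The evaluation of expressions in the target of a derivation. -/
def eval : ∀ {n : ℤ}, KahlerTerm A n → M.cx.X n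
  | _, .del n a => D.f n a
  | _, .zero _ => 0
  | _, .add x y => eval x + eval y
  | _, .smul c x => c • eval x
  | _, .act p q r h a x => M.act p q r h a (eval x)
  | _, .d p q _ x => M.cx.d p q (eval x)

variable {D}

lemma eval_eq (hD : IsDerivation D) {n : ℤ} {x y : KahlerTerm A n} (h : KahlerRel A n x y) :
    eval D x = eval D y := by
  induction h with
  | refl => rfl
  | symm _ _ _ _ h => exact h.symm
  | trans _ _ _ _ _ _ h h' => exact h.trans h'
  | pos n x hn =>
    have := M.nonpos n hn
    exact Subsingleton.elim _ _
  | congr_add _ _ _ _ _ _ _ h h' => simp only [eval, h, h']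
  | congr_smul _ _ _ _ _ h => simp only [eval, h]
  | congr_act _ _ _ _ _ _ _ _ h => simp only [eval, h]
  | congr_d _ _ _ _ _ _ h => simp only [eval, h]
  | add_assoc => simp only [eval, add_assoc]
  | add_comm => simp only [eval, add_comm]
  | zero_add => simp only [eval, zero_add]
  | one_smul => simp only [eval, one_smul]
  | mul_smul => simp only [eval, mul_smul]
  | add_smul => simp only [eval, add_smul]
  | smul_add => simp only [eval, smul_add]
  | zero_smul => simp only [eval, zero_smul]
  | smul_zero => simp only [eval, smul_zero]
  | d_d => exact CochainComplex.d_d_apply M.cx _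
  | one_act => exact M.one_act _ _
  | mul_act p q r pq qr s h₁ h₂ h₃ _ a b x => exact M.mul_act p q r pq qr s h₁ h₂ h₃ a b _
  | d_act p q r p' q' r' h hq hr _ _ a x hp =>
    simp only [eval, EpsCdga.sign_smul]
    exact M.d_act p q r p' q' r' h hp hq hr a _
  | del_d p q h a => exact CochainComplex.map_d_apply D a
  | del_mul p q r h _ a b =>
    simp only [eval, EpsCdga.sign_smul]
    exact hD.map_mul p q r h a b
  | _ => simp only [eval, map_add, map_smul, LinearMap.add_apply, LinearMap.smul_apply]

/-- The universal property of the Kähler differentials. -/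
def lift (hD : IsDerivation D) : Hom (kahler A) M where
  toHom := CochainComplex.homMk
    (fun n =>
      { toFun := Quotient.lift (s := setoid A n) (eval D) fun _ _ => eval_eq hD
        map_add' := by
          rintro ⟨x⟩ ⟨y⟩
          rfl
        map_smul' := by
          rintro c ⟨x⟩
          rfl })
    (by
      rintro p q h ⟨x⟩
      exact (congrArg (Quotient.lift (s := setoid A q) (eval D) fun _ _ => eval_eq hD)
        (el_d p q h x)).symm)
  map_act p q r h a := by
    rintro ⟨x⟩
    rfl

lemma del_lift (hD : IsDerivation D) : del A ≫ (lift hD).toHom = D :=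
  CochainComplex.hom_ext_apply fun _ _ => rfl

end lift

/-- The relations imposed on expressions hold in the target of every derivation, so evaluation
descends to a morphism. Uniqueness holds because the differentials `∂a` generate. -/
lemma isUniversalDerivation_del : IsUniversalDerivation (del A) where
  isDerivation := isDerivation_del
  existsUnique M D hD := by
    refine ⟨lift hD, del_lift hD, fun f hf => Hom.ext (CochainComplex.hom_ext_apply fun n x => ?_)⟩
    induction x using induction with
    | del n a => exact congrArg (fun g : A.cx ⟶ M.cx => g.f n a) hf
    | zero n => simp
    | add n x y hx hy => rw [map_add, map_add, hx, hy]
    | smul n c x hx =>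
      exact ((f.toHom.f n).hom.map_smul c x).trans
        ((congrArg (c • ·) hx).trans (((lift hD).toHom.f n).hom.map_smul c x).symm)
    | act p q r h a x hx => rw [f.map_act, (lift hD).map_act, hx]
    | d p q h x hx => rw [CochainComplex.map_d_apply, CochainComplex.map_d_apply, hx]

end Kahler

end DgMod

/-! ### Desuspension of dg-modules -/

variable {k : Type u} [CommRing k] {A : Cdga k}

namespace DgMod

variable (M : DgMod A)

lemma _root_.Cdga.eq_zero_of_pos {n : ℤ} (hn : 0 < n) (x : A.cx.X n) : x = 0 :=
  have := A.nonpos n hn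
  Subsingleton.elim _ _

/-- The degree `n` part of the truncation in degrees `≤ 0` of `M[-1]`. -/
def unshiftDeg (n : ℤ) : Submodule k (M.cx.X (n - 1)) where
  -- Truncation of `M[-1]`: degree `0` consists of the cocycles of `M` in degree `-1`, and nothing
  -- is left above.
  carrier := {y | (0 ≤ n → M.cx.d (n - 1) n y = 0) ∧ (0 < n → y = 0)}
  add_mem' h h' := ⟨fun hn => by simp [h.1 hn, h'.1 hn], fun hn => by simp [h.2 hn, h'.2 hn]⟩
  zero_mem' := ⟨fun _ => by simp, fun _ => rfl⟩
  smul_mem' c z h := ⟨fun hn => by simp [h.1 hn], fun hn => by simp [h.2 hn]⟩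

/-- The differential of `M[-1]`. -/
def unshiftD (p q : ℤ) (h : p + 1 = q) : M.unshiftDeg p →ₗ[k] M.unshiftDeg q where
  toFun y := ⟨-M.cx.d (p - 1) (q - 1) y.1, fun _ => by simp [CochainComplex.d_d_apply], fun hq => by
    have := y.2.1 (by omega)
    obtain rfl : p = q - 1 := by omega
    simp [this]⟩
  map_add' y y' := Subtype.ext (by simp; abel)
  map_smul' c y := Subtype.ext (by simp)

/-- The action of `A` on `M[-1]`. -/
def unshiftAct (p q r : ℤ) (h : p + q = r) :
    A.cx.X p →ₗ[k] M.unshiftDeg q →ₗ[k] M.unshiftDeg r :=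
  LinearMap.mk₂ k
    (fun a y => ⟨p.negOnePow • M.act p (q - 1) (r - 1) (by omega) a y.1, by
      by_cases hp : 0 < p
      · rw [A.eq_zero_of_pos hp a]
        simp
      by_cases hq : 0 < q
      · rw [y.2.2 hq]
        simp
      refine ⟨fun hr => ?_, fun hr => by omega⟩
      obtain rfl : p = 0 := by omega
      obtain rfl : q = 0 := by omega
      obtain rfl : r = 0 := by omega
      simp only [Int.negOnePow_zero, one_smul]
      rw [M.d_act 0 (0 - 1) (0 - 1) 1 0 0 _ (by omega) (by omega) (by omega), y.2.1 le_rfl,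
        A.eq_zero_of_pos (n := 1) (by omega) (A.cx.d 0 1 a)]
      simp⟩)
    (fun a a' y => Subtype.ext (by simp))
    (fun c a y => Subtype.ext (by simp [smul_comm p.negOnePow c]))
    (fun a y y' => Subtype.ext (by simp))
    (fun c a y => Subtype.ext (by simp [smul_comm p.negOnePow c]))

lemma unshiftD_unshiftD (p q r : ℤ) (h : p + 1 = q) (h' : q + 1 = r) (y : M.unshiftDeg p) :
    M.unshiftD q r h' (M.unshiftD p q h y) = 0 :=
  Subtype.ext (by simp [unshiftD, CochainComplex.d_d_apply])

lemma unshift_one_act (p : ℤ) (x : M.unshiftDeg p) :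
    M.unshiftAct 0 p p (by omega) A.one x = x :=
  Subtype.ext (by simp [unshiftAct, M.one_act])

lemma unshift_mul_act (p q r pq qr s : ℤ) (h₁ : p + q = pq) (h₂ : q + r = qr) (h₃ : pq + r = s)
    (a : A.cx.X p) (b : A.cx.X q) (x : M.unshiftDeg r) :
    M.unshiftAct pq r s h₃ (A.mul p q pq h₁ a b) x =
      M.unshiftAct p qr s (by omega) a (M.unshiftAct q r qr h₂ b x) :=
  Subtype.ext (by
    have := M.mul_act p q (r - 1) pq (qr - 1) (s - 1) h₁ (by omega) (by omega) a b x.1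
    subst h₁
    simp only [unshiftAct, LinearMap.mk₂_apply, Int.negOnePow_add, mul_smul,
      LinearMap.map_smul_of_tower, this])

lemma unshift_d_act (p q r p' q' r' : ℤ) (h : p + q = r) (hp : p + 1 = p') (hq : q + 1 = q')
    (hr : r + 1 = r') (a : A.cx.X p) (x : M.unshiftDeg q) :
    M.unshiftD r r' hr (M.unshiftAct p q r h a x) =
      M.unshiftAct p' q r' (by omega) (A.cx.d p p' a) x +
        p.negOnePow • M.unshiftAct p q' r' (by omega) a (M.unshiftD q q' hq x) :=
  Subtype.ext (by
    have := M.d_act p (q - 1) (r - 1) p' (q' - 1) (r' - 1) (by omega) hp (by omega) (by omega) a x.1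
    subst hp
    obtain hs | hs := Int.units_eq_one_or p.negOnePow <;>
      simp [unshiftAct, unshiftD, Int.negOnePow_succ, hs, this] <;> abel)

/-- The truncation in degrees `≤ 0` of the shift `M[-1]`, with `M[-1]^n = M^(n-1)`. -/
def unshift : DgMod A where
  cx := CochainComplex.ofModules (fun n => M.unshiftDeg n) M.unshiftD M.unshiftD_unshiftD
  nonpos n hn := ⟨fun x y => Subtype.ext ((x.2.2 hn).trans (y.2.2 hn).symm)⟩
  act := M.unshiftAct
  one_act := M.unshift_one_act
  mul_act := M.unshift_mul_act
  d_act p q r p' q' r' h hp hq hr a x :=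
    (CochainComplex.ofModules_d _ _ M.unshiftD_unshiftD hr _).trans
      ((M.unshift_d_act p q r p' q' r' h hp hq hr a x).trans
        (congrArg (fun y => M.unshiftAct p' q r' (by omega) (A.cx.d p p' a) x +
          p.negOnePow • M.unshiftAct p q' r' (by omega) a y)
          (CochainComplex.ofModules_d _ _ M.unshiftD_unshiftD hq x).symm))

variable {M}

lemma unshift_d {p q : ℤ} (h : p + 1 = q) (y : M.unshiftDeg p) :
    M.unshift.cx.d p q y = M.unshiftD p q h y :=
  CochainComplex.ofModules_d _ _ M.unshiftD_unshiftD h y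

/-- The morphism `N[1] → M` corresponding to a morphism `N → M[-1]`. -/
def shiftHom {N : DgMod A} (f : Hom N M.unshift) : Hom N.shift M where
  toHom := CochainComplex.homMk
    -- The component of degree `n` of `M[-1][1]` sits inside `M^(n+1-1)`, which is `M^n` only up to
    -- a cast.
    (fun n => (M.cx.castDeg (add_sub_cancel_right n 1)).comp
      ((M.unshiftDeg (n + 1)).subtype.comp (f.toHom.f (n + 1)).hom))
    (by
      intro p q h x
      have h₁ : f.toHom.f (q + 1) (N.cx.d (p + 1) (q + 1) x) =
          M.unshiftD (p + 1) (q + 1) (by omega) (f.toHom.f (p + 1) x) :=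
        (CochainComplex.map_d_apply f.toHom x).trans (unshift_d (by omega) _)
      have h₂ : (f.toHom.f (q + 1) (N.cx.d (p + 1) (q + 1) x) : M.unshiftDeg (q + 1)).1 =
          -M.cx.d (p + 1 - 1) (q + 1 - 1) (f.toHom.f (p + 1) x : M.unshiftDeg (p + 1)).1 :=
        congrArg Subtype.val h₁
      change M.cx.castDeg _ (f.toHom.f (q + 1) (-N.cx.d (p + 1) (q + 1) x) :
          M.unshiftDeg (q + 1)).1 =
        M.cx.d p q (M.cx.castDeg _ (f.toHom.f (p + 1) x : M.unshiftDeg (p + 1)).1)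
      have h₃ : (f.toHom.f (q + 1) (-N.cx.d (p + 1) (q + 1) x) : M.unshiftDeg (q + 1)).1 =
          -(f.toHom.f (q + 1) (N.cx.d (p + 1) (q + 1) x) : M.unshiftDeg (q + 1)).1 :=
        congrArg Subtype.val ((f.toHom.f (q + 1)).hom.map_neg _)
      rw [h₃, h₂, neg_neg, CochainComplex.castDeg_d, CochainComplex.d_castDeg])
  map_act p q r h a x := by
    have h₁ : (f.toHom.f (r + 1) (N.act p (q + 1) (r + 1) (by omega) a x) :
        M.unshiftDeg (r + 1)).1 = p.negOnePow • M.act p (q + 1 - 1) (r + 1 - 1) (by omega) a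
          (f.toHom.f (q + 1) x : M.unshiftDeg (q + 1)).1 :=
      congrArg Subtype.val (f.map_act p (q + 1) (r + 1) (by omega) a x)
    have h₂ : (f.toHom.f (r + 1) (p.negOnePow • N.act p (q + 1) (r + 1) (by omega) a x) :
        M.unshiftDeg (r + 1)).1 = p.negOnePow •
          (f.toHom.f (r + 1) (N.act p (q + 1) (r + 1) (by omega) a x) : M.unshiftDeg (r + 1)).1 :=
      congrArg Subtype.val ((f.toHom.f (r + 1)).hom.map_smul_of_tower p.negOnePow _)
    change M.cx.castDeg _ (f.toHom.f (r + 1) (p.negOnePow • N.act p (q + 1) (r + 1) _ a x) :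
        M.unshiftDeg (r + 1)).1 =
      M.act p q r h a (M.cx.castDeg _ (f.toHom.f (q + 1) x : M.unshiftDeg (q + 1)).1)
    rw [h₂, h₁, smul_smul, Int.units_mul_self, one_smul, castDeg_act, act_castDeg]

/-- The action on `N[1]` contains the sign `(-1)^p`, which is its own inverse and can be moved to
the other side. -/
lemma shift_map_act {N : DgMod A} (f : Hom N.shift M) (p q r : ℤ) (h : p + (q + 1) = r + 1)
    (a : A.cx.X p) (x : N.cx.X (q + 1)) :
    f.toHom.f r (N.act p (q + 1) (r + 1) h a x) =
      p.negOnePow • M.act p q r (by omega) a (f.toHom.f q x) := by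
  have h₁ : f.toHom.f r (p.negOnePow • N.act p (q + 1) (r + 1) h a x) =
      M.act p q r (by omega) a (f.toHom.f q x) := f.map_act p q r (by omega) a x
  rw [← h₁]
  refine Eq.trans ?_ (congrArg (p.negOnePow • ·)
    ((f.toHom.f r).hom.map_smul_of_tower p.negOnePow _).symm)
  exact (inv_smul_smul p.negOnePow _).symm.trans (by rw [Int.units_inv_eq_self])

lemma shift_map_d {N : DgMod A} (f : Hom N.shift M) (p q : ℤ) (x : N.cx.X (p + 1)) :
    f.toHom.f q (N.cx.d (p + 1) (q + 1) x) = -M.cx.d p q (f.toHom.f p x) := by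
  have h₁ : f.toHom.f q (-N.cx.d (p + 1) (q + 1) x) = M.cx.d p q (f.toHom.f p x) :=
    CochainComplex.map_d_apply f.toHom (p := p) (q := q) x
  rw [← h₁]
  refine Eq.trans ?_ ((f.toHom.f q).hom.map_neg _)
  exact congrArg (f.toHom.f q) (neg_neg _).symm

/-- A morphism out of the shifted Kähler differentials is determined on exact differentials. -/
lemma kahler_shift_hom_ext {f g : Hom (kahler A).shift M}
    (h : ∀ (n : ℤ) (a : A.cx.X (n + 1)),
      f.toHom.f n ((Kahler.del A).f (n + 1) a) = g.toHom.f n ((Kahler.del A).f (n + 1) a)) :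
    f = g := by
  -- Induction on differentials runs over all degrees `m`, whereas the shift only shows degrees of
  -- the form `n + 1`; hence the generalization to `m = n + 1` with a cast.
  suffices H : ∀ (m : ℤ) (x : (kahler A).cx.X m) (n : ℤ) (hm : m = n + 1),
      f.toHom.f n ((kahler A).cx.castDeg hm x) = g.toHom.f n ((kahler A).cx.castDeg hm x) from
    Hom.ext (CochainComplex.hom_ext_apply fun n x => H _ x n rfl)
  intro m x
  induction x using Kahler.induction with
  | del m a =>
    rintro n rfl
    exact h n a
  | zero m =>
    rintro n rfl
    exact (map_zero (f.toHom.f n).hom).trans (map_zero (g.toHom.f n).hom).symm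
  | add m x y hx hy =>
    rintro n rfl
    exact (map_add (f.toHom.f n).hom x y).trans ((congrArg₂ (· + ·) (hx n rfl) (hy n rfl)).trans
      (map_add (g.toHom.f n).hom x y).symm)
  | smul m c x hx =>
    rintro n rfl
    exact (map_smul (f.toHom.f n).hom c x).trans ((congrArg (c • ·) (hx n rfl)).trans
      (map_smul (g.toHom.f n).hom c x).symm)
  | act p q r h a x hx =>
    rintro n rfl
    obtain ⟨q, rfl⟩ : ∃ q', q = q' + 1 := ⟨q - 1, by omega⟩
    exact (shift_map_act f p q n h a x).trans ((congrArg (fun y => p.negOnePow • M.act p q n (by omega) a y)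
      (hx q rfl)).trans (shift_map_act g p q n h a x).symm)
  | d p q h x hx =>
    rintro n rfl
    obtain ⟨p, rfl⟩ : ∃ p', p = p' + 1 := ⟨p - 1, by omega⟩
    exact (shift_map_d f p n x).trans ((congrArg (fun y => -M.cx.d p n y) (hx p rfl)).trans
      (shift_map_d g p n x).symm)

end DgMod

variable {k : Type u} [CommRing k]

namespace Cdga

/-! ### The cofree `ε`-cdga -/

section cofree

variable (B : Cdga k)

/-- The zero derivation. -/
def zeroDerivation : EpsCdga.ScaledDerivation B.withZeroEps where
  D _ := 0
  c := 1
  map_mul _ _ _ _ _ _ := by simp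
  map_d _ _ _ := by simp
  map_eps _ _ _ _ := by simp
  smul_eq_zero _ _ := by simp

/-- The cofree `ε`-cdga on a cdga `B`: the truncation in degrees `≤ 0` of `B[η]`, with
`ε(x + ηy) = y`. -/
def cofree : EpsCdga k := B.zeroDerivation.thicken.toEpsCdga

/-- The counit of the cofree `ε`-cdga. -/
def cofreeFst : B.cofree.alg ⟶ B where
  toHom := CochainComplex.homMk
    (fun n => (LinearMap.fst k _ _).comp (B.zeroDerivation.thickening n).subtype)
    (fun _ q h x => congrArg (fun z : B.zeroDerivation.thickening q => z.1.1)
      (B.zeroDerivation.thicken.toEpsCdga_d h x))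
  map_one := rfl
  map_mul _ _ _ _ _ _ := rfl

variable {B} {A : Cdga k} (φ : A ⟶ B) (s : ∀ n : ℤ, A.cx.X n →ₗ[k] B.cx.X (n - 1))
  (hd : ∀ p q : ℤ, p + 1 = q → ∀ a : A.cx.X p,
    s q (A.cx.d p q a) = -B.cx.d (p - 1) (q - 1) (s p a))
  (hm : ∀ (p q r : ℤ) (h : p + q = r) (a : A.cx.X p) (b : A.cx.X q),
    s r (A.mul p q r h a b) =
      B.mul (p - 1) q (r - 1) (by omega) (s p a) (φ.toHom.f q b) +
        p.negOnePow • B.mul p (q - 1) (r - 1) (by omega) (φ.toHom.f p a) (s q b))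

-- As `da` has positive degree, it is zero, and `d (s a) = -s (da)`. Hence `s` takes values in the
-- truncation.
include hd in
lemma d_eq_zero_of_nonneg {n : ℤ} (hn : 0 ≤ n) (a : A.cx.X n) : B.cx.d (n - 1) n (s n a) = 0 := by
  have h := hd n (n + 1) rfl a
  rw [A.eq_zero_of_pos (by omega) (A.cx.d n (n + 1) a), map_zero, zero_eq_neg] at h
  rw [← B.cx.castDeg_d (add_sub_cancel_right n 1), h, map_zero]

include hm in
lemma map_one_eq_zero : s 0 A.one = 0 := by
  have h := hm 0 0 0 (by omega) A.one A.one
  rw [φ.map_one, B.mul_comm (0 - 1) 0 (0 - 1) _ (s 0 A.one) B.one, A.one_mul, B.one_mul] at h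
  simpa using h

include hd in
/-- The components of a morphism to the cofree `ε`-cdga. -/
def cofreeLiftDeg (n : ℤ) : A.cx.X n →ₗ[k] B.zeroDerivation.thickening n where
  toFun a := ⟨⟨φ.toHom.f n a, s n a⟩, fun hn => d_eq_zero_of_nonneg s hd hn a, fun hn =>
    (congrArg (s n) (A.eq_zero_of_pos hn a)).trans (map_zero (s n))⟩
  map_add' a b := EpsCdga.ScaledDerivation.thickening_ext (map_add (φ.toHom.f n).hom a b)
    (map_add (s n) a b)
  map_smul' c a := EpsCdga.ScaledDerivation.thickening_ext (map_smul (φ.toHom.f n).hom c a)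
    (map_smul (s n) c a)

include hd in
lemma cofreeLiftDeg_d (p q : ℤ) (h : p + 1 = q) (a : A.cx.X p) :
    cofreeLiftDeg φ s hd q (A.cx.d p q a) =
      B.zeroDerivation.thickeningD p q h (cofreeLiftDeg φ s hd p a) :=
  EpsCdga.ScaledDerivation.thickening_ext (CochainComplex.map_d_apply φ.toHom a)
    ((hd p q h a).trans (by
      change _ = (B.withZeroEps.castX (by omega) 0 : B.withZeroEps.X (q - 1)) -
        B.withZeroEps.d (p - 1) (q - 1) (s p a)
      rw [map_zero, zero_sub]
      rfl))

/-- The morphism to the cofree `ε`-cdga given by a morphism and a derivation of degree `-1`. -/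
def cofreeLift : A ⟶ B.cofree.alg where
  toHom := CochainComplex.homMk (L := B.cofree.alg.cx) (cofreeLiftDeg φ s hd)
    (fun p q h a => (cofreeLiftDeg_d φ s hd p q h a).trans
      (B.zeroDerivation.thicken.toEpsCdga_d h _).symm)
  map_one := EpsCdga.ScaledDerivation.thickening_ext φ.map_one (map_one_eq_zero φ s hm)
  map_mul p q r h a b := EpsCdga.ScaledDerivation.thickening_ext (φ.map_mul p q r h a b)
    (hm p q r h a b)

lemma cofreeLift_fst : cofreeLift φ s hd hm ≫ B.cofreeFst = φ :=
  Hom.ext (CochainComplex.hom_ext_apply fun _ _ => rfl)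

/-- With `c = 1` and zero operator on `B`, the projection of `ε (x + ηy)` is the `η`-component `y`.
-/
lemma fst_eps_cofreeLift (p : ℤ) (a : A.cx.X p) :
    B.cofreeFst.toHom.f (p - 1)
      (B.cofree.eps p (p - 1) (by omega) ((cofreeLift φ s hd hm).toHom.f p a)) = s p a := by
  change (0 : B.cx.X (p - 1)) + (1 : k) • s p a = s p a
  rw [zero_add, one_smul]

end cofree

/-- The cofree lift of a morphism out of the cdga underlying an `ε`-cdga. -/
def cofreeAdjunct {E : EpsCdga k} {B : Cdga k} (χ : E.alg ⟶ B) : E ⟶ B.cofree where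
  algHom := cofreeLift χ
    (fun n => (χ.toHom.f (n - 1)).hom.comp (E.eps n (n - 1) (by omega)))
    (fun p q h a => by
      obtain rfl : p = q - 1 := by omega
      change χ.toHom.f (q - 1) (E.eps q (q - 1) _ (E.d (q - 1) q a)) =
        -B.cx.d (q - 1 - 1) (q - 1) (χ.toHom.f (q - 1 - 1) (E.eps (q - 1) (q - 1 - 1) _ a))
      rw [E.d_eps' (q - 1) (q - 1 - 1) q (by omega) h a, ← CochainComplex.map_d_apply]
      exact map_neg (χ.toHom.f (q - 1)).hom _)
    (fun p q r h a b => by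
      change χ.toHom.f (r - 1) (E.eps r (r - 1) _ (E.mul p q r h a b)) =
        B.mul (p - 1) q (r - 1) _ (χ.toHom.f (p - 1) (E.eps p (p - 1) _ a)) (χ.toHom.f q b) +
          p.negOnePow • B.mul p (q - 1) (r - 1) _ (χ.toHom.f p a)
            (χ.toHom.f (q - 1) (E.eps q (q - 1) _ b))
      rw [E.eps_mul p q r (p - 1) (q - 1) (r - 1) h (by omega) (by omega) (by omega),
        ← χ.map_mul, ← χ.map_mul]
      exact (map_add (χ.toHom.f (r - 1)).hom _ _).trans
        (congrArg (_ + ·) ((χ.toHom.f (r - 1)).hom.map_smul_of_tower p.negOnePow _)))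
  map_eps p q h a := by
    obtain rfl : q = p - 1 := by omega
    refine EpsCdga.ScaledDerivation.thickening_ext (Eq.symm ?_) ?_
    · exact fst_eps_cofreeLift _ _ _ _ _ _
    -- The `η`-components agree since `ε² = 0` in `E` while `B` carries the zero operator.
    · change χ.toHom.f (p - 1 - 1) (E.eps (p - 1) (p - 1 - 1) _ (E.eps p (p - 1) h a)) =
        -(0 : B.cx.X (p - 1 - 1))
      rw [E.eps_eps, map_zero, neg_zero]

lemma cofreeAdjunct_fst {E : EpsCdga k} {B : Cdga k} (χ : E.alg ⟶ B) :
    (cofreeAdjunct χ).algHom ≫ B.cofreeFst = χ :=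
  Hom.ext (CochainComplex.hom_ext_apply fun _ _ => rfl)

/-! ### The de Rham construction -/

section deRham

/-- The free `ε`-cdga on a cdga, as an extension. -/
def deRhamExt (A : Cdga k) : EpsCdga.ExtData k where
  A := A.withZeroEps
  S _ := PEmpty
  B _ := PEmpty
  good _ _ _ _ _ := False
  -- `A` enters as a mere cdga: the zero operator that packages it as an `ε`-cdga must not be
  -- imposed on the extension.
  keepEps := False
  noEps := False

/-- The free `ε`-cdga on a cdga. -/
def deRham (A : Cdga k) : EpsCdga k := A.deRhamExt.obj

/-- The inclusion of `A` in the free `ε`-cdga. -/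
def deRhamι (A : Cdga k) : A ⟶ A.deRham.alg := A.deRhamExt.algι

variable {A : Cdga k} {E : EpsCdga k}

/-- The universal property of the free `ε`-cdga. -/
def deRhamLift (φ : A ⟶ E.alg) : A.deRham ⟶ E :=
  EpsCdga.ExtData.lift (X := A.deRhamExt) φ (fun _ x => x.elim) (fun h => h.elim)
    (fun _ _ _ _ _ b => b.elim) (fun h => h.elim) (fun _ _ _ _ _ _ b => b.elim)
    (fun _ _ _ _ _ _ b => b.elim)

@[simp]
lemma deRhamι_lift (φ : A ⟶ E.alg) : A.deRhamι ≫ (deRhamLift φ).algHom = φ :=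
  EpsCdga.ExtData.algι_lift (X := A.deRhamExt) _ _ _ _ _ _ _

lemma deRham_hom_ext {f g : A.deRham ⟶ E} (h : A.deRhamι ≫ f.algHom = A.deRhamι ≫ g.algHom) :
    f = g :=
  EpsCdga.ExtData.hom_ext (X := A.deRhamExt) h (fun _ x => x.elim) (fun _ _ _ _ b => b.elim)

variable (A E) in
/-- Morphisms out of the free `ε`-cdga. -/
def deRhamEquiv : (A.deRham ⟶ E) ≃ (A ⟶ E.alg) where
  toFun f := A.deRhamι ≫ f.algHom
  invFun := deRhamLift
  left_inv _ := deRham_hom_ext (deRhamι_lift _)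
  right_inv := deRhamι_lift

variable (k) in
/-- The free `ε`-cdga, as a functor. -/
def deRhamFunctor : Cdga k ⥤ EpsCdga k where
  obj := deRham
  map {_ B} f := deRhamLift (f ≫ B.deRhamι)
  map_id _ := deRham_hom_ext ((deRhamι_lift _).trans (Category.id_comp _))
  map_comp {_ B _} f g := deRham_hom_ext ((deRhamι_lift _).trans (by
    change _ = deRhamι _ ≫ (deRhamLift (f ≫ B.deRhamι)).algHom ≫ (deRhamLift _).algHom
    rw [← Category.assoc (deRhamι _), deRhamι_lift, Category.assoc, Category.assoc, deRhamι_lift]))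

variable (k) in
/-- The adjunction between the free `ε`-cdga and the forgetful functor. -/
def deRhamAdj : deRhamFunctor k ⊣ EpsCdga.forget k :=
  Adjunction.mkOfHomEquiv
    { homEquiv := deRhamEquiv
      homEquiv_naturality_left_symm := fun {_ B _} f g => deRham_hom_ext ((deRhamι_lift _).trans (by
        change _ = deRhamι _ ≫ (deRhamLift (f ≫ B.deRhamι)).algHom ≫ (deRhamLift g).algHom
        rw [← Category.assoc (deRhamι _), deRhamι_lift, Category.assoc]
        exact congrArg (f ≫ ·) (deRhamι_lift g).symm))
      homEquiv_naturality_right := fun _ _ => rfl }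

lemma deRhamAdj_unit_app (A : Cdga k) : (deRhamAdj k).unit.app A = A.deRhamι := by
  simp only [deRhamAdj, Adjunction.mkOfHomEquiv_unit_app]
  exact Category.comp_id A.deRhamι

end deRham

end Cdga

/-! ### The free `ε`-cdga as a symmetric algebra on shifted differentials -/

variable {k : Type u} [CommRing k]

namespace DgMod

variable {A : Cdga k}

lemma _root_.EpsCdga.d_eps_of_nonneg (E : EpsCdga k) {n : ℤ} (hn : 0 ≤ n) (x : E.X n) :
    E.d (n - 1) n (E.eps n (n - 1) (by omega) x) = 0 := by
  have h := E.d_eps' n (n - 1) (n + 1) (by omega) rfl x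
  rwa [E.eq_zero_of_pos (by omega) (E.d n (n + 1) x), map_zero, zero_eq_neg] at h

/-- The derivation of `A` of degree `-1` given by `ε` in an `ε`-cdga under `A`. -/
def epsDerivation {E : EpsCdga k} (i : A ⟶ E.alg) : A.cx ⟶ (ofHom i).unshift.cx :=
  CochainComplex.homMk (L := (ofHom i).unshift.cx)
    (fun n => LinearMap.codRestrict ((ofHom i).unshiftDeg n)
      ((E.eps n (n - 1) (by omega)).comp (i.toHom.f n).hom)
      fun a => ⟨fun hn => E.d_eps_of_nonneg hn _, fun hn =>
        (congrArg (E.eps n (n - 1) _) (E.eq_zero_of_pos hn _)).trans (map_zero _)⟩)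
    (fun p q h a => Eq.trans (Subtype.ext (by
        obtain rfl : p = q - 1 := by omega
        change E.eps q (q - 1) _ (i.toHom.f q (A.cx.d (q - 1) q a)) =
          -E.d (q - 1 - 1) (q - 1) (E.eps (q - 1) (q - 1 - 1) _ (i.toHom.f (q - 1) a))
        rw [← E.d_eps' (q - 1) (q - 1 - 1) q (by omega) h, CochainComplex.map_d_apply]
        rfl))
      (unshift_d h _).symm)

/-- Exchanging `ε(a)` and `b` costs `(-1)^((p-1)q) = (-1)^(pq) (-1)^q`; the first factor is the sign
in the definition of a derivation, the second is the sign of the action on `M[-1]`. -/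
lemma isDerivation_epsDerivation {E : EpsCdga k} (i : A ⟶ E.alg) :
    IsDerivation (epsDerivation i) where
  map_mul p q r h a b := Subtype.ext (by
    change E.eps r (r - 1) (by omega) (i.toHom.f r (A.mul p q r h a b)) =
      (p * q).negOnePow • q.negOnePow • E.mul q (p - 1) (r - 1) (by omega) (i.toHom.f q b)
          (E.eps p (p - 1) (by omega) (i.toHom.f p a)) +
        p.negOnePow • E.mul p (q - 1) (r - 1) (by omega) (i.toHom.f p a)
          (E.eps q (q - 1) (by omega) (i.toHom.f q b))
    rw [i.map_mul, E.eps_mul p q r (p - 1) (q - 1) (r - 1) h (by omega) (by omega) (by omega),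
      E.alg.mul_comm (p - 1) q, sub_mul, one_mul, Int.negOnePow_sub, mul_smul])

variable (A) in
/-- The morphism from the shifted Kähler differentials to the de Rham `ε`-cdga. -/
def kahlerToDeRham : Hom (kahler A).shift (ofHom A.deRhamι) :=
  shiftHom (Kahler.lift (isDerivation_epsDerivation A.deRhamι))

lemma kahlerToDeRham_del (p q : ℤ) (h : q + 1 = p) (a : A.cx.X p) :
    (kahlerToDeRham A).toHom.f q ((kahler A).cx.castDeg h.symm ((Kahler.del A).f p a)) =
      A.deRham.eps p q h (A.deRhamι.toHom.f p a) := by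
  subst h
  have H (r : ℤ) (hr : r + 1 = q + 1) (h : r = q) (x : A.deRham.X (q + 1)) :
      A.deRham.alg.cx.castDeg h (A.deRham.eps (q + 1) r hr x) =
        A.deRham.eps (q + 1) q rfl x := by
    subst h
    rfl
  exact H (q + 1 - 1) (by omega) (by omega) (A.deRhamι.toHom.f (q + 1) a)

/-- The derivation of degree `-1` given by a morphism from the shifted Kähler differentials. -/
def shiftDerivation {M : DgMod A} (ψ : Hom (kahler A).shift M) (n : ℤ) :
    A.cx.X n →ₗ[k] M.cx.X (n - 1) :=
  (ψ.toHom.f (n - 1)).hom.comp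
    (((kahler A).cx.castDeg (sub_add_cancel n 1).symm).comp ((Kahler.del A).f n).hom)

lemma shiftDerivation_apply {M : DgMod A} (ψ : Hom (kahler A).shift M) (n : ℤ) (a : A.cx.X n) :
    shiftDerivation ψ n a = ψ.toHom.f (n - 1)
      ((kahler A).cx.castDeg (sub_add_cancel n 1).symm ((Kahler.del A).f n a)) :=
  rfl

lemma shiftDerivation_d {M : DgMod A} (ψ : Hom (kahler A).shift M) (p q : ℤ)
    (a : A.cx.X p) :
    shiftDerivation ψ q (A.cx.d p q a) = -M.cx.d (p - 1) (q - 1) (shiftDerivation ψ p a) := by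
  rw [shiftDerivation_apply, shiftDerivation_apply, ← shift_map_d, CochainComplex.d_castDeg,
    CochainComplex.map_d_apply, CochainComplex.castDeg_d]

/-- Converse sign bookkeeping: the action on the shift turns the degree `0` rule for `∂` into the
graded rule in degree `-1` required of maps to the cofree `ε`-cdga. -/
lemma shiftDerivation_mul {B : Cdga k} {φ : A ⟶ B} (ψ : Hom (kahler A).shift (ofHom φ))
    (p q r : ℤ) (h : p + q = r) (a : A.cx.X p) (b : A.cx.X q) :
    shiftDerivation ψ r (A.mul p q r h a b) =
      B.mul (p - 1) q (r - 1) (by omega) (shiftDerivation ψ p a) (φ.toHom.f q b) +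
        p.negOnePow • B.mul p (q - 1) (r - 1) (by omega) (φ.toHom.f p a)
          (shiftDerivation ψ q b) := by
  have key (p q r : ℤ) (h : p + q = r) (a : A.cx.X p) (b : A.cx.X q) :
      ψ.toHom.f (r - 1) ((kahler A).cx.castDeg (sub_add_cancel r 1).symm
        ((kahler A).act p q r h a ((Kahler.del A).f q b))) =
      p.negOnePow • B.mul p (q - 1) (r - 1) (by omega) (φ.toHom.f p a)
        (shiftDerivation ψ q b) := by
    refine Eq.trans (congrArg (ψ.toHom.f (r - 1)) ?_) (shift_map_act ψ p (q - 1) (r - 1)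
      (by omega) a ((kahler A).cx.castDeg (sub_add_cancel q 1).symm ((Kahler.del A).f q b)))
    rw [castDeg_act, act_castDeg]
  have comm (x : B.cx.X (p - 1)) (y : B.cx.X q) : B.mul (p - 1) q (r - 1) (by omega) x y =
      (p * q).negOnePow • q.negOnePow • B.mul q (p - 1) (r - 1) (by omega) y x := by
    rw [B.mul_comm (p - 1) q, sub_mul, one_mul, Int.negOnePow_sub, mul_smul]
  refine Eq.trans ?_ (congrArg₂ (· + ·) ((congrArg ((p * q).negOnePow • ·)
    (key q p r (by omega) b a)).trans (comm _ _).symm) (key p q r h a b))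
  rw [shiftDerivation_apply, Kahler.isDerivation_del.map_mul p q r h a b, map_add,
    LinearMap.map_smul_of_tower]
  exact (map_add (ψ.toHom.f (r - 1)).hom _ _).trans (congrArg (· + _)
    ((ψ.toHom.f (r - 1)).hom.map_smul_of_tower (p * q).negOnePow _))

/-- The `ε`-cdga morphism from `A.deRham` to the cofree `ε`-cdga on `B` given by `φ` and `ψ`. -/
def deRhamToCofree {B : Cdga k} {φ : A ⟶ B} (ψ : Hom (kahler A).shift (ofHom φ)) :
    A.deRham ⟶ B.cofree :=
  Cdga.deRhamLift (Cdga.cofreeLift φ (shiftDerivation ψ) (fun p q _ => shiftDerivation_d ψ p q)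
    (shiftDerivation_mul ψ))

section deRhamToCofree

variable {B : Cdga k} {φ : A ⟶ B} (ψ : Hom (kahler A).shift (ofHom φ))

lemma deRhamι_deRhamToCofree :
    A.deRhamι ≫ (deRhamToCofree ψ).algHom =
      Cdga.cofreeLift φ (shiftDerivation ψ) (fun p q _ => shiftDerivation_d ψ p q)
        (shiftDerivation_mul ψ) :=
  Cdga.deRhamι_lift _

lemma deRhamι_deRhamToCofree_fst :
    A.deRhamι ≫ (deRhamToCofree ψ).algHom ≫ B.cofreeFst = φ := by
  rw [← Category.assoc, deRhamι_deRhamToCofree]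
  exact Cdga.cofreeLift_fst _ _ _ _

lemma deRhamToCofree_fst_eps (p q : ℤ) (h : q + 1 = p) (a : A.cx.X p) :
    ((deRhamToCofree ψ).algHom ≫ B.cofreeFst).toHom.f q
        (A.deRham.eps p q h (A.deRhamι.toHom.f p a)) =
      ψ.toHom.f q ((kahler A).cx.castDeg h.symm ((Kahler.del A).f p a)) := by
  obtain rfl : q = p - 1 := by omega
  exact (congrArg (B.cofreeFst.toHom.f (p - 1)) ((deRhamToCofree ψ).map_eps p (p - 1) h _)).trans
    (Cdga.fst_eps_cofreeLift φ _ (fun p q _ => shiftDerivation_d ψ p q) (shiftDerivation_mul ψ) p a)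

end deRhamToCofree

/-- The composition of a dg-module morphism to a cdga with a cdga morphism. -/
def Hom.compAlg {N : DgMod A} {E B : Cdga k} {i : A ⟶ E} (j : Hom N (ofHom i)) {φ : A ⟶ B}
    (χ : E ⟶ B) (h : i ≫ χ = φ) : Hom N (ofHom φ) where
  toHom := j.toHom ≫ χ.toHom
  map_act p q r hr a x := by
    subst h
    exact (congrArg (χ.toHom.f r) (j.map_act p q r hr a x)).trans (χ.map_mul p q r hr _ _)

/-- The pair `(φ, ψ)` defines a cdga map from `A` to the cofree `ε`-cdga on `B`, with components `φ`
and `ψ ∘ ∂`. It extends to the free `ε`-cdga, and projecting to `B` gives `χ`. The symmetric powers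
themselves are never computed. -/
lemma isFreeAlgebra_kahlerToDeRham : IsFreeAlgebra A.deRhamι (kahlerToDeRham A) := by
  intro B φ ψ
  refine ⟨(deRhamToCofree ψ).algHom ≫ B.cofreeFst, ⟨deRhamι_deRhamToCofree_fst ψ, ?_⟩, ?_⟩
  · have h : (kahlerToDeRham A).compAlg _ (deRhamι_deRhamToCofree_fst ψ) = ψ :=
      kahler_shift_hom_ext fun n a =>
        (congrArg (((deRhamToCofree ψ).algHom ≫ B.cofreeFst).toHom.f n)
          (kahlerToDeRham_del (n + 1) n rfl a)).trans
            (deRhamToCofree_fst_eps ψ (n + 1) n rfl a)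
    exact fun n x => congrArg (fun f : Hom (kahler A).shift (ofHom φ) => f.toHom.f n x) h
  · rintro χ ⟨h₁, h₂⟩
    -- Uniqueness: both sides are `ε`-morphisms out of the free `ε`-cdga, so they may be compared on
    -- `A`, where the first components agree by `h₁` and the `η`-components by `h₂` applied to `∂a`.
    have h : Cdga.cofreeAdjunct χ = deRhamToCofree ψ := by
      refine Cdga.deRham_hom_ext (Eq.trans ?_ (deRhamι_deRhamToCofree ψ).symm)
      refine Cdga.Hom.ext (CochainComplex.hom_ext_apply fun n a => ?_)
      refine EpsCdga.ScaledDerivation.thickening_ext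
        (congrArg (fun f : A ⟶ B => f.toHom.f n a) h₁) ?_
      exact (congrArg (χ.toHom.f (n - 1)) (kahlerToDeRham_del n (n - 1) (by omega) a).symm).trans
        (h₂ (n - 1) _)
    rw [← h, Cdga.cofreeAdjunct_fst]

lemma isDeRham_deRham (A : Cdga k) : IsDeRham A A.deRham A.deRhamι :=
  ⟨kahler A, Kahler.del A, kahlerToDeRham A, Kahler.isUniversalDerivation_del,
    isFreeAlgebra_kahlerToDeRham, fun n a => (kahlerToDeRham_del (n + 1) n rfl a).symm⟩

end DgMod

namespace EpsCdga

variable (k) [Algebra ℚ k]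

lemma isRightQuillen_forget :
    IsRightQuillen (cdgaModelCategory k) (epsCdgaModelCategory k) (forget k) where
  isRightAdjoint := (Cdga.deRhamAdj k).isRightAdjoint
  fibrations_le := le_rfl
  trivialFibrations_le := le_rfl

end EpsCdga

end

theorem proposition1p1 (k : Type u) [CommRing k] [Algebra ℚ k] :
    ∃ (M₀ : ModelCategory (Cdga k)) (M : ModelCategory (EpsCdga k)),
      IsModelStructure M₀ (Cdga.quasiIso k) (Cdga.surjNeg k) ∧
      IsModelStructure M (EpsCdga.quasiIso k) (EpsCdga.surjNeg k) ∧
      -- the model structure is transferred along the forgetful functor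
      weakEquivalences (EpsCdga k) =
        (weakEquivalences (Cdga k)).inverseImage (EpsCdga.forget k) ∧
      fibrations (EpsCdga k) = (fibrations (Cdga k)).inverseImage (EpsCdga.forget k) ∧
      IsRightQuillen M₀ M (EpsCdga.forget k) ∧
      -- the left adjoint is the de Rham construction
      ∃ (F : Cdga k ⥤ EpsCdga k) (adj : F ⊣ EpsCdga.forget k),
        ∀ A : Cdga k, IsDeRham A (F.obj A) (adj.unit.app A) :=
  ⟨EpsCdga.cdgaModelCategory k, EpsCdga.epsCdgaModelCategory k, EpsCdga.isModelStructure_cdga k,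
    EpsCdga.isModelStructure_epsCdga k, rfl, rfl, EpsCdga.isRightQuillen_forget k, _,
    Cdga.deRhamAdj k, fun A => (Cdga.deRhamAdj_unit_app A).symm ▸ DgMod.isDeRham_deRham A⟩
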